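/- Let $P$ be a simple polygon in the plane with $n\ge 3$ vertices, no three of which are collinear; that is, $P$ is the closed region bounded by a simple closed polygonal curve with $n$ vertices. For $s\in\operatorname{int}(P)$ let $V_0(s)$ be the set of points $t\in P$ such that the relative interior of the segment $st$ lies in $\operatorname{int}(P)$. The pockets of $V_0(s)$ are the connected components of $P\setminus\operatorname{cl}(V_0(s))$, and the size of a pocket is the number of vertices of $P$ that lie on the boundary of the pocket. For an integer $q\ge 0$, the generalized kernel $K_q(P)$ is the set of points $s\in\operatorname{int}(P)$ such that every pocket of $V_0(s)$ has size at most $q$. Then $K_{\lfloor n/2\rfloor-1}(P)$ has nonempty interior. -/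

import Mathlib

namespace GenKernel

/-- The Euclidean plane. -/
abbrev Plane : Type := EuclideanSpace ℝ (Fin 2)

variable {n : ℕ}

/-- The closed polygonal curve with vertices `p 0, …, p (n - 1)` is simple: its vertices are
distinct, consecutive edges meet only in their common vertex, and all other pairs of distinct
edges are disjoint. Edge `i` is the segment from `p i` to `p (finRotate n i)`, where
`finRotate n` is the cyclic successor on `Fin n`. -/
structure IsSimple (p : Polygon Plane n) : Prop where
  injective : Function.Injective p.vertices
  consecutive : ∀ i : Fin n,
    p.edgeSet ℝ i ∩ p.edgeSet ℝ (finRotate n i) = {p (finRotate n i)}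
  disjoint : ∀ i j : Fin n, j ≠ i → j ≠ finRotate n i → i ≠ finRotate n j →
    Disjoint (p.edgeSet ℝ i) (p.edgeSet ℝ j)

/-- General position: no three of the vertices are collinear. -/
def InGeneralPosition (p : Polygon Plane n) : Prop :=
  ∀ i j k : Fin n, i ≠ j → j ≠ k → i ≠ k → ¬ Collinear ℝ {p i, p j, p k}

/-- The closed region `P` bounded by the polygonal curve: the curve together with the bounded
connected components of its complement. -/
def region (p : Polygon Plane n) : Set Plane :=
  p.boundary ℝ ∪
    {x | x ∉ p.boundary ℝ ∧ Bornology.IsBounded (connectedComponentIn (p.boundary ℝ)ᶜ x)}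

/-- The visibility region `V₀(s)`: the points `t` of `P` such that the relative interior of the
segment `st` lies in the interior of `P`. -/
def visible (p : Polygon Plane n) (s : Plane) : Set Plane :=
  {t | t ∈ region p ∧ openSegment ℝ s t ⊆ interior (region p)}

/-- `U` is a pocket of `V₀(s)`: a connected component of `P \ cl V₀(s)`. -/
def IsPocket (p : Polygon Plane n) (s : Plane) (U : Set Plane) : Prop :=
  ∃ x ∈ region p \ closure (visible p s),
    U = connectedComponentIn (region p \ closure (visible p s)) x

/-- The size of a pocket: the number of vertices of `P` on the boundary of the pocket. -/
noncomputable def pocketSize (p : Polygon Plane n) (U : Set Plane) : ℕ :=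
  (Set.range p.vertices ∩ frontier U).ncard

/-- The generalized kernel `K_q(P)`: the points `s` in the interior of `P` such that every pocket
of `V₀(s)` has size at most `q`. -/
def genKernel (p : Polygon Plane n) (q : ℕ) : Set Plane :=
  {s | s ∈ interior (region p) ∧ ∀ U : Set Plane, IsPocket p s U → pocketSize p U ≤ q}

end GenKernel

/-! ### Cross product and oriented angles. -/

namespace GenKernel
open Set Filter Topology

/-! Call two vertices linked if they are adjacent or joined by a diagonal. For a suitable vertex
`a`, take `s` inside the polygon and so near `a` that `s` sees `a` and all vertices linked to it;
such `s` fill an open set (`exists_viewpoints`). A pocket is connected and misses every segment from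
`s` to a visible boundary point, so these segments confine it: if it is adherent to an invisible
vertex, then all its vertices lie on one boundary chain between two visible vertices `l` and `u`. A
chain of `g` edges has `g + 1` vertices, but the pocket is not adherent to both ends: between two
visible vertices there is a visible boundary point that is not a vertex, and the segments from `s`
to that point and to a third visible vertex separate the two (`not_mem_closure_of_visible`). So the
pocket has at most `g` vertices (`ncard_adherent_le`). It remains to choose `a` such that all these
chains have at most `n / 2 - 1` edges (`exists_balanced`).

The choice of `a` is a centroid argument for a triangulation, but no triangulation is built. It
suffices that a link spanning a chain of at least two edges is a side of a triangle whose apex is on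
that chain and linked to both ends (`exists_triangle`). A shortest chain of at least `n / 2` edges
spanned by a link is split by its apex into two short chains; the complementary chain has at most `n
- n / 2` edges and needs at most two more apexes. All division points can be linked to a common end
of the first link. The apex itself is the lowest vertex visible from a generic point of the base;
that it sees both ends of the base follows by sweeping a triangle (`exists_sweep`).

The topology rests on winding numbers, defined as sums of angles and used only modulo 2. They give
the Jordan curve theorem for polygons (`exists_two_components`). Two segments from `s` to the
boundary close the two boundary arcs to two cycles, whose winding numbers add up to that of the
polygon, which is odd inside. So every inner point off the cut is enclosed, modulo 2, by exactly one
of the cycles, and a connected set missing the cut stays on one side (`IsCut.subset_or_subset`).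

For `n = 3` the bound is zero; there the region is convex and has no pockets. -/

/-- The two-dimensional cross product. -/
def cross (u v : Plane) : ℝ := u 0 * v 1 - u 1 * v 0

lemma cross_add_left (u u' v : Plane) : cross (u + u') v = cross u v + cross u' v := by
  simp [cross]; ring

lemma cross_add_right (u v v' : Plane) : cross u (v + v') = cross u v + cross u v' := by
  simp [cross]; ring

lemma cross_smul_left (c : ℝ) (u v : Plane) : cross (c • u) v = c * cross u v := by
  simp [cross]; ring

lemma cross_smul_right (c : ℝ) (u v : Plane) : cross u (c • v) = c * cross u v := by
  simp [cross]; ring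

lemma cross_self (u : Plane) : cross u u = 0 := by
  simp [cross]; ring

lemma cross_swap (u v : Plane) : cross v u = -cross u v := by
  simp [cross]; ring

lemma cross_neg_left (u v : Plane) : cross (-u) v = -cross u v := by
  simp [cross]; ring

lemma cross_neg_right (u v : Plane) : cross u (-v) = -cross u v := by
  simp [cross]; ring

@[fun_prop]
lemma continuous_cross {X : Type*} [TopologicalSpace X] {f g : X → Plane}
    (hf : Continuous f) (hg : Continuous g) : Continuous fun x => cross (f x) (g x) := by
  unfold cross; fun_prop

/-- Two plane vectors with vanishing cross product are proportional. -/
lemma exists_eq_smul_of_cross_eq_zero {u v : Plane} (hu : u ≠ 0) (h : cross u v = 0) :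
    ∃ c : ℝ, v = c • u := by
  have hh : u 0 * v 1 = u 1 * v 0 := by unfold cross at h; linarith
  by_cases h0 : u 0 = 0
  · have h1 : u 1 ≠ 0 := by
      intro h1; apply hu; ext i; fin_cases i <;> simp [h0, h1]
    refine ⟨v 1 / u 1, ?_⟩
    ext i; fin_cases i
    · simp only [h0, zero_mul] at hh
      have : v 0 = 0 := by
        rcases mul_eq_zero.1 hh.symm with h | h
        · exact absurd h h1
        · exact h
      simp [h0, this]
    · simp; field_simp
  · refine ⟨v 0 / u 0, ?_⟩
    ext i; fin_cases i
    · simp; field_simp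
    · simp; field_simp; linarith

/-- Cramer's rule in the plane. -/
lemma cross_smul_eq (u v w : Plane) :
    cross u v • w = cross w v • u + cross u w • v := by
  ext i; fin_cases i <;> simp [cross] <;> ring

/-- The plane as complex numbers. -/
noncomputable def toC (x : Plane) : ℂ := x 0 + x 1 * Complex.I

@[simp] lemma toC_re (x : Plane) : (toC x).re = x 0 := by simp [toC]
@[simp] lemma toC_im (x : Plane) : (toC x).im = x 1 := by simp [toC]

@[fun_prop]
lemma continuous_toC : Continuous toC := by unfold toC; fun_prop

lemma toC_eq_zero {x : Plane} : toC x = 0 ↔ x = 0 := by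
  constructor
  · intro h
    have h0 := congrArg Complex.re h
    have h1 := congrArg Complex.im h
    rw [toC_re] at h0
    rw [toC_im] at h1
    ext i; fin_cases i
    · exact h0
    · exact h1
  · rintro rfl; simp [toC]

lemma toC_sub (x y : Plane) : toC (x - y) = toC x - toC y := by
  simp [toC]; ring

lemma norm_toC (x : Plane) : ‖toC x‖ = ‖x‖ := by
  rw [EuclideanSpace.norm_eq, Complex.norm_def, Complex.normSq_apply]
  simp [Fin.sum_univ_two, sq]

lemma toC_div_im (u v : Plane) : (toC v / toC u).im = cross u v / Complex.normSq (toC u) := by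
  rw [Complex.div_im]; simp [cross]; ring

/-- The oriented angle under which the point `x` sees the segment from `a` to `b`. -/
noncomputable def ang (x a b : Plane) : ℝ := Complex.arg (toC (b - x) / toC (a - x))

/-- A quotient on the closed negative real axis would make `b - x` a nonpositive multiple of `a - x`
and so put `x` between `a` and `b`. Hence the branch cut of `arg` is met only on the segment itself.
-/
lemma div_mem_slitPlane {x a b : Plane} (hx : x ∉ segment ℝ a b) :
    toC (b - x) / toC (a - x) ∈ Complex.slitPlane := by
  have ha : a - x ≠ 0 := by
    intro h; rw [sub_eq_zero] at h; exact hx (h ▸ left_mem_segment ℝ a b)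
  by_contra hs
  rw [Complex.mem_slitPlane_iff, not_or, not_lt, not_not] at hs
  obtain ⟨hre, him⟩ := hs
  have hN : 0 < Complex.normSq (toC (a - x)) := by
    rw [Complex.normSq_pos]; exact fun h => ha (toC_eq_zero.1 h)
  rw [toC_div_im, div_eq_zero_iff] at him
  obtain ⟨c, hc⟩ := exists_eq_smul_of_cross_eq_zero ha (him.resolve_right hN.ne')
  have hcx : toC (b - x) / toC (a - x) = c := by
    rw [div_eq_iff (fun h => ha (toC_eq_zero.1 h)), hc]; simp [toC]; ring
  rw [hcx, Complex.ofReal_re] at hre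
  apply hx
  refine ⟨-c / (1 - c), 1 / (1 - c), div_nonneg (by linarith) (by linarith),
    div_nonneg (by norm_num) (by linarith), ?_, ?_⟩
  · have : 1 - c ≠ 0 := by linarith
    field_simp; ring
  · have h1 : 1 - c ≠ 0 := by linarith
    have hb : b = x + c • (a - x) := by rw [← hc]; abel
    rw [hb]
    ext i
    simp
    field_simp
    ring

lemma continuousAt_ang {x a b : Plane} (hx : x ∉ segment ℝ a b) :
    ContinuousAt (fun x => ang x a b) x := by
  have ha : toC (a - x) ≠ 0 := by
    intro h; rw [toC_eq_zero, sub_eq_zero] at h; exact hx (h ▸ left_mem_segment ℝ a b)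
  have : ContinuousAt (fun x => toC (b - x) / toC (a - x)) x := by
    exact ContinuousAt.div (by fun_prop : Continuous fun x => toC (b - x)).continuousAt
      (by fun_prop : Continuous fun x => toC (a - x)).continuousAt ha
  exact ContinuousAt.comp (f := fun x => toC (b - x) / toC (a - x))
    (Complex.continuousAt_arg (div_mem_slitPlane hx)) this

lemma coe_ang {x a b : Plane} (ha : x ≠ a) (hb : x ≠ b) :
    (ang x a b : Real.Angle) = (Complex.arg (toC (b - x)) : Real.Angle)
      - (Complex.arg (toC (a - x)) : Real.Angle) := by
  unfold ang
  apply Complex.arg_div_coe_angle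
  · rw [Ne, toC_eq_zero, sub_eq_zero]; exact hb.symm
  · rw [Ne, toC_eq_zero, sub_eq_zero]; exact ha.symm

lemma ang_swap {x a b : Plane} (hx : x ∉ segment ℝ a b) : ang x b a = -ang x a b := by
  unfold ang
  rw [← inv_div, Complex.arg_inv, if_neg]
  exact Complex.slitPlane_arg_ne_pi (div_mem_slitPlane hx)

/-- The quotient of the two directions is `1 + (b - a) / (a - x)`, which tends to 1 far away. -/
lemma tendsto_ang_cobounded (a b : Plane) :
    Tendsto (fun x => ang x a b) (Bornology.cobounded Plane) (𝓝 0) := by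
  have h1 : Tendsto (fun x : Plane => toC (b - x) / toC (a - x)) (Bornology.cobounded Plane)
      (𝓝 1) := by
    have h2 : Tendsto (fun x : Plane => toC (a - x)) (Bornology.cobounded Plane)
        (Bornology.cobounded ℂ) := by
      rw [tendsto_norm_atTop_iff_cobounded.symm]
      simp only [norm_toC]
      rw [tendsto_norm_atTop_iff_cobounded]
      exact tendsto_const_sub_cobounded a
    have h3 := (tendsto_inv₀_cobounded.comp h2).const_mul (toC (b - a))
    have h4 := h3.const_add 1
    simp only [mul_zero, add_zero] at h4
    refine h4.congr' ?_
    have : ∀ᶠ x : Plane in Bornology.cobounded Plane, x ≠ a := by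
      have : ({a} : Set Plane)ᶜ ∈ Bornology.cobounded Plane :=
        Bornology.IsBounded.compl (Bornology.isBounded_singleton (x := a))
      filter_upwards [this] with x hx using hx
    filter_upwards [this] with x hx
    have ha : toC (a - x) ≠ 0 := by
      intro h; rw [toC_eq_zero, sub_eq_zero] at h; exact hx h.symm
    simp only [Function.comp]
    field_simp
    simp only [toC_sub]; ring
  have h := (Complex.continuousAt_arg Complex.one_mem_slitPlane).tendsto.comp h1
  rw [Complex.arg_one] at h
  exact h

lemma ang_eq_zero {x a b : Plane} (hx : x ∉ segment ℝ a b) (h : cross (a - x) (b - x) = 0) :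
    ang x a b = 0 := by
  unfold ang
  have := div_mem_slitPlane hx
  rw [Complex.mem_slitPlane_iff] at this
  have him : (toC (b - x) / toC (a - x)).im = 0 := by rw [toC_div_im, h, zero_div]
  rw [Complex.arg_eq_zero_iff]
  refine ⟨?_, him⟩
  rcases this with h | h
  · exact h.le
  · exact absurd him h

lemma ang_mem_Ioo {x a b : Plane} (h : 0 < cross (a - x) (b - x)) :
    ang x a b ∈ Ioo 0 Real.pi := by
  have hN : 0 < Complex.normSq (toC (a - x)) := by
    rw [Complex.normSq_pos]; intro h0; rw [toC_eq_zero] at h0; simp [h0, cross] at h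
  have him : 0 < (toC (b - x) / toC (a - x)).im := by rw [toC_div_im]; positivity
  unfold ang
  constructor
  · refine lt_of_le_of_ne (Complex.arg_nonneg_iff.2 him.le) fun h0 => ?_
    rw [eq_comm, Complex.arg_eq_zero_iff] at h0
    exact him.ne' h0.2
  · refine lt_of_le_of_ne (Complex.arg_le_pi _) fun h0 => ?_
    rw [Complex.arg_eq_pi_iff] at h0
    exact him.ne' h0.2

/-- Angles add up when a segment is subdivided. -/
lemma ang_add {x a b y : Plane} (hx : x ∉ segment ℝ a b) (hy : y ∈ segment ℝ a b) :
    ang x a y + ang x y b = ang x a b := by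
  have hay : segment ℝ a y ⊆ segment ℝ a b :=
    (convex_segment a b).segment_subset (left_mem_segment ℝ a b) hy
  have hyb : segment ℝ y b ⊆ segment ℝ a b :=
    (convex_segment a b).segment_subset hy (right_mem_segment ℝ a b)
  rcases eq_or_ne y a with rfl | hya
  · rw [ang_eq_zero (fun h => hx (hay h)) (cross_self _), zero_add]
  rcases eq_or_ne y b with rfl | hyb'
  · rw [ang_eq_zero (a := y) (b := y) (fun h => hx (hyb h)) (cross_self _), add_zero]
  have key : ∀ a b : Plane, x ∉ segment ℝ a b → y ∈ segment ℝ a b → y ≠ a → y ≠ b →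
      0 < cross (a - x) (b - x) → ang x a y + ang x y b = ang x a b := by
    intro a b hx hy hya hyb h
    have hxa : x ≠ a := fun h => hx (h ▸ left_mem_segment ℝ a b)
    have hxb : x ≠ b := fun h => hx (h ▸ right_mem_segment ℝ a b)
    have hxy : x ≠ y := fun h => hx (h ▸ hy)
    have hc : ((ang x a y + ang x y b : ℝ) : Real.Angle) = (ang x a b : ℝ) := by
      rw [Real.Angle.coe_add, coe_ang hxa hxy, coe_ang hxy hxb, coe_ang hxa hxb]; abel
    obtain ⟨s, t, hs, ht, hst, rfl⟩ := hy
    have hs0 : 0 < s := lt_of_le_of_ne hs (by rintro rfl; simp_all)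
    have ht0 : 0 < t := lt_of_le_of_ne ht (by rintro rfl; simp_all)
    have e : s • a + t • b - x = s • (a - x) + t • (b - x) := by
      rw [smul_sub, smul_sub]
      calc _ = s • a + t • b - (s + t) • x := by rw [hst, one_smul]
        _ = _ := by rw [add_smul]; abel
    have h1 := ang_mem_Ioo (x := x) (a := a) (b := s • a + t • b) (by
      rw [e, cross_add_right, cross_smul_right, cross_smul_right, cross_self]; simp; positivity)
    have h2 := ang_mem_Ioo (x := x) (a := s • a + t • b) (b := b) (by
      rw [e, cross_add_left, cross_smul_left, cross_smul_left, cross_self]; simp; positivity)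
    have h3 := ang_mem_Ioo h
    -- The two sides agree modulo `2π`. All three angles lie in `(0, π)`, so the multiple of `2π` is
    -- zero.
    rw [Real.Angle.angle_eq_iff_two_pi_dvd_sub] at hc
    obtain ⟨k, hk⟩ := hc
    have hpi := Real.pi_pos
    obtain ⟨h11, h12⟩ := h1
    obtain ⟨h21, h22⟩ := h2
    obtain ⟨h31, h32⟩ := h3
    have hk1 : (-1 : ℝ) < k := by
      by_contra hcon
      push Not at hcon
      nlinarith
    have hk2 : (k : ℝ) < 1 := by
      by_contra hcon
      push Not at hcon
      nlinarith
    have : k = 0 := by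
      have a1 : (-1 : ℤ) < k := by exact_mod_cast hk1
      have a2 : k < 1 := by exact_mod_cast hk2
      omega
    rw [this] at hk; simp at hk; linarith
  rcases lt_trichotomy (cross (a - x) (b - x)) 0 with h | h | h
  · have := key b a (by rwa [segment_symm]) (by rwa [segment_symm]) hyb' hya
      (by rw [cross_swap]; linarith)
    rw [ang_swap hx, ang_swap (a := a) (b := y) fun h => hx (hay h),
      ang_swap (a := y) (b := b) fun h => hx (hyb h)] at this
    linarith
  · obtain ⟨s, t, hs, ht, hst, rfl⟩ := hy
    have e : s • a + t • b - x = s • (a - x) + t • (b - x) := by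
      rw [smul_sub, smul_sub]
      calc _ = s • a + t • b - (s + t) • x := by rw [hst, one_smul]
        _ = _ := by rw [add_smul]; abel
    rw [ang_eq_zero hx h, ang_eq_zero (fun h => hx (hay h)), ang_eq_zero (fun h => hx (hyb h)),
      add_zero]
    · rw [e, cross_add_left, cross_smul_left, cross_smul_left, cross_self, h]; simp
    · rw [e, cross_add_right, cross_smul_right, cross_smul_right, cross_self, h]; simp
  · exact key a b hx hy hya hyb' h

/-- On the segment the quotient is a negative real, that is, on the branch cut of `arg`. This is the
source of the jump from `-π` to `π` across the segment. -/
lemma tendsto_div_openSegment {a b y : Plane} (hab : a ≠ b) (hy : y ∈ openSegment ℝ a b) :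
    Tendsto (fun x => toC (b - x) / toC (a - x)) (𝓝 y) (𝓝 (toC (b - y) / toC (a - y))) ∧
      (toC (b - y) / toC (a - y)).re < 0 ∧ (toC (b - y) / toC (a - y)).im = 0 := by
  obtain ⟨s, t, hs, ht, hst, rfl⟩ := hy
  have hs' : s = 1 - t := by linarith
  have ea : a - (s • a + t • b) = t • (a - b) := by
    rw [hs']; ext i; simp; ring
  have eb : b - (s • a + t • b) = (-s) • (a - b) := by
    rw [hs']; ext i; simp; ring
  have hab' : toC (a - b) ≠ 0 := by rwa [Ne, toC_eq_zero, sub_eq_zero]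
  have hsm : ∀ (c : ℝ) (z : Plane), toC (c • z) = c * toC z := by
    intro c z; simp [toC]; ring
  have ha : toC (a - (s • a + t • b)) ≠ 0 := by
    rw [ea, hsm]; exact mul_ne_zero (by exact_mod_cast ht.ne') hab'
  have hval : toC (b - (s • a + t • b)) / toC (a - (s • a + t • b)) = ((-s / t : ℝ) : ℂ) := by
    rw [ea, eb, hsm, hsm, mul_div_mul_right _ _ hab']; push_cast; rfl
  refine ⟨?_, ?_, ?_⟩
  · apply Tendsto.div _ _ ha
    · exact (by fun_prop : Continuous fun x => toC (b - x)).tendsto _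
    · exact (by fun_prop : Continuous fun x => toC (a - x)).tendsto _
  · rw [hval, Complex.ofReal_re, neg_div]
    have := div_pos hs ht
    linarith
  · rw [hval, Complex.ofReal_im]

lemma cross_sub_sub (a b x : Plane) : cross (a - x) (b - x) = cross (b - a) (x - a) := by
  simp [cross]; ring

lemma tendsto_ang_left {a b y : Plane} (hab : a ≠ b) (hy : y ∈ openSegment ℝ a b) :
    Tendsto (fun x => ang x a b) (𝓝[{x | 0 < cross (b - a) (x - a)}] y) (𝓝 Real.pi) := by
  obtain ⟨h1, h2, h3⟩ := tendsto_div_openSegment hab hy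
  refine (Complex.tendsto_arg_nhdsWithin_im_nonneg_of_re_neg_of_im_zero h2 h3).comp
    (tendsto_nhdsWithin_iff.2 ⟨h1.mono_left nhdsWithin_le_nhds, ?_⟩)
  filter_upwards [self_mem_nhdsWithin] with x hx
  rw [← cross_sub_sub] at hx
  rw [toC_div_im]
  exact div_nonneg hx.le (Complex.normSq_nonneg _)

lemma tendsto_ang_right {a b y : Plane} (hab : a ≠ b) (hy : y ∈ openSegment ℝ a b) :
    Tendsto (fun x => ang x a b) (𝓝[{x | cross (b - a) (x - a) < 0}] y) (𝓝 (-Real.pi)) := by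
  obtain ⟨h1, h2, h3⟩ := tendsto_div_openSegment hab hy
  refine (Complex.tendsto_arg_nhdsWithin_im_neg_of_re_neg_of_im_zero h2 h3).comp
    (tendsto_nhdsWithin_iff.2 ⟨h1.mono_left nhdsWithin_le_nhds, ?_⟩)
  filter_upwards [self_mem_nhdsWithin] with x hx
  rw [← cross_sub_sub] at hx
  rw [toC_div_im]
  refine div_neg_of_neg_of_pos hx ?_
  rw [Complex.normSq_pos]; intro h0; rw [toC_eq_zero] at h0; simp [h0, cross] at hx

end GenKernel

/-! ### Winding numbers of cycles of segments, modulo 2. -/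

namespace GenKernel
open Set Filter Topology

/-- A point that can be approached along a ray inside `S` lies in the closure of `S`. -/
lemma mem_closure_of_ray {S : Set Plane} {y d : Plane} {ε : ℝ} (hε : 0 < ε)
    (h : ∀ t : ℝ, 0 < t → t < ε → y + t • d ∈ S) : y ∈ closure S := by
  have h1 : Tendsto (fun t : ℝ => y + t • d) (𝓝[>] 0) (𝓝 y) := by
    have : Continuous fun t : ℝ => y + t • d := by fun_prop
    have h2 := this.tendsto 0
    simp only [zero_smul, add_zero] at h2
    exact h2.mono_left nhdsWithin_le_nhds
  refine mem_closure_of_tendsto h1 ?_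
  filter_upwards [Ioo_mem_nhdsGT hε] with t ht using h t ht.1 ht.2

/-- Rotation by a right angle. -/
noncomputable def rot (u : Plane) : Plane := !₂[-u 1, u 0]

lemma cross_rot_pos {u : Plane} (hu : u ≠ 0) : 0 < cross u (rot u) := by
  have : cross u (rot u) = u 0 * u 0 + u 1 * u 1 := by simp [cross, rot]
  rw [this]
  have h : u 0 ≠ 0 ∨ u 1 ≠ 0 := by
    by_contra hc
    push Not at hc
    apply hu; ext i; fin_cases i
    · exact hc.1
    · exact hc.2
  rcases h with h | h
  · have := mul_self_pos.2 h; nlinarith [mul_self_nonneg (u 1)]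
  · have := mul_self_pos.2 h; nlinarith [mul_self_nonneg (u 0)]

/-- Total angle under which `x` sees a list of oriented segments. -/
noncomputable def wind (L : List (Plane × Plane)) (x : Plane) : ℝ :=
  (L.map fun e => ang x e.1 e.2).sum

/-- The union of the segments of a list. -/
def trace (L : List (Plane × Plane)) : Set Plane := {x | ∃ e ∈ L, x ∈ segment ℝ e.1 e.2}

/-- The list of oriented segments is a cycle. -/
def IsCycle (L : List (Plane × Plane)) : Prop :=
  ∀ f : Plane → Real.Angle, (L.map fun e => f e.2 - f e.1).sum = 0

/-- The parity of the winding number of a cycle, as a sign. -/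
noncomputable def parity (L : List (Plane × Plane)) (x : Plane) : ℝ := Real.cos (wind L x / 2)

lemma trace_nil : trace [] = ∅ := by ext; simp [trace]

lemma trace_cons (e : Plane × Plane) (L : List (Plane × Plane)) :
    trace (e :: L) = segment ℝ e.1 e.2 ∪ trace L := by
  ext; simp [trace]

lemma trace_append (L L' : List (Plane × Plane)) : trace (L ++ L') = trace L ∪ trace L' := by
  ext x; simp only [trace, List.mem_append, mem_union]
  constructor
  · rintro ⟨e, h | h, hx⟩
    · exact Or.inl ⟨e, h, hx⟩
    · exact Or.inr ⟨e, h, hx⟩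
  · rintro (⟨e, h, hx⟩ | ⟨e, h, hx⟩)
    · exact ⟨e, Or.inl h, hx⟩
    · exact ⟨e, Or.inr h, hx⟩

lemma isCompact_segment (a b : Plane) : IsCompact (segment ℝ a b) := by
  rw [segment_eq_image]
  exact isCompact_Icc.image (by fun_prop)

lemma isCompact_trace (L : List (Plane × Plane)) : IsCompact (trace L) := by
  induction L with
  | nil => rw [trace_nil]; exact isCompact_empty
  | cons e L ih => rw [trace_cons]; exact (isCompact_segment _ _).union ih

lemma isClosed_trace (L : List (Plane × Plane)) : IsClosed (trace L) := (isCompact_trace L).isClosed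

lemma wind_append (L L' : List (Plane × Plane)) (x : Plane) :
    wind (L ++ L') x = wind L x + wind L' x := by simp [wind]

lemma wind_cons (e : Plane × Plane) (L : List (Plane × Plane)) (x : Plane) :
    wind (e :: L) x = ang x e.1 e.2 + wind L x := by simp [wind]

lemma continuousAt_wind {L : List (Plane × Plane)} {x : Plane} (hx : x ∉ trace L) :
    ContinuousAt (wind L) x := by
  induction L with
  | nil => exact (continuousAt_const (y := (0 : ℝ))).congr (.of_forall fun y => by simp [wind])
  | cons e L ih =>
    rw [trace_cons, mem_union, not_or] at hx
    exact ((continuousAt_ang hx.1).add (ih hx.2)).congr (.of_forall fun y => (wind_cons e L y).symm)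

lemma tendsto_wind_cobounded (L : List (Plane × Plane)) :
    Tendsto (wind L) (Bornology.cobounded Plane) (𝓝 0) := by
  induction L with
  | nil => exact (tendsto_const_nhds (x := (0 : ℝ))).congr fun y => by simp [wind]
  | cons e L ih =>
    have := (tendsto_ang_cobounded e.1 e.2).add ih
    rw [add_zero] at this
    exact this.congr fun y => (wind_cons e L y).symm

lemma coe_wind {L : List (Plane × Plane)} {x : Plane} (hx : x ∉ trace L) :
    (wind L x : Real.Angle) = (L.map fun e => (Complex.arg (toC (e.2 - x)) : Real.Angle)
      - (Complex.arg (toC (e.1 - x)) : Real.Angle)).sum := by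
  induction L with
  | nil => simp [wind]
  | cons e L ih =>
    rw [trace_cons, mem_union, not_or] at hx
    rw [wind_cons, Real.Angle.coe_add, ih hx.2, List.map_cons, List.sum_cons, coe_ang]
    · rintro rfl; exact hx.1 (left_mem_segment ℝ _ _)
    · rintro rfl; exact hx.1 (right_mem_segment ℝ _ _)

/-- Modulo `2π` each angle is a difference of values of `z ↦ arg (z - x)`, and on a cycle such
differences sum to zero. -/
lemma exists_wind_eq {L : List (Plane × Plane)} (hL : IsCycle L) {x : Plane} (hx : x ∉ trace L) :
    ∃ k : ℤ, wind L x = 2 * Real.pi * k := by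
  have h : (wind L x : Real.Angle) = (0 : ℝ) := by
    rw [coe_wind hx]; exact hL fun z => (Complex.arg (toC (z - x)) : Real.Angle)
  rw [Real.Angle.angle_eq_iff_two_pi_dvd_sub] at h
  simpa using h

lemma sin_half_wind {L : List (Plane × Plane)} (hL : IsCycle L) {x : Plane} (hx : x ∉ trace L) :
    Real.sin (wind L x / 2) = 0 := by
  obtain ⟨k, hk⟩ := exists_wind_eq hL hx
  rw [hk, Real.sin_eq_zero_iff]
  exact ⟨k, by ring⟩

lemma parity_eq {L : List (Plane × Plane)} (hL : IsCycle L) {x : Plane} (hx : x ∉ trace L) :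
    parity L x = 1 ∨ parity L x = -1 := by
  have := Real.sin_sq_add_cos_sq (wind L x / 2)
  rw [sin_half_wind hL hx] at this
  exact sq_eq_one_iff.1 (by unfold parity; linarith)

lemma continuousAt_parity {L : List (Plane × Plane)} {x : Plane} (hx : x ∉ trace L) :
    ContinuousAt (parity L) x :=
  Real.continuous_cos.continuousAt.comp ((continuousAt_wind hx).div_const 2)

lemma parity_eventually_eq {L : List (Plane × Plane)} (hL : IsCycle L) {x : Plane}
    (hx : x ∉ trace L) : ∀ᶠ z in 𝓝 x, z ∉ trace L ∧ parity L z = parity L x := by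
  have h1 : ∀ᶠ z in 𝓝 x, z ∉ trace L := (isClosed_trace L).isOpen_compl.mem_nhds hx
  have h2 := (continuousAt_parity hx).tendsto.eventually
    (Metric.ball_mem_nhds (parity L x) one_pos)
  filter_upwards [h1, h2] with z hz hd
  refine ⟨hz, ?_⟩
  rw [Real.dist_eq, abs_lt] at hd
  rcases parity_eq hL hx with h | h <;> rcases parity_eq hL hz with h' | h' <;>
    rw [h, h'] at hd ⊢ <;> norm_num at hd

lemma isOpen_parity {L : List (Plane × Plane)} (hL : IsCycle L) (c : ℝ) :
    IsOpen {x | x ∉ trace L ∧ parity L x = c} := by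
  rw [isOpen_iff_mem_nhds]
  rintro x ⟨hx, rfl⟩
  exact parity_eventually_eq hL hx

lemma parity_const {L : List (Plane × Plane)} (hL : IsCycle L) {S : Set Plane}
    (hS : IsPreconnected S) (hd : Disjoint S (trace L)) {x y : Plane} (hx : x ∈ S) (hy : y ∈ S) :
    parity L x = parity L y := by
  by_contra hne
  have hcov : S ⊆ {z | z ∉ trace L ∧ parity L z = 1} ∪ {z | z ∉ trace L ∧ parity L z = -1} := by
    intro z hz
    have hz' : z ∉ trace L := disjoint_left.1 hd hz
    rcases parity_eq hL hz' with h | h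
    · exact Or.inl ⟨hz', h⟩
    · exact Or.inr ⟨hz', h⟩
  have hne' : (S ∩ {z | z ∉ trace L ∧ parity L z = 1}).Nonempty ∧
      (S ∩ {z | z ∉ trace L ∧ parity L z = -1}).Nonempty := by
    rcases hcov hx with h1 | h1 <;> rcases hcov hy with h2 | h2
    · exact absurd (h1.2.trans h2.2.symm) hne
    · exact ⟨⟨x, hx, h1⟩, ⟨y, hy, h2⟩⟩
    · exact ⟨⟨y, hy, h2⟩, ⟨x, hx, h1⟩⟩
    · exact absurd (h1.2.trans h2.2.symm) hne
  obtain ⟨z, -, h1, h2⟩ := hS _ _ (isOpen_parity hL 1) (isOpen_parity hL (-1)) hcov hne'.1 hne'.2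
  have := h1.2.symm.trans h2.2
  norm_num at this

lemma eventually_parity_eq_one {L : List (Plane × Plane)} (hL : IsCycle L) :
    ∀ᶠ x in Bornology.cobounded Plane, x ∉ trace L ∧ parity L x = 1 := by
  have h1 : ∀ᶠ x in Bornology.cobounded Plane, x ∉ trace L :=
    Bornology.IsBounded.compl (isCompact_trace L).isBounded
  have h2 : Tendsto (parity L) (Bornology.cobounded Plane) (𝓝 1) := by
    have := (Real.continuous_cos.tendsto _).comp ((tendsto_wind_cobounded L).div_const 2)
    rw [zero_div, Real.cos_zero] at this
    exact this
  filter_upwards [h1, h2.eventually (lt_mem_nhds one_pos)] with x hx hp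
  refine ⟨hx, (parity_eq hL hx).resolve_right fun h => ?_⟩
  rw [h] at hp; norm_num at hp

/-- An unbounded set reaches points at which the total angle is near zero; parity is 1 there, and it
is constant on the set. -/
lemma parity_eq_one_of_unbounded {L : List (Plane × Plane)} (hL : IsCycle L) {S : Set Plane}
    (hS : IsPreconnected S) (hd : Disjoint S (trace L)) (hb : ¬ Bornology.IsBounded S)
    {x : Plane} (hx : x ∈ S) : parity L x = 1 := by
  by_contra hne
  apply hb
  have h := eventually_parity_eq_one hL
  rw [← Bornology.isCobounded_compl_iff]
  filter_upwards [h] with z hz hzS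
  exact hne ((parity_const hL hS hd hx hzS).trans hz.2)

/-- The parity changes when a segment of the cycle is crossed. -/
lemma parity_flip {L L' : List (Plane × Plane)} (hL : IsCycle L) {a b y : Plane}
    (hp : L.Perm ((a, b) :: L')) (hab : a ≠ b) (hy : y ∈ openSegment ℝ a b) (hy' : y ∉ trace L') :
    ∃ c : ℝ, (c = 1 ∨ c = -1) ∧ ∀ᶠ x in 𝓝 y,
      (0 < cross (b - a) (x - a) → parity L x = c) ∧
      (cross (b - a) (x - a) < 0 → parity L x = -c) := by
  have hw : ∀ x, wind L x = ang x a b + wind L' x := by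
    intro x
    rw [← wind_cons (a, b)]
    exact (hp.map _).sum_eq
  have htr : ∀ x, x ∈ trace L ↔ x ∈ segment ℝ a b ∨ x ∈ trace L' := by
    intro x
    have : x ∈ trace ((a, b) :: L') ↔ x ∈ segment ℝ a b ∨ x ∈ trace L' := by
      rw [trace_cons]; rfl
    rw [← this]
    constructor
    · rintro ⟨e, he, hx⟩; exact ⟨e, hp.mem_iff.1 he, hx⟩
    · rintro ⟨e, he, hx⟩; exact ⟨e, hp.mem_iff.2 he, hx⟩
  have hoff : ∀ᶠ x in 𝓝 y, cross (b - a) (x - a) ≠ 0 → x ∉ trace L := by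
    filter_upwards [(isClosed_trace L').isOpen_compl.mem_nhds hy'] with x hx hc
    rw [htr, not_or]
    refine ⟨?_, hx⟩
    rintro ⟨s, t, -, -, hst, rfl⟩
    apply hc
    have : s • a + t • b - a = t • (b - a) := by
      rw [show s = 1 - t by linarith]; ext i; simp; ring
    rw [this, cross_smul_right, cross_self, mul_zero]
  have hW' : ∀ F : Filter Plane, F ≤ 𝓝 y → Tendsto (wind L') F (𝓝 (wind L' y)) := fun F hF =>
    (continuousAt_wind hy').tendsto.mono_left hF
  -- The angle of the crossed segment tends to `π` on the left and to `-π` on the right. Half the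
  -- total angle differs by `π` in the limit, so the cosine changes sign.
  have hl : Tendsto (parity L) (𝓝[{x | 0 < cross (b - a) (x - a)}] y)
      (𝓝 (-Real.sin (wind L' y / 2))) := by
    have h := (Real.continuous_cos.tendsto _).comp
      (((tendsto_ang_left hab hy).add (hW' _ nhdsWithin_le_nhds)).div_const 2)
    have e : Real.cos ((Real.pi + wind L' y) / 2) = -Real.sin (wind L' y / 2) := by
      rw [← Real.cos_add_pi_div_two]; congr 1; ring
    rw [e] at h
    exact h.congr fun x => by simp only [Function.comp, parity, hw]
  have hr : Tendsto (parity L) (𝓝[{x | cross (b - a) (x - a) < 0}] y)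
      (𝓝 (Real.sin (wind L' y / 2))) := by
    have h := (Real.continuous_cos.tendsto _).comp
      (((tendsto_ang_right hab hy).add (hW' _ nhdsWithin_le_nhds)).div_const 2)
    have e : Real.cos ((-Real.pi + wind L' y) / 2) = Real.sin (wind L' y / 2) := by
      rw [← Real.cos_sub_pi_div_two]; congr 1; ring
    rw [e] at h
    exact h.congr fun x => by simp only [Function.comp, parity, hw]
  have hline : cross (b - a) (y - a) = 0 := by
    obtain ⟨s, t, -, -, hst, rfl⟩ := hy
    have : s • a + t • b - a = t • (b - a) := by
      rw [show s = 1 - t by linarith]; ext i; simp; ring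
    rw [this, cross_smul_right, cross_self, mul_zero]
  have hne : (𝓝[{x | 0 < cross (b - a) (x - a)}] y).NeBot := by
    rw [← mem_closure_iff_nhdsWithin_neBot]
    refine mem_closure_of_ray (d := rot (b - a)) one_pos fun t ht _ => ?_
    have := cross_rot_pos (sub_ne_zero.2 hab.symm)
    show 0 < cross (b - a) (y + t • rot (b - a) - a)
    rw [add_sub_right_comm, cross_add_right, hline, cross_smul_right, zero_add]
    positivity
  -- The limit from the left is a limit of values `±1`, which determines the sine up to sign.
  have hsq : Real.sin (wind L' y / 2) ^ 2 = 1 := by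
    have h1 := hl.pow 2
    have h2 : (fun x => parity L x ^ 2) =ᶠ[𝓝[{x | 0 < cross (b - a) (x - a)}] y] fun _ => 1 := by
      filter_upwards [self_mem_nhdsWithin, hoff.filter_mono nhdsWithin_le_nhds] with x hx hx'
      rcases parity_eq hL (hx' (ne_of_gt hx)) with h | h <;> rw [h] <;> norm_num
    have := tendsto_nhds_unique (h1.congr' h2) tendsto_const_nhds
    linarith
  have hside : ∀ (S : Set Plane) (c : ℝ), (∀ x ∈ S, cross (b - a) (x - a) ≠ 0) →
      (c = 1 ∨ c = -1) → Tendsto (parity L) (𝓝[S] y) (𝓝 c) →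
      ∀ᶠ x in 𝓝 y, x ∈ S → parity L x = c := by
    intro S c hS hc ht
    have h1 := ht.eventually (Metric.ball_mem_nhds c one_pos)
    rw [eventually_nhdsWithin_iff] at h1
    filter_upwards [h1, hoff] with x hx hx' hxS
    have hd := hx hxS
    rw [Real.dist_eq, abs_lt] at hd
    rcases parity_eq hL (hx' (hS x hxS)) with h | h <;> rcases hc with h' | h' <;>
      rw [h, h'] at hd ⊢ <;> norm_num at hd
  have hc : -Real.sin (wind L' y / 2) = 1 ∨ -Real.sin (wind L' y / 2) = -1 :=
    sq_eq_one_iff.1 (by rw [neg_sq, hsq])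
  refine ⟨_, hc, ?_⟩
  have hc' : Real.sin (wind L' y / 2) = 1 ∨ Real.sin (wind L' y / 2) = -1 :=
    sq_eq_one_iff.1 hsq
  filter_upwards [hside _ _ (fun x hx => ne_of_gt hx) hc hl,
    hside _ _ (fun x hx => ne_of_lt hx) hc' hr] with x h1 h2
  exact ⟨fun h => h1 h, fun h => by rw [neg_neg]; exact h2 h⟩

end GenKernel

/-! ### Periodic vertex sequences and the local shape of the curve. -/

namespace GenKernel
open Set Filter Topology

/-- Real functions on the plane that respect affine combinations of two points. -/
def IsAff (f : Plane → ℝ) : Prop :=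
  ∀ (x y : Plane) (a b : ℝ), a + b = 1 → f (a • x + b • y) = a * f x + b * f y

lemma isAff_cross_sub (u y : Plane) : IsAff fun x => cross u (x - y) := by
  intro x x' a b hab
  obtain rfl : a = 1 - b := by linarith
  simp [cross]; ring

lemma isAff_sub_cross (u y : Plane) : IsAff fun x => cross (x - y) u := by
  intro x x' a b hab
  obtain rfl : a = 1 - b := by linarith
  simp [cross]; ring

lemma IsAff.const_mul {f : Plane → ℝ} (hf : IsAff f) (c : ℝ) : IsAff fun x => c * f x := by
  intro x y a b hab
  simp only [hf x y a b hab]; ring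

lemma IsAff.convex_pos {f : Plane → ℝ} (hf : IsAff f) : Convex ℝ {x | 0 < f x} := by
  intro x hx y hy a b ha hb hab
  have hx : 0 < f x := hx
  have hy : 0 < f y := hy
  show 0 < f (a • x + b • y)
  rw [hf x y a b hab]
  rcases ha.eq_or_lt with rfl | ha
  · obtain rfl : b = 1 := by linarith
    simpa using hy
  · positivity

lemma IsAff.convex_neg {f : Plane → ℝ} (hf : IsAff f) : Convex ℝ {x | f x < 0} := by
  have := (hf.const_mul (-1)).convex_pos
  convert this using 3 with x
  simp

/-- A point of an open set that can be approached along a ray inside `S`. -/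
lemma mem_closure_inter_of_ray {U S : Set Plane} (hU : IsOpen U) {y d : Plane} (hy : y ∈ U)
    (h : ∀ t : ℝ, 0 < t → y + t • d ∈ S) : y ∈ closure (U ∩ S) := by
  have h1 : Tendsto (fun t : ℝ => y + t • d) (𝓝[>] 0) (𝓝 y) := by
    have : Continuous fun t : ℝ => y + t • d := by fun_prop
    have h2 := this.tendsto 0
    simp only [zero_smul, add_zero] at h2
    exact h2.mono_left nhdsWithin_le_nhds
  refine mem_closure_of_tendsto h1 ?_
  filter_upwards [self_mem_nhdsWithin, h1.eventually (hU.mem_nhds hy)] with t ht htU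
  exact ⟨htU, h t ht⟩

/-- The `i`-th edge of a polygonal curve. -/
def edge (P : ℕ → Plane) (i : ℕ) : Set Plane := segment ℝ (P i) (P (i + 1))

/-- The curve traced by a sequence of vertices. -/
def curve (P : ℕ → Plane) : Set Plane := ⋃ i, edge P i

/-- A simple closed polygonal curve in general position, with periodically numbered vertices. -/
structure SimpleCycle (n : ℕ) (P : ℕ → Plane) : Prop where
  three_le : 3 ≤ n
  periodic : ∀ i, P (i + n) = P i
  injective : ∀ i j, P i = P j → i ≡ j [MOD n]
  generic : ∀ i j k, ¬ i ≡ j [MOD n] → ¬ j ≡ k [MOD n] → ¬ i ≡ k [MOD n] →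
    cross (P j - P i) (P k - P i) ≠ 0
  edge_inter : ∀ i j x, i < j → j < i + n → x ∈ edge P i → x ∈ edge P j →
    (j = i + 1 ∧ x = P j) ∨ (j + 1 = i + n ∧ x = P i)

lemma not_modEq_of_lt {n i j : ℕ} (h : i < j) (h' : j < i + n) : ¬ i ≡ j [MOD n] := by
  intro hm
  rw [Nat.modEq_iff_dvd' h.le] at hm
  have := Nat.le_of_dvd (by omega) hm
  omega

/-- The oriented edges number `a, …, a + m - 1`. -/
def edgeList (P : ℕ → Plane) (a m : ℕ) : List (Plane × Plane) :=
  (List.range m).map fun i => (P (a + i), P (a + i + 1))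

lemma edgeList_succ (P : ℕ → Plane) (a m : ℕ) :
    edgeList P a (m + 1) = (P a, P (a + 1)) :: edgeList P (a + 1) m := by
  unfold edgeList
  rw [List.range_succ_eq_map, List.map_cons, List.map_map]
  congr 1
  apply List.map_congr_left
  intro i _
  simp only [Function.comp]
  congr 2 <;> omega

lemma edgeList_add (P : ℕ → Plane) (a m k : ℕ) :
    edgeList P a (m + k) = edgeList P a m ++ edgeList P (a + m) k := by
  unfold edgeList
  rw [List.range_add, List.map_append, List.map_map]
  congr 1
  apply List.map_congr_left
  intro i _
  simp only [Function.comp]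
  congr 2 <;> omega

lemma mem_trace_edgeList {P : ℕ → Plane} {a m : ℕ} {x : Plane} :
    x ∈ trace (edgeList P a m) ↔ ∃ i, a ≤ i ∧ i < a + m ∧ x ∈ edge P i := by
  simp only [trace, edgeList, List.mem_map, List.mem_range]
  constructor
  · rintro ⟨e, ⟨i, hi, rfl⟩, hx⟩
    exact ⟨a + i, by omega, by omega, hx⟩
  · rintro ⟨i, h1, h2, hx⟩
    refine ⟨_, ⟨i - a, by omega, rfl⟩, ?_⟩
    have : a + (i - a) = i := by omega
    simp only [this]
    exact hx

lemma sum_edgeList (P : ℕ → Plane) (a m : ℕ) (f : Plane → Real.Angle) :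
    ((edgeList P a m).map fun e => f e.2 - f e.1).sum = f (P (a + m)) - f (P a) := by
  induction m generalizing a with
  | zero => simp [edgeList]
  | succ m ih =>
    rw [edgeList_succ, List.map_cons, List.sum_cons, ih]
    rw [show a + 1 + m = a + (m + 1) by omega]
    abel

namespace SimpleCycle

variable {n : ℕ} {P : ℕ → Plane}

lemma periodic_mul (h : SimpleCycle n P) (i k : ℕ) : P (i + n * k) = P i := by
  induction k with
  | zero => rfl
  | succ k ih => rw [Nat.mul_succ, ← add_assoc, h.periodic, ih]

lemma congr (h : SimpleCycle n P) {i j : ℕ} (hij : i ≡ j [MOD n]) : P i = P j := by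
  have key : ∀ i, P i = P (i % n) := by
    intro i
    conv_lhs => rw [← Nat.mod_add_div i n]
    exact h.periodic_mul _ _
  rw [key i, key j, hij]

lemma ne_of_lt (h : SimpleCycle n P) {i j : ℕ} (hij : i < j) (hj : j < i + n) : P i ≠ P j :=
  fun he => not_modEq_of_lt hij hj (h.injective i j he)

lemma ne_succ (h : SimpleCycle n P) (i : ℕ) : P i ≠ P (i + 1) :=
  h.ne_of_lt (by omega) (by have := h.three_le; omega)

lemma edge_congr (h : SimpleCycle n P) {i j : ℕ} (hij : i ≡ j [MOD n]) : edge P i = edge P j := by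
  unfold edge
  rw [h.congr hij, h.congr (Nat.ModEq.add_right 1 hij)]

lemma shift (h : SimpleCycle n P) (c : ℕ) : SimpleCycle n fun i => P (c + i) where
  three_le := h.three_le
  periodic i := by rw [← add_assoc, h.periodic]
  injective i j hij := Nat.ModEq.add_left_cancel' c (h.injective _ _ hij)
  generic i j k h1 h2 h3 := h.generic _ _ _ (fun e => h1 (Nat.ModEq.add_left_cancel' c e))
    (fun e => h2 (Nat.ModEq.add_left_cancel' c e)) (fun e => h3 (Nat.ModEq.add_left_cancel' c e))
  edge_inter i j x hij hj hx hx' := by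
    have := h.edge_inter (c + i) (c + j) x (by omega) (by omega) hx hx'
    rcases this with ⟨h1, h2⟩ | ⟨h1, h2⟩
    · exact Or.inl ⟨by omega, h2⟩
    · exact Or.inr ⟨by omega, h2⟩

/-- Every residue class has a representative in a given period. -/
lemma exists_rep (h : SimpleCycle n P) (a i : ℕ) : ∃ j, a ≤ j ∧ j < a + n ∧ i ≡ j [MOD n] := by
  have h3 := h.three_le
  -- The summand `(n - 1) * a` plays the role of `-a` modulo `n`, without truncated subtraction.
  refine ⟨a + (i + (n - 1) * a) % n, by omega, ?_, ?_⟩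
  · have := Nat.mod_lt (i + (n - 1) * a) (by omega : 0 < n); omega
  · have h1 : a + (i + (n - 1) * a) % n ≡ a + (i + (n - 1) * a) [MOD n] :=
      Nat.ModEq.add_left a (Nat.mod_modEq _ _)
    refine (h1.trans ?_).symm
    have : a + (i + (n - 1) * a) = i + n * a := by
      obtain ⟨k, rfl⟩ : ∃ k, n = k + 1 := ⟨n - 1, by omega⟩
      simp only [Nat.add_sub_cancel]; ring
    rw [this]
    simp [Nat.ModEq]

lemma mem_curve (h : SimpleCycle n P) (a : ℕ) {x : Plane} :
    x ∈ curve P ↔ ∃ i, a ≤ i ∧ i < a + n ∧ x ∈ edge P i := by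
  constructor
  · intro hx
    obtain ⟨i, hi⟩ := mem_iUnion.1 hx
    obtain ⟨j, h1, h2, h3⟩ := h.exists_rep a i
    exact ⟨j, h1, h2, h.edge_congr h3 ▸ hi⟩
  · rintro ⟨i, -, -, hx⟩
    exact mem_iUnion.2 ⟨i, hx⟩

lemma curve_shift (h : SimpleCycle n P) (c : ℕ) : curve (fun i => P (c + i)) = curve P := by
  ext x
  rw [(h.shift c).mem_curve 0, h.mem_curve c]
  constructor
  · rintro ⟨i, -, h2, hx⟩
    exact ⟨c + i, by omega, by omega, hx⟩
  · rintro ⟨i, h1, h2, hx⟩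
    refine ⟨i - c, by omega, by omega, ?_⟩
    show x ∈ segment ℝ (P (c + (i - c))) (P (c + (i - c + 1)))
    rw [show c + (i - c) = i by omega, show c + (i - c + 1) = i + 1 by omega]
    exact hx

lemma trace_edgeList (h : SimpleCycle n P) (a : ℕ) : trace (edgeList P a n) = curve P := by
  ext x; rw [mem_trace_edgeList, h.mem_curve a]

lemma isCycle (h : SimpleCycle n P) (a : ℕ) : IsCycle (edgeList P a n) := by
  intro f
  rw [sum_edgeList, h.periodic, sub_self]

lemma isClosed_curve (h : SimpleCycle n P) : IsClosed (curve P) := by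
  rw [← h.trace_edgeList 0]; exact isClosed_trace _

lemma vertex_mem_curve (_ : SimpleCycle n P) (i : ℕ) : P i ∈ curve P :=
  mem_iUnion.2 ⟨i, left_mem_segment ℝ _ _⟩

lemma edge_subset_curve (_ : SimpleCycle n P) (i : ℕ) : edge P i ⊆ curve P :=
  subset_iUnion (edge P) i

lemma isPreconnected_curve (_ : SimpleCycle n P) : IsPreconnected (curve P) := by
  have key : ∀ m, IsPreconnected (⋃ i ∈ Iio (m + 1), edge P i) := by
    intro m
    induction m with
    | zero =>
      have : (⋃ i ∈ Iio (0 + 1), edge P i) = edge P 0 := by simp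
      rw [this]; exact (convex_segment _ _).isPreconnected
    | succ m ih =>
      have : (⋃ i ∈ Iio (m + 1 + 1), edge P i) = (⋃ i ∈ Iio (m + 1), edge P i) ∪ edge P (m + 1) := by
        ext x; simp only [mem_iUnion, mem_Iio, mem_union]
        constructor
        · rintro ⟨i, hi, hx⟩
          rcases Nat.lt_succ_iff_lt_or_eq.1 hi with h | rfl
          · exact Or.inl ⟨i, h, hx⟩
          · exact Or.inr hx
        · rintro (⟨i, hi, hx⟩ | hx)
          · exact ⟨i, by omega, hx⟩
          · exact ⟨m + 1, by omega, hx⟩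
      rw [this]
      refine IsPreconnected.union (P (m + 1)) ?_ (left_mem_segment ℝ _ _) ih
        (convex_segment _ _).isPreconnected
      exact mem_iUnion₂.2 ⟨m, by simp, right_mem_segment ℝ _ _⟩
  have : curve P = ⋃ m, ⋃ i ∈ Iio (m + 1), edge P i := by
    ext x; simp only [curve, mem_iUnion, mem_Iio]
    exact ⟨fun ⟨i, hi⟩ => ⟨i, i, by omega, hi⟩, fun ⟨_, i, _, hi⟩ => ⟨i, hi⟩⟩
  rw [this]
  refine isPreconnected_iUnion ⟨P 0, mem_iInter.2 fun m => ?_⟩ key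
  exact mem_iUnion₂.2 ⟨0, by simp, left_mem_segment ℝ _ _⟩

/-- Near an inner point of an edge the curve is a straight line. -/
lemma local_edge (h : SimpleCycle n P) {y : Plane} (hy : y ∈ openSegment ℝ (P 0) (P 1)) :
    ∃ r > 0, ∀ x ∈ Metric.ball y r, (x ∈ curve P ↔ cross (P 1 - P 0) (x - y) = 0) := by
  have h3 := h.three_le
  have hy' : y ∉ trace (edgeList P 1 (n - 1)) := by
    intro hc
    obtain ⟨i, h1, h2, hi⟩ := mem_trace_edgeList.1 hc
    have hne : y ≠ P 0 ∧ y ≠ P 1 := by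
      constructor <;> rintro rfl
      · rw [left_mem_openSegment_iff] at hy; exact h.ne_succ 0 hy
      · rw [right_mem_openSegment_iff] at hy; exact h.ne_succ 0 hy
    rcases h.edge_inter 0 i y (by omega) (by omega) (openSegment_subset_segment ℝ _ _ hy) hi with
      ⟨rfl, h5⟩ | ⟨-, h5⟩
    · exact hne.2 h5
    · exact hne.1 h5
  obtain ⟨r₁, hr₁, hb₁⟩ := Metric.isOpen_iff.1 (isClosed_trace _).isOpen_compl y hy'
  obtain ⟨s, t, hs, ht, hst, hyst⟩ := hy
  have hu : P 1 - P 0 ≠ 0 := sub_ne_zero.2 (h.ne_succ 0).symm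
  have hu' : 0 < ‖P 1 - P 0‖ := norm_pos_iff.2 hu
  refine ⟨min r₁ (min (s * ‖P 1 - P 0‖) (t * ‖P 1 - P 0‖)),
    lt_min hr₁ (lt_min (by positivity) (by positivity)), fun x hx => ?_⟩
  rw [Metric.mem_ball, lt_min_iff, lt_min_iff] at hx
  obtain ⟨hx1, hx2, hx3⟩ := hx
  have hyu : y = P 0 + t • (P 1 - P 0) := by
    rw [← hyst, show s = 1 - t by linarith]; module
  constructor
  · intro hxC
    obtain ⟨i, h1, h2, hi⟩ := (h.mem_curve 0).1 hxC
    rcases Nat.eq_zero_or_pos i with rfl | hi0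
    · obtain ⟨s', t', -, -, hst', rfl⟩ := hi
      rw [hyu, show s' = 1 - t' by linarith]
      have : (1 - t') • P 0 + t' • P (0 + 1) - (P 0 + t • (P 1 - P 0)) = (t' - t) • (P 1 - P 0) := by
        module
      rw [this, cross_smul_right, cross_self, mul_zero]
    · exact absurd (mem_trace_edgeList.2 ⟨i, hi0, by omega, hi⟩) (hb₁ hx1)
  · intro hc
    obtain ⟨c, hc⟩ := exists_eq_smul_of_cross_eq_zero hu hc
    rw [dist_eq_norm, hc, norm_smul, Real.norm_eq_abs] at hx2 hx3
    have h1 := (abs_lt.1 (lt_of_mul_lt_mul_right hx2 hu'.le)).2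
    have h2 := (abs_lt.1 (lt_of_mul_lt_mul_right hx3 hu'.le)).1
    refine h.edge_subset_curve 0 ⟨1 - (t + c), t + c, by linarith, by linarith, by ring, ?_⟩
    rw [show x = y + c • (P 1 - P 0) by rw [← hc]; abel, hyu]
    module

/-- Near a vertex the curve consists of two rays. -/
lemma local_vertex (h : SimpleCycle n P) {c : ℝ} (hc : c = cross (P 2 - P 1) (P 0 - P 1)) :
    ∃ r > 0, ∀ x ∈ Metric.ball (P 1) r, (x ∈ curve P ↔
      0 ≤ c * cross (P 2 - P 1) (x - P 1) ∧ 0 ≤ c * cross (x - P 1) (P 0 - P 1) ∧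
      (c * cross (P 2 - P 1) (x - P 1) = 0 ∨ c * cross (x - P 1) (P 0 - P 1) = 0)) := by
  have h3 := h.three_le
  have hc0 : c ≠ 0 := by
    rw [hc]
    refine h.generic 1 2 0 (not_modEq_of_lt (by omega) (by omega)) (fun e => ?_) (fun e => ?_)
    · exact not_modEq_of_lt (n := n) (i := 0) (j := 2) (by omega) (by omega) e.symm
    · exact not_modEq_of_lt (n := n) (i := 0) (j := 1) (by omega) (by omega) e.symm
  have hc2 : 0 < c * c := mul_self_pos.2 hc0
  have hy' : P 1 ∉ trace (edgeList P 2 (n - 2)) := by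
    intro hcon
    obtain ⟨i, h1, h2, hi⟩ := mem_trace_edgeList.1 hcon
    rcases h.edge_inter 1 i (P 1) (by omega) (by omega) (left_mem_segment ℝ _ _) hi with
      ⟨rfl, h5⟩ | ⟨h4, -⟩
    · exact h.ne_succ 1 h5
    · omega
  obtain ⟨r₁, hr₁, hb₁⟩ := Metric.isOpen_iff.1 (isClosed_trace _).isOpen_compl _ hy'
  have hu' : 0 < ‖P 2 - P 1‖ := norm_pos_iff.2 (sub_ne_zero.2 (h.ne_succ 1).symm)
  have hv' : 0 < ‖P 0 - P 1‖ := norm_pos_iff.2 (sub_ne_zero.2 (h.ne_succ 0))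
  refine ⟨min r₁ (min ‖P 2 - P 1‖ ‖P 0 - P 1‖),
    lt_min hr₁ (lt_min hu' hv'), fun x hx => ?_⟩
  rw [Metric.mem_ball, lt_min_iff, lt_min_iff] at hx
  obtain ⟨hx1, hx2, hx3⟩ := hx
  constructor
  · intro hxC
    obtain ⟨i, h1, h2, hi⟩ := (h.mem_curve 0).1 hxC
    rcases Nat.lt_or_ge i 2 with hi2 | hi2
    · interval_cases i
      · obtain ⟨s, t, hs, ht, hst, rfl⟩ := hi
        have : s • P 0 + t • P (0 + 1) - P 1 = s • (P 0 - P 1) := by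
          rw [show t = 1 - s by linarith]; module
        rw [this, cross_smul_right, cross_smul_left, cross_self, ← hc]
        refine ⟨?_, by simp, Or.inr (by simp)⟩
        rw [mul_left_comm]; positivity
      · obtain ⟨s, t, hs, ht, hst, rfl⟩ := hi
        have : s • P 1 + t • P (1 + 1) - P 1 = t • (P 2 - P 1) := by
          rw [show s = 1 - t by linarith]; module
        rw [this, cross_smul_right, cross_smul_left, cross_self, ← hc]
        refine ⟨by simp, ?_, Or.inl (by simp)⟩
        rw [mul_left_comm]; positivity
    · exact absurd (mem_trace_edgeList.2 ⟨i, hi2, by omega, hi⟩) (hb₁ hx1)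
  · rintro ⟨h1, h2, h0 | h0⟩
    · have h0 := (mul_eq_zero.1 h0).resolve_left hc0
      obtain ⟨d, hd⟩ := exists_eq_smul_of_cross_eq_zero (norm_pos_iff.1 hu') h0
      rw [hd, cross_smul_left, ← hc, mul_left_comm] at h2
      have hd0 : 0 ≤ d := nonneg_of_mul_nonneg_left h2 hc2
      rw [dist_eq_norm, hd, norm_smul, Real.norm_eq_abs, abs_of_nonneg hd0] at hx2
      have hd1 : d < 1 := by
        by_contra hcon
        push Not at hcon
        nlinarith
      refine h.edge_subset_curve 1 ⟨1 - d, d, by linarith, hd0, by ring, ?_⟩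
      rw [show x = P 1 + d • (P 2 - P 1) by rw [← hd]; abel]
      module
    · have h0 := (mul_eq_zero.1 h0).resolve_left hc0
      rw [cross_swap, neg_eq_zero] at h0
      obtain ⟨d, hd⟩ := exists_eq_smul_of_cross_eq_zero (norm_pos_iff.1 hv') h0
      rw [hd, cross_smul_right, ← hc, mul_left_comm] at h1
      have hd0 : 0 ≤ d := nonneg_of_mul_nonneg_left h1 hc2
      rw [dist_eq_norm, hd, norm_smul, Real.norm_eq_abs, abs_of_nonneg hd0] at hx3
      have hd1 : d < 1 := by
        by_contra hcon
        push Not at hcon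
        nlinarith
      refine h.edge_subset_curve 0 ⟨d, 1 - d, hd0, by linarith, by ring, ?_⟩
      rw [show x = P 1 + d • (P 0 - P 1) by rw [← hd]; abel]
      module

end SimpleCycle

end GenKernel

/-! ### The Jordan curve theorem for polygons. -/

namespace GenKernel
open Set Filter Topology

/-- This is for the reflex sector at a vertex, which is not convex: it is the union of two convex
pieces, and the ray from `y` in direction `d` runs in both of them. -/
lemma isPreconnected_union_halfPlanes {B : Set Plane} (hB : Convex ℝ B) (hBo : IsOpen B)
    {f g : Plane → ℝ} (hf : IsAff f) (hg : IsAff g) {y d : Plane} (hy : y ∈ B)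
    (hd : ∀ t : ℝ, 0 < t → f (y + t • d) < 0 ∧ g (y + t • d) < 0) :
    IsPreconnected (B ∩ {x | f x < 0 ∨ g x < 0}) := by
  have hcl := mem_closure_inter_of_ray (S := {x | f x < 0 ∧ g x < 0}) hBo hy hd
  obtain ⟨z, hzB, hz⟩ := closure_nonempty_iff.1 ⟨y, hcl⟩
  have : B ∩ {x | f x < 0 ∨ g x < 0} = (B ∩ {x | f x < 0}) ∪ (B ∩ {x | g x < 0}) := by
    ext x; exact and_or_left
  rw [this]
  exact IsPreconnected.union z ⟨hzB, hz.1⟩ ⟨hzB, hz.2⟩ (hB.inter hf.convex_neg).isPreconnected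
    (hB.inter hg.convex_neg).isPreconnected

/-- The union of the bounded components of the complement of a set. -/
def inside (C : Set Plane) : Set Plane :=
  {x | x ∉ C ∧ Bornology.IsBounded (connectedComponentIn Cᶜ x)}

/-- The union of the unbounded components of the complement of a set. -/
def outside (C : Set Plane) : Set Plane :=
  {x | x ∉ C ∧ ¬ Bornology.IsBounded (connectedComponentIn Cᶜ x)}

/-- The set `C` looks near `y` like the common boundary of the two connected sets `S₁`, `S₂`. -/
structure IsLocalSplit (C : Set Plane) (y : Plane) (B S₁ S₂ : Set Plane) : Prop where
  isOpen : IsOpen B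
  mem : y ∈ B
  conn₁ : IsPreconnected S₁
  conn₂ : IsPreconnected S₂
  sub₁ : S₁ ⊆ Cᶜ
  sub₂ : S₂ ⊆ Cᶜ
  cover : B \ C ⊆ S₁ ∪ S₂
  closure₁ : B ∩ C ⊆ closure S₁
  closure₂ : B ∩ C ⊆ closure S₂

/-- A component adherent to `y` has a point in `B`. This point is in one of the two connected
pieces, and the component swallows that piece whole. -/
lemma IsLocalSplit.subset_component {C : Set Plane} {y : Plane} {B S₁ S₂ : Set Plane}
    (hs : IsLocalSplit C y B S₁ S₂) {x : Plane} (hx : y ∈ closure (connectedComponentIn Cᶜ x)) :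
    S₁ ⊆ connectedComponentIn Cᶜ x ∧ S₁.Nonempty ∨ S₂ ⊆ connectedComponentIn Cᶜ x ∧ S₂.Nonempty := by
  obtain ⟨z, hzB, hzK⟩ := mem_closure_iff.1 hx B hs.isOpen hs.mem
  have hzC := connectedComponentIn_subset _ _ hzK
  rw [connectedComponentIn_eq hzK]
  rcases hs.cover ⟨hzB, hzC⟩ with h | h
  · exact Or.inl ⟨hs.conn₁.subset_connectedComponentIn h hs.sub₁, z, h⟩
  · exact Or.inr ⟨hs.conn₂.subset_connectedComponentIn h hs.sub₂, z, h⟩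

/-- The points of `C` adherent to a component form a relatively clopen subset of `C`: near such a
point the component contains a whole piece, and all of `B ∩ C` is adherent to this piece. The subset
is nonempty, since otherwise the component would be clopen in the plane. Connectedness of `C`
finishes. -/
lemma closure_component_of_localSplit {C : Set Plane} (hC : IsClosed C) (hconn : IsPreconnected C)
    (hne : C.Nonempty) (hs : ∀ y ∈ C, ∃ B S₁ S₂, IsLocalSplit C y B S₁ S₂) {x : Plane}
    (hx : x ∉ C) : C ⊆ closure (connectedComponentIn Cᶜ x) := by
  set K := connectedComponentIn Cᶜ x with hK
  have hKo : IsOpen K := hC.isOpen_compl.connectedComponentIn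
  have hxK : x ∈ K := mem_connectedComponentIn hx
  have hmeet : (C ∩ closure K).Nonempty := by
    by_contra hcon
    rw [not_nonempty_iff_eq_empty] at hcon
    have hcl : closure K ⊆ K := by
      intro z hz
      have hzC : z ∉ C := fun h => (hcon ▸ (⟨h, hz⟩ : z ∈ C ∩ closure K) : z ∈ (∅ : Set Plane))
      have hzo : IsOpen (connectedComponentIn Cᶜ z) := hC.isOpen_compl.connectedComponentIn
      obtain ⟨w, hw1, hw2⟩ := mem_closure_iff.1 hz _ hzo (mem_connectedComponentIn hzC)
      have := (connectedComponentIn_eq hw1).trans (connectedComponentIn_eq hw2).symm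
      rw [hK, ← this]
      exact mem_connectedComponentIn hzC
    have hclosed : IsClosed K := closure_subset_iff_isClosed.1 hcl
    have huniv : K = univ := IsClopen.eq_univ ⟨hclosed, hKo⟩ ⟨x, hxK⟩
    obtain ⟨z, hz⟩ := hne
    exact connectedComponentIn_subset _ _ (huniv ▸ mem_univ z : z ∈ K) hz
  choose! B S₁ S₂ hB using hs
  set U : Set Plane := ⋃ y ∈ C ∩ closure K, B y with hU
  have hUo : IsOpen U := isOpen_biUnion fun y hy => (hB y hy.1).isOpen
  have hUK : ∀ z ∈ U, z ∈ C → z ∈ closure K := by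
    intro z hz hzC
    obtain ⟨y, hy, hzy⟩ := mem_iUnion₂.1 hz
    rcases (hB y hy.1).subset_component hy.2 with h | h
    · exact closure_mono h.1 ((hB y hy.1).closure₁ ⟨hzy, hzC⟩)
    · exact closure_mono h.1 ((hB y hy.1).closure₂ ⟨hzy, hzC⟩)
  by_contra hcon
  obtain ⟨z, hzC, hzK⟩ := not_subset.1 hcon
  obtain ⟨y, hyC, hyK⟩ := hmeet
  obtain ⟨w, hwC, hwU, hwK⟩ := hconn U (closure K)ᶜ hUo isClosed_closure.isOpen_compl
    (fun w hw => by
      by_cases h : w ∈ closure K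
      · exact Or.inl (mem_iUnion₂.2 ⟨w, ⟨hw, h⟩, (hB w hw).mem⟩)
      · exact Or.inr h)
    ⟨y, hyC, mem_iUnion₂.2 ⟨y, ⟨hyC, hyK⟩, (hB y hyC).mem⟩⟩ ⟨z, hzC, hzK⟩
  exact hwK (hUK w hwU hwC)

namespace SimpleCycle

variable {n : ℕ} {P : ℕ → Plane}

lemma localSplit_edge (h : SimpleCycle n P) {y : Plane} (hy : y ∈ openSegment ℝ (P 0) (P 1)) :
    ∃ r > 0, IsLocalSplit (curve P) y (Metric.ball y r)
      (Metric.ball y r ∩ {x | 0 < cross (P 1 - P 0) (x - y)})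
      (Metric.ball y r ∩ {x | cross (P 1 - P 0) (x - y) < 0}) := by
  obtain ⟨r, hr, hloc⟩ := h.local_edge hy
  have hpos := cross_rot_pos (sub_ne_zero.2 (h.ne_succ 0).symm)
  rw [zero_add] at hpos
  refine ⟨r, hr, Metric.isOpen_ball, Metric.mem_ball_self hr,
    ((convex_ball _ _).inter (isAff_cross_sub _ _).convex_pos).isPreconnected,
    ((convex_ball _ _).inter (isAff_cross_sub _ _).convex_neg).isPreconnected, ?_, ?_, ?_, ?_, ?_⟩
  · rintro x ⟨hx, hx'⟩ hxC
    exact (ne_of_gt hx') ((hloc x hx).1 hxC)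
  · rintro x ⟨hx, hx'⟩ hxC
    exact (_root_.ne_of_lt hx') ((hloc x hx).1 hxC)
  · rintro x ⟨hx, hxC⟩
    rw [hloc x hx] at hxC
    rcases lt_or_gt_of_ne hxC with h | h
    · exact Or.inr ⟨hx, h⟩
    · exact Or.inl ⟨hx, h⟩
  · rintro x ⟨hx, hxC⟩
    rw [hloc x hx] at hxC
    refine mem_closure_inter_of_ray (d := rot (P 1 - P 0)) Metric.isOpen_ball hx fun t ht => ?_
    show 0 < cross _ _
    rw [add_sub_right_comm, cross_add_right, cross_smul_right, hxC, zero_add]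
    positivity
  · rintro x ⟨hx, hxC⟩
    rw [hloc x hx] at hxC
    refine mem_closure_inter_of_ray (d := -rot (P 1 - P 0)) Metric.isOpen_ball hx fun t ht => ?_
    show cross _ _ < 0
    rw [add_sub_right_comm, cross_add_right, cross_smul_right, hxC, zero_add, cross_neg_right]
    nlinarith

lemma cross_vertex_ne_zero (h : SimpleCycle n P) : cross (P 2 - P 1) (P 0 - P 1) ≠ 0 := by
  have h3 := h.three_le
  refine h.generic 1 2 0 (not_modEq_of_lt (by omega) (by omega)) (fun e => ?_) (fun e => ?_)
  · exact not_modEq_of_lt (n := n) (i := 0) (j := 2) (by omega) (by omega) e.symm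
  · exact not_modEq_of_lt (n := n) (i := 0) (j := 1) (by omega) (by omega) e.symm

/-- The factor `c` makes both functions positive exactly in the sector of angle less than `π`
between the two edges, whichever way the curve turns. So the first piece is always the convex sector
and the second the reflex one; which of them is inside is not decided here. -/
lemma localSplit_vertex (h : SimpleCycle n P) {c : ℝ}
    (hc : c = cross (P 2 - P 1) (P 0 - P 1)) :
    ∃ r > 0, IsLocalSplit (curve P) (P 1) (Metric.ball (P 1) r)
      (Metric.ball (P 1) r ∩ {x | 0 < c * cross (P 2 - P 1) (x - P 1) ∧
        0 < c * cross (x - P 1) (P 0 - P 1)})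
      (Metric.ball (P 1) r ∩ {x | c * cross (P 2 - P 1) (x - P 1) < 0 ∨
        c * cross (x - P 1) (P 0 - P 1) < 0}) := by
  obtain ⟨r, hr, hloc⟩ := h.local_vertex hc
  have hc0 : 0 < c * c := mul_self_pos.2 (hc ▸ h.cross_vertex_ne_zero)
  have hf := (isAff_cross_sub (P 2 - P 1) (P 1)).const_mul c
  have hg := (isAff_sub_cross (P 0 - P 1) (P 1)).const_mul c
  have ef : ∀ (x : Plane) (t : ℝ), c * cross (P 2 - P 1)
      (x + t • ((P 2 - P 1) + (P 0 - P 1)) - P 1) = c * cross (P 2 - P 1) (x - P 1) + t * (c * c) := by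
    intro x t
    rw [add_sub_right_comm, cross_add_right, cross_smul_right, cross_add_right, cross_self, ← hc]
    ring
  have eg : ∀ (x : Plane) (t : ℝ), c * cross
      (x + t • ((P 2 - P 1) + (P 0 - P 1)) - P 1) (P 0 - P 1) =
      c * cross (x - P 1) (P 0 - P 1) + t * (c * c) := by
    intro x t
    rw [add_sub_right_comm, cross_add_left, cross_smul_left, cross_add_left, cross_self, ← hc]
    ring
  refine ⟨r, hr, Metric.isOpen_ball, Metric.mem_ball_self hr,
    ((convex_ball _ _).inter (hf.convex_pos.inter hg.convex_pos)).isPreconnected,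
    isPreconnected_union_halfPlanes (d := -((P 2 - P 1) + (P 0 - P 1))) (convex_ball _ _)
      Metric.isOpen_ball hf hg (Metric.mem_ball_self hr) ?_, ?_, ?_, ?_, ?_, ?_⟩
  · intro t ht
    simp only [smul_neg, ← neg_smul]
    rw [ef, eg]
    simp only [sub_self]
    simp only [cross, PiLp.zero_apply]
    constructor <;> nlinarith
  · rintro x ⟨hx, hx1, hx2⟩ hxC
    rcases ((hloc x hx).1 hxC).2.2 with h | h
    · exact hx1.ne' h
    · exact hx2.ne' h
  · rintro x ⟨hx, hx'⟩ hxC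
    obtain ⟨h1, h2, -⟩ := (hloc x hx).1 hxC
    rcases hx' with h | h
    · exact absurd h (not_lt.2 h1)
    · exact absurd h (not_lt.2 h2)
  · rintro x ⟨hx, hxC⟩
    rw [hloc x hx] at hxC
    by_cases h1 : c * cross (P 2 - P 1) (x - P 1) < 0
    · exact Or.inr ⟨hx, Or.inl h1⟩
    by_cases h2 : c * cross (x - P 1) (P 0 - P 1) < 0
    · exact Or.inr ⟨hx, Or.inr h2⟩
    push Not at h1 h2
    refine Or.inl ⟨hx, lt_of_le_of_ne h1 fun e => ?_, lt_of_le_of_ne h2 fun e => ?_⟩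
    · exact hxC ⟨h1, h2, Or.inl e.symm⟩
    · exact hxC ⟨h1, h2, Or.inr e.symm⟩
  · rintro x ⟨hx, hxC⟩
    obtain ⟨h1, h2, -⟩ := (hloc x hx).1 hxC
    refine mem_closure_inter_of_ray (d := (P 2 - P 1) + (P 0 - P 1)) Metric.isOpen_ball hx
      fun t ht => ⟨?_, ?_⟩
    · rw [ef]; positivity
    · rw [eg]; positivity
  · rintro x ⟨hx, hxC⟩
    obtain ⟨-, -, h0⟩ := (hloc x hx).1 hxC
    refine mem_closure_inter_of_ray (d := -((P 2 - P 1) + (P 0 - P 1))) Metric.isOpen_ball hx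
      fun t ht => ?_
    simp only [smul_neg, ← neg_smul]
    have := mul_pos ht hc0
    refine h0.imp (fun h0 => ?_) (fun h0 => ?_)
    · rw [ef, h0]; linarith
    · rw [eg, h0]; linarith

lemma localSplit (h : SimpleCycle n P) {y : Plane} (hy : y ∈ curve P) :
    ∃ B S₁ S₂, IsLocalSplit (curve P) y B S₁ S₂ := by
  have h3 := h.three_le
  obtain ⟨i, hi⟩ := mem_iUnion.1 hy
  have vert : ∀ i, ∃ B S₁ S₂, IsLocalSplit (curve P) (P i) B S₁ S₂ := by
    intro i
    -- The shift is by `i - 1` modulo `n`, so vertex `i` gets index 1.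
    obtain ⟨r, -, hs⟩ := (h.shift (i + (n - 1))).localSplit_vertex rfl
    rw [h.curve_shift] at hs
    have : P (i + (n - 1) + 1) = P i := by
      rw [show i + (n - 1) + 1 = i + n by omega, h.periodic]
    simp only [this] at hs
    exact ⟨_, _, _, hs⟩
  by_cases h0 : y = P i
  · exact h0 ▸ vert i
  by_cases h1 : y = P (i + 1)
  · exact h1 ▸ vert (i + 1)
  obtain ⟨r, -, hs⟩ := (h.shift i).localSplit_edge
    (mem_openSegment_of_ne_left_right (Ne.symm h0) (Ne.symm h1) hi)
  rw [h.curve_shift] at hs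
  exact ⟨_, _, _, hs⟩

lemma curve_subset_closure_component (h : SimpleCycle n P) {x : Plane} (hx : x ∉ curve P) :
    curve P ⊆ closure (connectedComponentIn (curve P)ᶜ x) :=
  closure_component_of_localSplit h.isClosed_curve h.isPreconnected_curve
    ⟨_, h.vertex_mem_curve 0⟩ (fun _ hy => h.localSplit hy) hx

lemma disjoint_component (h : SimpleCycle n P) (a : ℕ) (x : Plane) :
    Disjoint (connectedComponentIn (curve P)ᶜ x) (trace (edgeList P a n)) := by
  rw [h.trace_edgeList]
  exact disjoint_left.2 fun z hz => connectedComponentIn_subset _ _ hz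

/-- The polygonal Jordan curve theorem. -/
lemma exists_two_components (h : SimpleCycle n P) :
    ∃ p q, p ∉ curve P ∧ q ∉ curve P ∧ parity (edgeList P 0 n) p = -1 ∧
      parity (edgeList P 0 n) q = 1 ∧ ∀ x, x ∉ curve P →
      x ∈ connectedComponentIn (curve P)ᶜ p ∨ x ∈ connectedComponentIn (curve P)ᶜ q := by
  have h3 := h.three_le
  have hne := h.ne_succ 0
  rw [zero_add] at hne
  obtain ⟨y, hy⟩ : (openSegment ℝ (P 0) (P 1)).Nonempty :=
    ⟨_, 1/2, 1/2, by norm_num, by norm_num, by norm_num, rfl⟩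
  have hy' : y ∉ trace (edgeList P 1 (n - 1)) := by
    intro hc
    obtain ⟨i, h1, h2, hi⟩ := mem_trace_edgeList.1 hc
    rcases h.edge_inter 0 i y (by omega) (by omega) (openSegment_subset_segment ℝ _ _ hy) hi with
      ⟨rfl, rfl⟩ | ⟨-, rfl⟩
    · rw [zero_add, right_mem_openSegment_iff] at hy; exact hne hy
    · rw [left_mem_openSegment_iff] at hy; exact hne hy
  have hL : edgeList P 0 n = (P 0, P 1) :: edgeList P 1 (n - 1) := by
    obtain ⟨k, rfl⟩ : ∃ k, n = k + 1 := ⟨n - 1, by omega⟩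
    rw [edgeList_succ, Nat.add_sub_cancel]
  obtain ⟨c, hc, hflip⟩ := parity_flip (h.isCycle 0) (List.Perm.of_eq hL) hne hy hy'
  obtain ⟨r, hr, hs⟩ := h.localSplit_edge hy
  have hyC : y ∈ curve P := h.edge_subset_curve 0 (openSegment_subset_segment ℝ _ _ hy)
  have hlin : ∀ x, cross (P 1 - P 0) (x - P 0) = cross (P 1 - P 0) (x - y) := by
    intro x
    obtain ⟨s, t, -, -, hst, rfl⟩ := hy
    have : x - P 0 = (x - (s • P 0 + t • P 1)) + t • (P 1 - P 0) := by
      rw [show s = 1 - t by linarith]; module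
    rw [this, cross_add_right, cross_smul_right, cross_self, mul_zero, add_zero]
  simp only [hlin] at hflip
  obtain ⟨U, hU, hUo, hyU⟩ := eventually_nhds_iff.1 hflip
  obtain ⟨p, hpU, hp⟩ := mem_closure_iff.1 (hs.closure₁ ⟨hs.mem, hyC⟩) U hUo hyU
  obtain ⟨q, hqU, hq⟩ := mem_closure_iff.1 (hs.closure₂ ⟨hs.mem, hyC⟩) U hUo hyU
  have hpp : parity (edgeList P 0 n) p = c := (hU p hpU).1 hp.2
  have hqq : parity (edgeList P 0 n) q = -c := (hU q hqU).2 hq.2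
  -- Every component is adherent to `y` and so contains one of the two half discs at `y`: there are
  -- at most two components. The parities `c` and `-c` will keep them apart.
  have hall : ∀ x, x ∉ curve P →
      x ∈ connectedComponentIn (curve P)ᶜ p ∨ x ∈ connectedComponentIn (curve P)ᶜ q := by
    intro x hx
    have hxm := mem_connectedComponentIn (F := (curve P)ᶜ) hx
    rcases hs.subset_component (h.curve_subset_closure_component hx hyC) with h1 | h1
    · left; rw [← connectedComponentIn_eq (h1.1 hp)]; exact hxm
    · right; rw [← connectedComponentIn_eq (h1.1 hq)]; exact hxm
  rcases hc with rfl | rfl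
  · exact ⟨q, p, hs.sub₂ hq, hs.sub₁ hp, hqq, hpp, fun x hx => (hall x hx).symm⟩
  · exact ⟨p, q, hs.sub₁ hp, hs.sub₂ hq, hpp, by rw [hqq, neg_neg], hall⟩

/-- The component of parity `-1` is bounded because parity is 1 far away. The other one cannot be
bounded too, since the two components and the curve cover the plane. -/
lemma exists_components (h : SimpleCycle n P) :
    ∃ p q, p ∉ curve P ∧ q ∉ curve P ∧ inside (curve P) = connectedComponentIn (curve P)ᶜ p ∧
      outside (curve P) = connectedComponentIn (curve P)ᶜ q ∧
      parity (edgeList P 0 n) p = -1 := by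
  obtain ⟨p, q, hp, hq, hpp, hqq, hall⟩ := h.exists_two_components
  set L := edgeList P 0 n with hL
  have hLc : IsCycle L := h.isCycle 0
  have hpar : ∀ z x, x ∈ connectedComponentIn (curve P)ᶜ z → z ∉ curve P →
      parity L x = parity L z := fun z x hx hz =>
    parity_const hLc isPreconnected_connectedComponentIn (h.disjoint_component 0 z) hx
      (mem_connectedComponentIn hz)
  have hev := eventually_parity_eq_one hLc
  have hpb : Bornology.IsBounded (connectedComponentIn (curve P)ᶜ p) := by
    rw [← Bornology.isCobounded_compl_iff]
    filter_upwards [hev] with z hz hzp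
    have := (hpar p z hzp hp).symm.trans hz.2
    rw [hpp] at this; norm_num at this
  have hqb : ¬ Bornology.IsBounded (connectedComponentIn (curve P)ᶜ q) := by
    intro hb
    have hb' := (hpb.union hb).union (isCompact_trace L).isBounded
    have : (univ : Set Plane) ⊆ _ := fun z _ => show z ∈ (connectedComponentIn (curve P)ᶜ p ∪
      connectedComponentIn (curve P)ᶜ q) ∪ trace L by
        by_cases hz : z ∈ curve P
        · right; rw [hL, h.trace_edgeList]; exact hz
        · left; exact hall z hz
    exact NormedSpace.unbounded_univ ℝ Plane (hb'.subset this)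
  refine ⟨p, q, hp, hq, ?_, ?_, hpp⟩
  · ext x
    constructor
    · rintro ⟨hx, hb⟩
      rcases hall x hx with h | h
      · exact h
      · rw [← connectedComponentIn_eq h] at hb; exact absurd hb hqb
    · intro hx
      refine ⟨connectedComponentIn_subset _ _ hx, ?_⟩
      rw [← connectedComponentIn_eq hx]; exact hpb
  · ext x
    constructor
    · rintro ⟨hx, hb⟩
      rcases hall x hx with h | h
      · rw [← connectedComponentIn_eq h] at hb; exact absurd hpb hb
      · exact h
    · intro hx
      refine ⟨connectedComponentIn_subset _ _ hx, ?_⟩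
      rw [← connectedComponentIn_eq hx]; exact hqb

lemma isPreconnected_inside (h : SimpleCycle n P) : IsPreconnected (inside (curve P)) := by
  obtain ⟨p, q, -, -, h1, -⟩ := h.exists_components
  rw [h1]; exact isPreconnected_connectedComponentIn

lemma isPreconnected_outside (h : SimpleCycle n P) : IsPreconnected (outside (curve P)) := by
  obtain ⟨p, q, -, -, -, h1, -⟩ := h.exists_components
  rw [h1]; exact isPreconnected_connectedComponentIn

lemma isOpen_inside (h : SimpleCycle n P) : IsOpen (inside (curve P)) := by
  obtain ⟨p, q, -, -, h1, -⟩ := h.exists_components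
  rw [h1]; exact h.isClosed_curve.isOpen_compl.connectedComponentIn

lemma inside_nonempty (h : SimpleCycle n P) : (inside (curve P)).Nonempty := by
  obtain ⟨p, q, hp, -, h1, -⟩ := h.exists_components
  rw [h1]; exact ⟨p, mem_connectedComponentIn hp⟩

lemma isBounded_inside (h : SimpleCycle n P) : Bornology.IsBounded (inside (curve P)) := by
  obtain ⟨p, q, hp, -, h1, -⟩ := h.exists_components
  have := h1 ▸ mem_connectedComponentIn (F := (curve P)ᶜ) hp
  rw [h1]; exact this.2

lemma not_isBounded_outside (h : SimpleCycle n P) :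
    ¬ Bornology.IsBounded (outside (curve P)) := by
  obtain ⟨p, q, -, hq, -, h1, -⟩ := h.exists_components
  have := h1 ▸ mem_connectedComponentIn (F := (curve P)ᶜ) hq
  rw [h1]; exact this.2

lemma curve_subset_closure_inside (h : SimpleCycle n P) :
    curve P ⊆ closure (inside (curve P)) := by
  obtain ⟨p, q, hp, -, h1, -⟩ := h.exists_components
  rw [h1]; exact h.curve_subset_closure_component hp

lemma curve_subset_closure_outside (h : SimpleCycle n P) :
    curve P ⊆ closure (outside (curve P)) := by
  obtain ⟨p, q, -, hq, -, h1, -⟩ := h.exists_components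
  rw [h1]; exact h.curve_subset_closure_component hq

lemma parity_inside (h : SimpleCycle n P) {x : Plane} (hx : x ∈ inside (curve P)) :
    parity (edgeList P 0 n) x = -1 := by
  obtain ⟨p, q, hp, -, h1, -, h2⟩ := h.exists_components
  rw [← h2]
  exact parity_const (h.isCycle 0) h.isPreconnected_inside
    (h1 ▸ h.disjoint_component 0 p) hx (h1 ▸ mem_connectedComponentIn hp)

/-- A connected set avoiding the curve and meeting the inside lies inside. -/
lemma subset_inside (_ : SimpleCycle n P) {S : Set Plane} (hS : IsPreconnected S)
    (hd : Disjoint S (curve P)) {x : Plane} (hxS : x ∈ S) (hx : x ∈ inside (curve P)) :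
    S ⊆ inside (curve P) := by
  intro z hz
  have hsub := hS.subset_connectedComponentIn hxS (F := (curve P)ᶜ) (subset_compl_iff_disjoint_right.2 hd)
  refine ⟨disjoint_left.1 hd hz, ?_⟩
  rw [← connectedComponentIn_eq (hsub hz)]
  exact hx.2

/-- Every point of the curve is a limit of outside points, so it is not interior to the closed
region. -/
lemma interior_union_inside (h : SimpleCycle n P) :
    interior (curve P ∪ inside (curve P)) = inside (curve P) := by
  apply Subset.antisymm
  · intro x hx
    rcases interior_subset hx with hxC | hxI
    · obtain ⟨z, hz, hzo⟩ := mem_closure_iff.1 (h.curve_subset_closure_outside hxC) _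
        isOpen_interior hx
      rcases interior_subset hz with hzC | hzI
      · exact absurd hzC hzo.1
      · exact absurd hzI.2 hzo.2
    · exact hxI
  · exact interior_maximal subset_union_right h.isOpen_inside

end SimpleCycle

end GenKernel

/-! ### Cutting the region along two segments from an inner point. -/

namespace GenKernel
open Set Filter Topology

/-- The arc of a polygonal curve from the vertex `P 0` to the point `y` of the edge `j`. -/
def arcTo (P : ℕ → Plane) (j : ℕ) (y : Plane) : Set Plane :=
  trace (edgeList P 0 j) ∪ segment ℝ (P j) y

/-- The arc of a polygonal curve from the point `y` of the edge `j` to the vertex `P n`. -/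
def arcFrom (P : ℕ → Plane) (n j : ℕ) (y : Plane) : Set Plane :=
  segment ℝ y (P (j + 1)) ∪ trace (edgeList P (j + 1) (n - 1 - j))

/-- The cycle that runs along `arcTo` and returns through `s`. -/
def cycleTo (P : ℕ → Plane) (j : ℕ) (y s : Plane) : List (Plane × Plane) :=
  edgeList P 0 j ++ [(P j, y), (y, s), (s, P 0)]

/-- The cycle that runs along `arcFrom` and returns through `s`. -/
def cycleFrom (P : ℕ → Plane) (n j : ℕ) (y s : Plane) : List (Plane × Plane) :=
  (P 0, s) :: (edgeList P (j + 1) (n - 1 - j) ++ [(s, y), (y, P (j + 1))])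

/-- Two segments from `s` to the points `P 0` and `y` of the curve that run inside. -/
structure IsCut (n : ℕ) (P : ℕ → Plane) (j : ℕ) (y s : Plane) : Prop where
  one_le : 1 ≤ j
  lt : j < n
  mem_edge : y ∈ edge P j
  ne : y ≠ P (j + 1)
  mem_inside : s ∈ inside (curve P)
  left : openSegment ℝ s (P 0) ⊆ inside (curve P)
  right : openSegment ℝ s y ⊆ inside (curve P)

/-- Two points that see each other end on the same ray only if they agree. -/
lemma eq_of_same_ray {I : Set Plane} {s a b o : Plane} (hs : s ∈ I) (ha : a ∉ I) (hb : b ∉ I)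
    (hsa : openSegment ℝ s a ⊆ I) (hsb : openSegment ℝ s b ⊆ I) (hoa : o ∈ openSegment ℝ s a)
    (hob : o ∈ segment ℝ s b) : a = b := by
  have hsa' : s ≠ a := by rintro rfl; exact ha hs
  have hos : o ≠ s := by
    rintro rfl; rw [left_mem_openSegment_iff] at hoa; exact hsa' hoa
  have hob' : o ∈ openSegment ℝ s b := by
    refine mem_openSegment_of_ne_left_right hos.symm ?_ hob
    rintro rfl; exact hb (hsa hoa)
  rw [openSegment_eq_image'] at hoa hob'
  obtain ⟨l, ⟨hl0, hl1⟩, rfl⟩ := hoa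
  obtain ⟨m, ⟨hm0, hm1⟩, hm⟩ := hob'
  have hm : m • (b - s) = l • (a - s) := add_left_cancel hm
  rcases lt_trichotomy l m with h | h | h
  · exfalso; apply hb; apply hsa
    rw [openSegment_eq_image']
    refine ⟨l / m, ⟨by positivity, (div_lt_one hm0).2 h⟩, ?_⟩
    have : b - s = (l / m) • (a - s) := by
      rw [div_eq_inv_mul, mul_smul, ← hm, smul_smul, inv_mul_cancel₀ hm0.ne', one_smul]
    simp only
    rw [← this]; abel
  · rw [h] at hm
    have := smul_right_injective Plane hm0.ne' hm
    exact (sub_left_injective this).symm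
  · exfalso; apply ha; apply hsb
    rw [openSegment_eq_image']
    refine ⟨m / l, ⟨by positivity, (div_lt_one hl0).2 h⟩, ?_⟩
    have : a - s = (m / l) • (b - s) := by
      rw [div_eq_inv_mul, mul_smul, hm, smul_smul, inv_mul_cancel₀ hl0.ne', one_smul]
    simp only
    rw [← this]; abel

lemma mem_segment_cases {s y z : Plane} (h : z ∈ segment ℝ s y) :
    z = s ∨ z = y ∨ z ∈ openSegment ℝ s y := by
  by_cases h1 : z = s
  · exact Or.inl h1
  by_cases h2 : z = y
  · exact Or.inr (Or.inl h2)
  exact Or.inr (Or.inr (mem_openSegment_of_ne_left_right (Ne.symm h1) (Ne.symm h2) h))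

namespace SimpleCycle

variable {n : ℕ} {P : ℕ → Plane}

/-- A cycle in the closed region does not wind around points of the curve that it misses. -/
lemma parity_curve (h : SimpleCycle n P) {L : List (Plane × Plane)} (hL : IsCycle L)
    (hsub : trace L ⊆ curve P ∪ inside (curve P)) {z : Plane} (hz : z ∈ curve P)
    (hzL : z ∉ trace L) : parity L z = 1 := by
  -- Parity is constant near `z`, and arbitrarily near `z` there are outside points. The outside is
  -- connected, unbounded and disjoint from the cycle, so parity is 1 on it.
  obtain ⟨U, hU, hUo, hzU⟩ := eventually_nhds_iff.1 (parity_eventually_eq hL hzL)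
  obtain ⟨w, hwU, hw⟩ := mem_closure_iff.1 (h.curve_subset_closure_outside hz) U hUo hzU
  rw [← (hU w hwU).2]
  refine parity_eq_one_of_unbounded hL h.isPreconnected_outside ?_ h.not_isBounded_outside hw
  refine disjoint_left.2 fun x hx hxL => ?_
  rcases hsub hxL with h1 | h1
  · exact hx.1 h1
  · exact hx.2 h1.2

lemma vertex_mem_edge (h : SimpleCycle n P) {i j : ℕ} (hj : P i ∈ edge P j) :
    i ≡ j [MOD n] ∨ i ≡ j + 1 [MOD n] := by
  have h3 := h.three_le
  obtain ⟨k, hk1, hk2, hk⟩ := h.exists_rep j i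
  rw [h.congr hk] at hj
  rcases hk1.eq_or_lt with rfl | hlt
  · exact Or.inl hk
  · rcases h.edge_inter j k (P k) hlt hk2 hj (left_mem_segment ℝ _ _) with ⟨rfl, -⟩ | ⟨-, he⟩
    · exact Or.inr hk
    · exact absurd he.symm (h.ne_of_lt hlt hk2)

lemma segment_subset_edge (_ : SimpleCycle n P) {j : ℕ} {y : Plane} (hy : y ∈ edge P j) :
    segment ℝ (P j) y ⊆ edge P j :=
  (convex_segment _ _).segment_subset (left_mem_segment ℝ _ _) hy

lemma segment_subset_edge' (_ : SimpleCycle n P) {j : ℕ} {y : Plane} (hy : y ∈ edge P j) :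
    segment ℝ y (P (j + 1)) ⊆ edge P j :=
  (convex_segment _ _).segment_subset hy (right_mem_segment ℝ _ _)

variable {j : ℕ} {y s : Plane}

lemma arcTo_subset (h : SimpleCycle n P) (hy : y ∈ edge P j) : arcTo P j y ⊆ curve P := by
  rintro x (hx | hx)
  · obtain ⟨i, -, -, hi⟩ := mem_trace_edgeList.1 hx
    exact h.edge_subset_curve i hi
  · exact h.edge_subset_curve j (h.segment_subset_edge hy hx)

lemma arcFrom_subset (h : SimpleCycle n P) (hy : y ∈ edge P j) : arcFrom P n j y ⊆ curve P := by
  rintro x (hx | hx)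
  · exact h.edge_subset_curve j (h.segment_subset_edge' hy hx)
  · obtain ⟨i, -, -, hi⟩ := mem_trace_edgeList.1 hx
    exact h.edge_subset_curve i hi

lemma subset_arcs (h : SimpleCycle n P) (hjn : j < n) (hy : y ∈ edge P j) :
    curve P ⊆ arcTo P j y ∪ arcFrom P n j y := by
  intro x hx
  obtain ⟨i, -, h2, hi⟩ := (h.mem_curve 0).1 hx
  rcases lt_trichotomy i j with hij | rfl | hij
  · exact Or.inl (Or.inl (mem_trace_edgeList.2 ⟨i, by omega, by omega, hi⟩))
  · have hx' : x ∈ segment ℝ (P i) y ∪ segment ℝ y (P (i + 1)) := by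
      have : y ∈ segment ℝ (P i) (P (i + 1)) := hy
      have hi : x ∈ segment ℝ (P i) (P (i + 1)) := hi
      rw [segment_eq_image'] at this hi
      obtain ⟨a, ha, rfl⟩ := this
      obtain ⟨b, hb, rfl⟩ := hi
      simp only
      rcases le_total b a with hab | hab
      · left
        rcases ha.1.eq_or_lt with h0 | h0
        · have : b = 0 := le_antisymm (h0 ▸ hab) hb.1
          rw [this, zero_smul, add_zero]; exact left_mem_segment ℝ _ _
        · rw [segment_eq_image']
          refine ⟨b / a, ⟨div_nonneg hb.1 ha.1, (div_le_one h0).2 hab⟩, ?_⟩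
          simp only [add_sub_cancel_left, smul_smul]
          rw [div_mul_cancel₀ _ h0.ne']
      · right
        rw [segment_symm]
        rcases ha.2.eq_or_lt with h0 | h0
        · have : b = 1 := le_antisymm hb.2 (h0 ▸ hab)
          rw [this, one_smul, add_sub_cancel]; exact left_mem_segment ℝ _ _
        · rw [segment_eq_image']
          have h1 : 0 < 1 - a := by linarith
          refine ⟨(1 - b) / (1 - a), ⟨div_nonneg (by linarith [hb.2]) h1.le,
            (div_le_one h1).2 (by linarith)⟩, ?_⟩
          have e : P i + a • (P (i + 1) - P i) - P (i + 1) = (-(1 - a)) • (P (i + 1) - P i) := by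
            module
          simp only [e, smul_smul]
          rw [mul_neg, div_mul_cancel₀ _ h1.ne']
          module
    exact hx'.imp Or.inr Or.inl
  · exact Or.inr (Or.inr (mem_trace_edgeList.2 ⟨i, by omega, by omega, hi⟩))

lemma arcs_inter (h : SimpleCycle n P) (hj : 1 ≤ j) (hjn : j < n) (hy : y ∈ edge P j)
    (hne : y ≠ P (j + 1)) : arcTo P j y ∩ arcFrom P n j y ⊆ {P 0, y} := by
  have hn : P n = P 0 := by rw [← h.periodic 0, zero_add]
  rintro x ⟨hx1 | hx1, hx2 | hx2⟩
  · obtain ⟨i, -, hi, hxi⟩ := mem_trace_edgeList.1 hx1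
    rcases h.edge_inter i j x (by omega) (by omega) hxi (h.segment_subset_edge' hy hx2) with
      ⟨rfl, rfl⟩ | ⟨h1, rfl⟩
    · right
      have hy' : y ∈ segment ℝ (P (i + 1)) (P (i + 1 + 1)) := hy
      by_contra hcon
      have hcon : P (i + 1) ≠ y := hcon
      obtain ⟨a, b, ha, hb, hab, hE⟩ := hx2
      obtain ⟨c, d, hc, hd, hcd, rfl⟩ := hy'
      have hd0 : d ≠ 0 := by
        rintro rfl; apply hcon; rw [show c = 1 by linarith]; module
      have hcz : (a * d + b) • (P (i + 1 + 1) - P (i + 1)) = 0 := by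
        rw [← sub_eq_zero] at hE
        rw [← hE, show c = 1 - d by linarith, show a = 1 - b by linarith]; module
      rcases smul_eq_zero.1 hcz with h0 | h0
      · have hadn := mul_nonneg ha hd
        have hb0 : b = 0 := by linarith
        have : a * d = 0 := by linarith
        rcases mul_eq_zero.1 this with h' | h'
        · linarith
        · exact hd0 h'
      · rw [sub_eq_zero] at h0; exact h.ne_succ (i + 1) h0.symm
    · left
      have : i = 0 := by omega
      rw [this]
  · obtain ⟨i, -, hi, hxi⟩ := mem_trace_edgeList.1 hx1
    obtain ⟨k, hk, hk', hxk⟩ := mem_trace_edgeList.1 hx2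
    rcases h.edge_inter i k x (by omega) (by omega) hxi hxk with ⟨h1, -⟩ | ⟨h1, rfl⟩
    · omega
    · left
      have : i = 0 := by omega
      rw [this]
  · right
    obtain ⟨c, d, hc, hd, hcd, rfl⟩ := hy
    obtain ⟨a, b, ha, hb, hab, rfl⟩ := hx1
    obtain ⟨a', b', ha', hb', hab', hE⟩ := hx2
    have hz : (a' * d + b' - b * d) • (P (j + 1) - P j) = 0 := by
      rw [← sub_eq_zero] at hE
      rw [← hE, show c = 1 - d by linarith, show a = 1 - b by linarith,
        show a' = 1 - b' by linarith]; module
    have h0 := (smul_eq_zero.1 hz).resolve_right (sub_ne_zero.2 (h.ne_succ j).symm)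
    have hd1 : d < 1 := by
      refine lt_of_le_of_ne (by linarith) fun h1 => hne ?_
      rw [h1, show c = 0 by linarith]; module
    obtain rfl : a' = 1 - b' := by linarith
    have hb1 : b ≤ 1 := by linarith
    have e1 : b' * (1 - d) + d * (1 - b) = 0 := by linarith
    have p1 := mul_nonneg hb' (by linarith : 0 ≤ 1 - d)
    have p2 := mul_nonneg hd (by linarith : 0 ≤ 1 - b)
    have q2 : d * (1 - b) = 0 := by linarith
    rw [mem_singleton_iff]
    rcases mul_eq_zero.1 q2 with h' | h'
    · rw [h', show c = 1 by linarith, show a = 1 - b by linarith]; module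
    · rw [show b = 1 by linarith, show a = 0 by linarith]; module
  · obtain ⟨k, hk, hk', hxk⟩ := mem_trace_edgeList.1 hx2
    rcases h.edge_inter j k x (by omega) (by omega) (h.segment_subset_edge hy hx1) hxk with
      ⟨rfl, rfl⟩ | ⟨h1, -⟩
    · exfalso
      obtain ⟨c, d, hc, hd, hcd, rfl⟩ := hy
      obtain ⟨a, b, ha, hb, hab, hE⟩ := hx1
      have hz : (1 - b * d) • (P (j + 1) - P j) = 0 := by
        rw [← sub_eq_zero] at hE
        rw [← neg_eq_zero, ← hE, show c = 1 - d by linarith, show a = 1 - b by linarith]; module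
      have h0 := (smul_eq_zero.1 hz).resolve_right (sub_ne_zero.2 (h.ne_succ j).symm)
      have hd1 : d = 1 := by nlinarith
      apply hne
      rw [hd1, show c = 0 by linarith]; module
    · omega

lemma isCycle_cycleTo (P : ℕ → Plane) (j : ℕ) (y s : Plane) : IsCycle (cycleTo P j y s) := by
  intro f
  simp only [cycleTo, List.map_append, List.sum_append, sum_edgeList, List.map_cons,
    List.sum_cons, List.map_nil, List.sum_nil, zero_add]
  abel

lemma isCycle_cycleFrom (h : SimpleCycle n P) (hjn : j < n) : IsCycle (cycleFrom P n j y s) := by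
  intro f
  simp only [cycleFrom, List.map_append, List.sum_append, sum_edgeList, List.map_cons,
    List.sum_cons, List.map_nil, List.sum_nil]
  rw [show j + 1 + (n - 1 - j) = 0 + n by omega, h.periodic]
  abel

lemma trace_cycleTo : trace (cycleTo P j y s) =
    arcTo P j y ∪ (segment ℝ s (P 0) ∪ segment ℝ s y) := by
  simp only [cycleTo, trace_append, trace_cons, trace_nil, union_empty, arcTo]
  rw [segment_symm ℝ y s, union_comm (segment ℝ s y), union_assoc]

lemma trace_cycleFrom : trace (cycleFrom P n j y s) =
    arcFrom P n j y ∪ (segment ℝ s (P 0) ∪ segment ℝ s y) := by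
  simp only [cycleFrom, trace_append, trace_cons, trace_nil, union_empty, arcFrom]
  rw [segment_symm ℝ (P 0) s]
  ext x; simp only [mem_union]; tauto

/-- The two cycles run through `s` in opposite directions, so these parts cancel. The two parts of
edge `j` add up by `ang_add`. -/
lemma wind_add (hjn : j < n) (hy : y ∈ edge P j) {x : Plane}
    (hx : x ∉ edge P j) (h0 : x ∉ segment ℝ s (P 0)) (h1 : x ∉ segment ℝ s y) :
    wind (cycleTo P j y s) x + wind (cycleFrom P n j y s) x = wind (edgeList P 0 n) x := by
  have hsplit : edgeList P 0 n = edgeList P 0 j ++ (P j, P (j + 1)) :: edgeList P (j + 1) (n - 1 - j) := by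
    rw [← edgeList_succ]
    have := edgeList_add P 0 j (n - 1 - j + 1)
    rw [show j + (n - 1 - j + 1) = n by omega, zero_add] at this
    exact this
  rw [hsplit]
  simp only [cycleTo, cycleFrom, wind_append, wind_cons]
  have e0 : wind [] x = 0 := by simp [wind]
  rw [e0, ← ang_add hx hy, ang_swap h0, ang_swap h1]
  ring

end SimpleCycle

namespace IsCut

open SimpleCycle

variable {n : ℕ} {P : ℕ → Plane} {j : ℕ} {y s : Plane}

lemma trace_subset (h : SimpleCycle n P) (hc : IsCut n P j y s) :
    segment ℝ s (P 0) ∪ segment ℝ s y ⊆ curve P ∪ inside (curve P) := by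
  rintro x (hx | hx)
  · rcases mem_segment_cases hx with rfl | rfl | hx
    · exact Or.inr hc.mem_inside
    · exact Or.inl (h.vertex_mem_curve 0)
    · exact Or.inr (hc.left hx)
  · rcases mem_segment_cases hx with rfl | rfl | hx
    · exact Or.inr hc.mem_inside
    · exact Or.inl (h.edge_subset_curve j hc.mem_edge)
    · exact Or.inr (hc.right hx)

lemma path_inter_curve (hc : IsCut n P j y s) {x : Plane}
    (hx : x ∈ segment ℝ s (P 0) ∪ segment ℝ s y) (hxC : x ∈ curve P) : x = P 0 ∨ x = y := by
  rcases hx with hx | hx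
  · rcases mem_segment_cases hx with rfl | rfl | hx
    · exact absurd hxC hc.mem_inside.1
    · exact Or.inl rfl
    · exact absurd hxC (hc.left hx).1
  · rcases mem_segment_cases hx with rfl | rfl | hx
    · exact absurd hxC hc.mem_inside.1
    · exact Or.inr rfl
    · exact absurd hxC (hc.right hx).1

lemma ends_mem_arcTo (hc : IsCut n P j y s) : P 0 ∈ arcTo P j y ∧ y ∈ arcTo P j y :=
  ⟨Or.inl (mem_trace_edgeList.2 ⟨0, le_rfl, by have := hc.one_le; omega, left_mem_segment ℝ _ _⟩),
    Or.inr (right_mem_segment ℝ _ _)⟩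

lemma ends_mem_arcFrom (h : SimpleCycle n P) (hc : IsCut n P j y s) :
    P 0 ∈ arcFrom P n j y ∧ y ∈ arcFrom P n j y := by
  have hn : P n = P 0 := by rw [← h.periodic 0, zero_add]
  refine ⟨?_, Or.inl (left_mem_segment ℝ _ _)⟩
  have := hc.lt
  rcases Nat.lt_or_ge (j + 1) n with h1 | h1
  · refine Or.inr (mem_trace_edgeList.2 ⟨n - 1, by omega, by omega, ?_⟩)
    unfold edge
    rw [show n - 1 + 1 = n by omega, hn]
    exact right_mem_segment ℝ _ _
  · refine Or.inl ?_
    rw [show j + 1 = n by omega, hn]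
    exact right_mem_segment ℝ _ _

/-- The points of the curve off the first arc are not enclosed by the first cycle. -/
lemma parity_cycleTo (h : SimpleCycle n P) (hc : IsCut n P j y s) {z : Plane} (hz : z ∈ curve P)
    (hz' : z ∉ arcTo P j y) : z ∉ trace (cycleTo P j y s) ∧ parity (cycleTo P j y s) z = 1 := by
  have h1 : z ∉ trace (cycleTo P j y s) := by
    rw [trace_cycleTo]
    rintro (h1 | h1)
    · exact hz' h1
    · rcases hc.path_inter_curve h1 hz with rfl | rfl
      · exact hz' hc.ends_mem_arcTo.1
      · exact hz' hc.ends_mem_arcTo.2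
  refine ⟨h1, h.parity_curve (isCycle_cycleTo P j y s) ?_ hz h1⟩
  rw [trace_cycleTo]
  exact union_subset ((h.arcTo_subset hc.mem_edge).trans subset_union_left) (hc.trace_subset h)

lemma parity_cycleFrom (h : SimpleCycle n P) (hc : IsCut n P j y s) {z : Plane} (hz : z ∈ curve P)
    (hz' : z ∉ arcFrom P n j y) :
    z ∉ trace (cycleFrom P n j y s) ∧ parity (cycleFrom P n j y s) z = 1 := by
  have h1 : z ∉ trace (cycleFrom P n j y s) := by
    rw [trace_cycleFrom]
    rintro (h1 | h1)
    · exact hz' h1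
    · rcases hc.path_inter_curve h1 hz with rfl | rfl
      · exact hz' (hc.ends_mem_arcFrom h).1
      · exact hz' (hc.ends_mem_arcFrom h).2
  refine ⟨h1, h.parity_curve (h.isCycle_cycleFrom hc.lt) ?_ hz h1⟩
  rw [trace_cycleFrom]
  exact union_subset ((h.arcFrom_subset hc.mem_edge).trans subset_union_left) (hc.trace_subset h)

/-- The two winding numbers have the odd sum that belongs to the polygon, so exactly one of them is
odd. In the addition formula for the cosine the sine term vanishes. -/
lemma parity_mul (h : SimpleCycle n P) (hc : IsCut n P j y s) {x : Plane}
    (hx : x ∈ inside (curve P)) (hx' : x ∉ segment ℝ s (P 0) ∪ segment ℝ s y) :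
    x ∉ trace (cycleTo P j y s) ∧ x ∉ trace (cycleFrom P n j y s) ∧
      parity (cycleTo P j y s) x * parity (cycleFrom P n j y s) x = -1 := by
  have h1 : x ∉ trace (cycleTo P j y s) := by
    rw [trace_cycleTo]
    rintro (h1 | h1)
    · exact hx.1 (h.arcTo_subset hc.mem_edge h1)
    · exact hx' h1
  have h2 : x ∉ trace (cycleFrom P n j y s) := by
    rw [trace_cycleFrom]
    rintro (h1 | h1)
    · exact hx.1 (h.arcFrom_subset hc.mem_edge h1)
    · exact hx' h1
  refine ⟨h1, h2, ?_⟩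
  have hp := h.parity_inside hx
  rw [mem_union, not_or] at hx'
  unfold parity at hp ⊢
  rw [← wind_add hc.lt hc.mem_edge (fun hxe => hx.1 (h.edge_subset_curve j hxe)) hx'.1 hx'.2,
    add_div, Real.cos_add, sin_half_wind (isCycle_cycleTo P j y s) h1] at hp
  linarith

/-- A connected part of the region that misses a cut lies on one side of it. -/
lemma subset_or_subset (h : SimpleCycle n P) (hc : IsCut n P j y s) {U : Set Plane}
    (hU : IsPreconnected U) (hsub : U ⊆ curve P ∪ inside (curve P))
    (hd : Disjoint U (segment ℝ s (P 0) ∪ segment ℝ s y)) :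
    (U ⊆ {x | x ∉ trace (cycleFrom P n j y s) ∧ parity (cycleFrom P n j y s) x = 1} ∧
      closure U ∩ curve P ⊆ arcTo P j y) ∨
    (U ⊆ {x | x ∉ trace (cycleTo P j y s) ∧ parity (cycleTo P j y s) x = 1} ∧
      closure U ∩ curve P ⊆ arcFrom P n j y) := by
  -- `O₂` consists of the points not enclosed by the second cycle, so it is the side of the first
  -- arc, and `O₁` is the side of the second arc. An inner point off the cut is in exactly one of
  -- them by `parity_mul`; a boundary point of `U` is on one arc only and lies in the set of that
  -- arc. So the connected set `U` is in one of these open sets, and a boundary point off the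
  -- corresponding arc has a neighbourhood in the other set.
  set O₂ := {x | x ∉ trace (cycleFrom P n j y s) ∧ parity (cycleFrom P n j y s) x = 1} with hO₂
  set O₁ := {x | x ∉ trace (cycleTo P j y s) ∧ parity (cycleTo P j y s) x = 1} with hO₁
  have ho₁ : IsOpen O₁ := isOpen_parity (isCycle_cycleTo P j y s) 1
  have ho₂ : IsOpen O₂ := isOpen_parity (h.isCycle_cycleFrom hc.lt) 1
  have hcover : U ⊆ O₂ ∪ O₁ := by
    intro x hx
    have hxp := disjoint_left.1 hd hx
    rcases hsub hx with hxC | hxI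
    · by_cases hx1 : x ∈ arcTo P j y
      · by_cases hx2 : x ∈ arcFrom P n j y
        · exfalso; apply hxp
          rcases h.arcs_inter hc.one_le hc.lt hc.mem_edge hc.ne ⟨hx1, hx2⟩ with rfl | rfl
          · exact Or.inl (right_mem_segment ℝ _ _)
          · exact Or.inr (right_mem_segment ℝ _ _)
        · exact Or.inl (hc.parity_cycleFrom h hxC hx2)
      · exact Or.inr (hc.parity_cycleTo h hxC hx1)
    · obtain ⟨h1, h2, h3⟩ := hc.parity_mul h hxI hxp
      rcases parity_eq (isCycle_cycleTo P j y s) h1 with h4 | h4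
      · exact Or.inr ⟨h1, h4⟩
      · refine Or.inl ⟨h2, ?_⟩
        rw [h4] at h3; linarith
  have hdisj : U ∩ (O₂ ∩ O₁) = ∅ := by
    rw [← not_nonempty_iff_eq_empty]
    rintro ⟨x, hx, h2, h1⟩
    rcases hsub hx with hxC | hxI
    · have h1' := h1.1
      have h2' := h2.1
      rw [trace_cycleTo] at h1'
      rw [trace_cycleFrom] at h2'
      rcases h.subset_arcs hc.lt hc.mem_edge hxC with h3 | h3
      · exact h1' (Or.inl h3)
      · exact h2' (Or.inl h3)
    · obtain ⟨-, -, h3⟩ := hc.parity_mul h hxI (disjoint_left.1 hd hx)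
      rw [h1.2, h2.2] at h3; norm_num at h3
  have hU' : ∀ x ∈ U, x ∈ O₂ → x ∈ O₁ → False := fun x hx h2 h1 =>
    (hdisj ▸ (⟨hx, h2, h1⟩ : x ∈ U ∩ (O₂ ∩ O₁)) : x ∈ (∅ : Set Plane))
  rcases isPreconnected_iff_subset_of_disjoint.1 hU O₂ O₁ ho₂ ho₁ hcover hdisj with hs | hs
  · refine Or.inl ⟨hs, fun z hz => ?_⟩
    by_contra hzA
    obtain ⟨w, hw1, hwU⟩ := mem_closure_iff.1 hz.1 O₁ ho₁ (hc.parity_cycleTo h hz.2 hzA)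
    exact hU' w hwU (hs hwU) hw1
  · refine Or.inr ⟨hs, fun z hz => ?_⟩
    by_contra hzA
    obtain ⟨w, hw2, hwU⟩ := mem_closure_iff.1 hz.1 O₂ ho₂ (hc.parity_cycleFrom h hz.2 hzA)
    exact hU' w hwU hw2 (hs hwU)

lemma ne_zero (h : SimpleCycle n P) (hc : IsCut n P j y s) : y ≠ P 0 := by
  rintro rfl
  have := hc.one_le
  have hlt := hc.lt
  rcases h.edge_inter 0 j (P 0) (by omega) (by omega) (left_mem_segment ℝ _ _) hc.mem_edge with
    ⟨rfl, h2⟩ | ⟨h1, -⟩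
  · exact h.ne_succ 0 h2
  · apply hc.ne; rw [h1, h.periodic]

/-- Near each point of the first segment of a cut there are points on the side of the first arc. -/
lemma exists_side (h : SimpleCycle n P) (hc : IsCut n P j y s) {o : Plane}
    (ho : o ∈ openSegment ℝ s (P 0)) {N : Set Plane} (hN : IsOpen N) (hoN : o ∈ N) :
    ∃ V ⊆ N, IsOpen V ∧ V.Nonempty ∧ V ⊆ inside (curve P) ∧
      ∀ x ∈ V, cross (P 0 - s) (x - s) ≠ 0 ∧ ∀ U : Set Plane, IsPreconnected U →
        U ⊆ curve P ∪ inside (curve P) →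
        Disjoint U (segment ℝ s (P 0) ∪ segment ℝ s y) → x ∈ U →
        closure U ∩ curve P ⊆ arcTo P j y := by
  have hs0 : P 0 ≠ s := by rintro he; exact hc.mem_inside.1 (he ▸ h.vertex_mem_curve 0)
  have hoI := hc.left ho
  set L' := edgeList P (j + 1) (n - 1 - j) ++ [(s, y), (y, P (j + 1))] with hL'
  have hoL : o ∉ trace L' := by
    simp only [hL', trace_append, trace_cons, trace_nil, union_empty]
    rintro (h1 | h1 | h1)
    · obtain ⟨i, -, -, hi⟩ := mem_trace_edgeList.1 h1
      exact hoI.1 (h.edge_subset_curve i hi)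
    · refine hc.ne_zero h (eq_of_same_ray hc.mem_inside ?_ ?_ hc.left hc.right ho h1).symm
      · exact fun h2 => h2.1 (h.vertex_mem_curve 0)
      · exact fun h2 => h2.1 (h.edge_subset_curve j hc.mem_edge)
    · exact hoI.1 (h.edge_subset_curve j (h.segment_subset_edge' hc.mem_edge h1))
  -- The second cycle passes `o` only along its first segment, from `P 0` to `s`. So its parity
  -- changes there, and it is 1 on exactly one side near `o`; this is the side of the first arc.
  obtain ⟨c, hcc, hflip⟩ := parity_flip (L := cycleFrom P n j y s) (h.isCycle_cycleFrom hc.lt)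
    (List.Perm.refl _) hs0 (by rwa [openSegment_symm]) hoL
  obtain ⟨W, hW, hWo, hoW⟩ := eventually_nhds_iff.1 hflip
  have hline : cross (s - P 0) (o - P 0) = 0 := by
    obtain ⟨a, b, -, -, hab, rfl⟩ := ho
    rw [show a • s + b • P 0 - P 0 = a • (s - P 0) by rw [show b = 1 - a by linarith]; module,
      cross_smul_right, cross_self, mul_zero]
  have hrot := cross_rot_pos (sub_ne_zero.2 hs0.symm)
  obtain ⟨e, hee, hside⟩ : ∃ e : ℝ, (e = 1 ∨ e = -1) ∧ ∀ x ∈ W,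
      0 < e * cross (s - P 0) (x - P 0) → parity (cycleFrom P n j y s) x = 1 := by
    rcases hcc with rfl | rfl
    · exact ⟨1, Or.inl rfl, fun x hx hp => (hW x hx).1 (by linarith)⟩
    · exact ⟨-1, Or.inr rfl, fun x hx hp => by
        rw [(hW x hx).2 (by linarith), neg_neg]⟩
  set B := ((N ∩ W) ∩ (inside (curve P) ∩ (trace L')ᶜ)) with hB
  have hBo : IsOpen B := (hN.inter hWo).inter (h.isOpen_inside.inter (isClosed_trace L').isOpen_compl)
  have hoB : o ∈ B := ⟨⟨hoN, hoW⟩, hoI, hoL⟩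
  have hcl := mem_closure_inter_of_ray (S := {x | 0 < e * cross (s - P 0) (x - P 0)})
    (d := e • rot (s - P 0)) hBo hoB (fun t ht => by
      show 0 < e * cross (s - P 0) (o + t • e • rot (s - P 0) - P 0)
      rw [add_sub_right_comm, cross_add_right, hline, cross_smul_right, cross_smul_right, zero_add]
      have : e * (t * (e * cross (s - P 0) (rot (s - P 0)))) =
        (e * e) * (t * cross (s - P 0) (rot (s - P 0))) := by ring
      rw [this]
      have : e * e = 1 := by rcases hee with rfl | rfl <;> norm_num
      rw [this, one_mul]; positivity)
  refine ⟨B ∩ {x | 0 < e * cross (s - P 0) (x - P 0)}, fun x hx => hx.1.1.1,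
    hBo.inter (isOpen_lt continuous_const (by fun_prop)),
    closure_nonempty_iff.1 ⟨o, hcl⟩, fun x hx => hx.1.2.1, ?_⟩
  rintro x ⟨⟨⟨hxN, hxW⟩, hxI, hxL⟩, hx⟩
  have hx : 0 < e * cross (s - P 0) (x - P 0) := hx
  have hxc : cross (P 0 - s) (x - s) ≠ 0 := by
    intro h0
    have : cross (s - P 0) (x - P 0) = -cross (P 0 - s) (x - s) := by simp [cross]; ring
    rw [this, h0] at hx; simp at hx
  refine ⟨hxc, fun U hU hsub hd hxU => ?_⟩
  rcases hc.subset_or_subset h hU hsub hd with h1 | h1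
  · exact h1.2
  · exfalso
    have h2 := hside x hxW hx
    obtain ⟨-, -, h3⟩ := hc.parity_mul h hxI (disjoint_left.1 hd hxU)
    rw [h2, (h1.1 hxU).2] at h3
    norm_num at h3

end IsCut

end GenKernel

/-! ### Segments and triangles: the sweep argument. -/

namespace GenKernel
open Set Filter Topology

/-- Affine coordinates with respect to a triangle. -/
lemma exists_coords {Z Q F : Plane} (hΔ : cross (Q - Z) (F - Z) ≠ 0) :
    ∃ β γ : Plane → ℝ, IsAff β ∧ IsAff γ ∧ (∀ x, x = Z + β x • (Q - Z) + γ x • (F - Z)) ∧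
      ∀ b g, β (Z + b • (Q - Z) + g • (F - Z)) = b ∧ γ (Z + b • (Q - Z) + g • (F - Z)) = g := by
  set Δ := cross (Q - Z) (F - Z) with hΔd
  refine ⟨fun x => Δ⁻¹ * cross (x - Z) (F - Z), fun x => Δ⁻¹ * cross (Q - Z) (x - Z),
    (isAff_sub_cross _ _).const_mul _, (isAff_cross_sub _ _).const_mul _, fun x => ?_,
    fun b g => ?_⟩
  · have h := cross_smul_eq (Q - Z) (F - Z) (x - Z)
    rw [mul_smul, mul_smul, add_assoc, ← smul_add, ← h, smul_smul, inv_mul_cancel₀ hΔ, one_smul]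
    abel
  · have e : Z + b • (Q - Z) + g • (F - Z) - Z = b • (Q - Z) + g • (F - Z) := by abel
    simp only [e, cross_add_left, cross_add_right, cross_smul_left, cross_smul_right, cross_self,
      ← hΔd, mul_zero, add_zero, zero_add]
    constructor <;> field_simp

/-- A segment that leaves a triangle without losing height above one side crosses another side. -/
lemma exists_crossing {α β γ : Plane → ℝ} (hα : IsAff α) (hβ : IsAff β) (hγ : IsAff γ)
    {x a : Plane} (hαx : 0 ≤ α x) (hβx : 0 ≤ β x) (hγx : 0 ≤ γ x)
    (hx : 0 < α x ∨ 0 < β x ∧ 0 < γ x) (hαa : 0 < α a) (ha : β a < 0 ∨ γ a < 0) :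
    ∃ z ∈ segment ℝ x a, 0 < α z ∧ 0 ≤ β z ∧ 0 ≤ γ z ∧ (β z = 0 ∨ γ z = 0) := by
  -- Here `f` is the coordinate that vanishes first on the way from `x` to `a`, and the point found
  -- is its zero. The last hypothesis expresses that `g` has not become negative by then: either it
  -- is nonnegative at `a`, or its zero does not come earlier.
  have main : ∀ f g : Plane → ℝ, IsAff f → IsAff g → 0 ≤ f x → 0 ≤ g x → f a < 0 →
      (0 < α x ∨ 0 < f x) → (0 ≤ g a ∨ f x * (g x - g a) ≤ g x * (f x - f a)) →
      ∃ z ∈ segment ℝ x a, 0 < α z ∧ f z = 0 ∧ 0 ≤ g z := by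
    intro f g hf hg hfx hgx hfa hpos hcmp
    have hd : 0 < f x - f a := by linarith
    have hsum : -f a / (f x - f a) + f x / (f x - f a) = 1 := by field_simp; ring
    have h1 : 0 < -f a / (f x - f a) := div_pos (by linarith) hd
    have h2 : 0 ≤ f x / (f x - f a) := div_nonneg hfx hd.le
    refine ⟨(-f a / (f x - f a)) • x + (f x / (f x - f a)) • a,
      ⟨_, _, h1.le, h2, hsum, rfl⟩, ?_, ?_, ?_⟩
    · rw [hα _ _ _ _ hsum]
      rcases hpos with h | h
      · have := mul_pos h1 h
        have := mul_nonneg h2 hαa.le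
        linarith
      · have h2' : 0 < f x / (f x - f a) := div_pos h hd
        have := mul_nonneg h1.le hαx
        have := mul_pos h2' hαa
        linarith
    · rw [hf _ _ _ _ hsum]; field_simp; ring
    · rw [hg _ _ _ _ hsum]
      rcases hcmp with h | h
      · have := mul_nonneg h1.le hgx
        have := mul_nonneg h2 h
        linarith
      · have : -f a / (f x - f a) * g x + f x / (f x - f a) * g a =
            (g x * (f x - f a) - f x * (g x - g a)) / (f x - f a) := by field_simp; ring
        rw [this]
        exact div_nonneg (by linarith) hd.le
  have hx1 : 0 < α x ∨ 0 < β x := hx.imp id fun h => h.1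
  have hx2 : 0 < α x ∨ 0 < γ x := hx.imp id fun h => h.2
  have fin1 : (∃ z ∈ segment ℝ x a, 0 < α z ∧ β z = 0 ∧ 0 ≤ γ z) →
      ∃ z ∈ segment ℝ x a, 0 < α z ∧ 0 ≤ β z ∧ 0 ≤ γ z ∧ (β z = 0 ∨ γ z = 0) :=
    fun ⟨z, hz, h1, h2, h3⟩ => ⟨z, hz, h1, h2.ge, h3, Or.inl h2⟩
  have fin2 : (∃ z ∈ segment ℝ x a, 0 < α z ∧ γ z = 0 ∧ 0 ≤ β z) →
      ∃ z ∈ segment ℝ x a, 0 < α z ∧ 0 ≤ β z ∧ 0 ≤ γ z ∧ (β z = 0 ∨ γ z = 0) :=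
    fun ⟨z, hz, h1, h2, h3⟩ => ⟨z, hz, h1, h3, h2.ge, Or.inr h2⟩
  by_cases hb : β a < 0
  · by_cases hc : γ a < 0
    · rcases le_total (β x * (γ x - γ a)) (γ x * (β x - β a)) with h | h
      · exact fin1 (main β γ hβ hγ hβx hγx hb hx1 (Or.inr h))
      · exact fin2 (main γ β hγ hβ hγx hβx hc hx2 (Or.inr h))
    · exact fin1 (main β γ hβ hγ hβx hγx hb hx1 (Or.inl (not_lt.1 hc)))
  · exact fin2 (main γ β hγ hβ hγx hβx (ha.resolve_left hb) hx2 (Or.inl (not_lt.1 hb)))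

/-- A segment whose endpoints are off an open triangle and that misses two half-open sides with
common endpoint `Z` misses the triangle up to the third side. -/
lemma disjoint_triangle {Z Q F : Plane} {β γ : Plane → ℝ} (hβ : IsAff β) (hγ : IsAff γ)
    (hcoord : ∀ x, x = Z + β x • (Q - Z) + γ x • (F - Z)) {a b x : Plane}
    (hQ : ∀ g : ℝ, 0 ≤ g → g < 1 → Z + g • (Q - Z) ∉ segment ℝ a b)
    (hF : ∀ g : ℝ, 0 ≤ g → g < 1 → Z + g • (F - Z) ∉ segment ℝ a b)
    (ha : β a < 0 ∨ γ a < 0 ∨ 1 ≤ β a + γ a) (hb : β b < 0 ∨ γ b < 0 ∨ 1 ≤ β b + γ b)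
    (hx : x ∈ segment ℝ a b) (hβx : 0 ≤ β x) (hγx : 0 ≤ γ x) (hαx : β x + γ x ≤ 1)
    (hαx' : β x + γ x < 1 ∨ (0 < β x ∧ 0 < γ x ∧ (β a + γ a < 1 ∨ β b + γ b < 1))) : False := by
  have hα : IsAff fun x => 1 - β x - γ x := by
    intro x y s t hst
    simp only [hβ x y s t hst, hγ x y s t hst]
    linear_combination (-1 : ℝ) * hst
  -- The function `1 - β - γ` measures the height over the side `QF`. Going from `x` to an end with
  -- positive height, the segment cannot leave through `QF`; it must leave through one of the two
  -- sides at `Z`, which it misses.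
  have key : ∀ c : Plane, c ∈ segment ℝ a b → β c + γ c < 1 →
      (β c < 0 ∨ γ c < 0 ∨ 1 ≤ β c + γ c) → (β x + γ x < 1 ∨ (0 < β x ∧ 0 < γ x)) → False := by
    intro c hc hc1 hc2 hxx
    obtain ⟨z, hz, h1, h2, h3, h4⟩ := exists_crossing (x := x) (a := c) hα hβ hγ
      (by linarith) hβx hγx (hxx.imp (fun h => by linarith) id) (by linarith)
      (hc2.imp id fun h => h.resolve_right (by linarith))
    have hzab : z ∈ segment ℝ a b := (convex_segment a b).segment_subset hx hc hz
    rcases h4 with h4 | h4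
    · apply hF (γ z) h3 (by linarith)
      have := hcoord z
      rw [h4, zero_smul, add_zero] at this
      rwa [← this]
    · apply hQ (β z) h2 (by linarith)
      have := hcoord z
      rw [h4, zero_smul, add_zero] at this
      rwa [← this]
  rcases hαx' with h | ⟨h1, h2, h3⟩
  · obtain ⟨s, t, hs, ht, hst, rfl⟩ := hx
    rw [hβ _ _ _ _ hst, hγ _ _ _ _ hst] at h
    have : β a + γ a < 1 ∨ β b + γ b < 1 := by
      by_contra hcon
      push Not at hcon
      have p1 := mul_le_mul_of_nonneg_left hcon.1 hs
      have p2 := mul_le_mul_of_nonneg_left hcon.2 ht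
      nlinarith
    rcases this with h4 | h4
    · exact key a (left_mem_segment ℝ _ _) h4 ha (Or.inl (by
        rw [hβ _ _ _ _ hst, hγ _ _ _ _ hst]; exact h))
    · exact key b (right_mem_segment ℝ _ _) h4 hb (Or.inl (by
        rw [hβ _ _ _ _ hst, hγ _ _ _ _ hst]; exact h))
  · rcases h3 with h4 | h4
    · exact key a (left_mem_segment ℝ _ _) h4 ha (Or.inr ⟨h1, h2⟩)
    · exact key b (right_mem_segment ℝ _ _) h4 hb (Or.inr ⟨h1, h2⟩)

/-- Among the vertices in the triangle `Z Q F`, the one seen from `Q` under the smallest angle with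
`QZ` is visible from `Z`, and also from `Q`. -/
lemma exists_sweep {Z Q F : Plane} (hΔ : cross (Q - Z) (F - Z) ≠ 0) {V : Set Plane}
    (hV : V.Finite) (hFV : F ∈ V) (hZQ : ∀ g : ℝ, 0 ≤ g → g < 1 → Z + g • (Q - Z) ∉ V) :
    ∃ k ∈ V, ∃ b g : ℝ, k = Z + b • (Q - Z) + g • (F - Z) ∧ 0 ≤ b ∧ 0 < g ∧ b + g ≤ 1 ∧
      ∀ v ∈ V, ∀ w ∈ V, (∀ g : ℝ, 0 ≤ g → g < 1 → Z + g • (Q - Z) ∉ segment ℝ v w) →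
        (∀ g : ℝ, 0 ≤ g → g < 1 → Z + g • (F - Z) ∉ segment ℝ v w) →
        (∀ b g : ℝ, 0 ≤ b → 0 ≤ g → b + g < 1 →
          Z + b • (Q - Z) + g • (k - Z) ∉ segment ℝ v w) ∧
        ((∀ z ∈ V, cross (k - Q) (z - Q) = 0 → z = k ∨ z = Q) →
          ¬ ((v = k ∨ v = Q) ∧ (w = k ∨ w = Q)) →
          Disjoint (segment ℝ v w) (openSegment ℝ Q k)) := by
  obtain ⟨β, γ, hβ, hγ, hcoord, huniq⟩ := exists_coords hΔ
  have hQc : β Q = 1 ∧ γ Q = 0 := by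
    have := huniq 1 0
    rwa [one_smul, zero_smul, add_zero, add_sub_cancel] at this
  have hFc : β F = 0 ∧ γ F = 1 := by
    have := huniq 0 1
    rwa [one_smul, zero_smul, add_zero, add_sub_cancel] at this
  set T : Set Plane := {v | v ∈ V ∧ 0 ≤ β v ∧ 0 ≤ γ v ∧ β v + γ v ≤ 1 ∧ v ≠ Q} with hT
  have hTg : ∀ v ∈ T, 0 < γ v ∧ β v < 1 := by
    rintro v ⟨h1, h2, h3, h4, h5⟩
    have hg : 0 < γ v := by
      refine lt_of_le_of_ne h3 fun h0 => ?_
      have hv := hcoord v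
      rw [← h0, zero_smul, add_zero] at hv
      rcases lt_or_ge (β v) 1 with h6 | h6
      · apply hZQ (β v) h2 h6
        rwa [← hv]
      · apply h5
        have : β v = 1 := by linarith
        rw [hv, this, one_smul]; abel
    exact ⟨hg, by linarith⟩
  have hFT : F ∈ T := by
    refine ⟨hFV, by rw [hFc.1], by rw [hFc.2]; norm_num, by rw [hFc.1, hFc.2]; norm_num, ?_⟩
    rintro rfl
    rw [hQc.2] at hFc; norm_num at hFc
  have hTfin : T.Finite := hV.subset fun v hv => hv.1
  -- The line through `Q` and `v` meets the line `ZF` in `Z + (γ v / (1 - β v)) • (F - Z)`. So this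
  -- quotient orders the points of `T` by their angle at `Q`.
  obtain ⟨k, hkT, hkmin⟩ := Set.exists_min_image T (fun v => γ v / (1 - β v)) hTfin ⟨F, hFT⟩
  obtain ⟨hgk, hbk⟩ := hTg k hkT
  obtain ⟨hkV, hbk0, -, hk1, hkQ⟩ := hkT
  set ρ := γ k / (1 - β k) with hρ
  have hbk' : 0 < 1 - β k := by linarith
  have hρ0 : 0 < ρ := div_pos hgk hbk'
  have hρ1 : ρ ≤ 1 := by rw [hρ, div_le_one hbk']; linarith
  have hγk : γ k = ρ * (1 - β k) := by rw [hρ]; field_simp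
  have hmin : ∀ v ∈ T, ρ * (1 - β v) ≤ γ v := by
    intro v hv
    have := hkmin v hv
    rwa [le_div_iff₀ (by linarith [(hTg v hv).2])] at this
  -- Change to coordinates of the smaller triangle with vertices `Z`, `Q` and `Z + ρ • (F - Z)`,
  -- whose third side passes through `k`. By minimality no point of `V` is in this triangle except
  -- on its third side (`hout`), so `disjoint_triangle` applies.
  have hγ' : IsAff fun x => ρ⁻¹ * γ x := hγ.const_mul _
  have hcoord' : ∀ x, x = Z + β x • (Q - Z) + (ρ⁻¹ * γ x) • ((Z + ρ • (F - Z)) - Z) := by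
    intro x
    rw [add_sub_cancel_left, smul_smul]
    have : ρ⁻¹ * γ x * ρ = γ x := by field_simp
    rw [this]
    exact hcoord x
  have hout : ∀ v ∈ V, β v < 0 ∨ ρ⁻¹ * γ v < 0 ∨ 1 ≤ β v + ρ⁻¹ * γ v := by
    intro v hv
    by_contra hcon
    push Not at hcon
    obtain ⟨h1, h2, h3⟩ := hcon
    have h2' : 0 ≤ γ v := by
      by_contra hneg
      push Not at hneg
      have := mul_neg_of_pos_of_neg (inv_pos.2 hρ0) hneg
      linarith
    have h3' : γ v < ρ * (1 - β v) := by
      have := mul_lt_mul_of_pos_left (by linarith : ρ⁻¹ * γ v < 1 - β v) hρ0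
      rwa [← mul_assoc, mul_inv_cancel₀ hρ0.ne', one_mul] at this
    have h4 : 0 ≤ 1 - β v := by
      by_contra hneg
      push Not at hneg
      have := mul_neg_of_pos_of_neg hρ0 hneg
      linarith
    have hvT : v ∈ T := by
      refine ⟨hv, h1, h2', ?_, ?_⟩
      · have := mul_le_mul_of_nonneg_right hρ1 h4
        linarith
      · rintro rfl
        rw [hQc.1, hQc.2] at h3'; norm_num at h3'
    exact absurd (hmin v hvT) (not_le.2 h3')
  refine ⟨k, hkV, β k, γ k, hcoord k, hbk0, hgk, hk1, fun v hv w hw hQ hF => ?_⟩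
  have hF' : ∀ g : ℝ, 0 ≤ g → g < 1 → Z + g • ((Z + ρ • (F - Z)) - Z) ∉ segment ℝ v w := by
    intro g hg0 hg1
    rw [add_sub_cancel_left, smul_smul]
    refine hF _ (by positivity) ?_
    have := mul_le_mul_of_nonneg_left hρ1 hg0
    linarith
  have hρk : ρ⁻¹ * γ k = 1 - β k := by rw [hγk]; field_simp
  constructor
  · intro b g hb hg hbg hx
    have hp : Z + b • (Q - Z) + g • (k - Z) =
        Z + (b + g * β k) • (Q - Z) + (g * γ k) • (F - Z) := by
      nth_rewrite 1 [hcoord k]; module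
    rw [hp] at hx
    obtain ⟨e1, e2⟩ := huniq (b + g * β k) (g * γ k)
    have hsum : b + g * β k + ρ⁻¹ * (g * γ k) = b + g := by
      rw [mul_left_comm, hρk]; ring
    refine disjoint_triangle hβ hγ' hcoord' hQ hF' (hout v hv) (hout w hw) hx ?_ ?_ ?_ (Or.inl ?_)
    · rw [e1]; positivity
    · rw [e2]; positivity
    · rw [e1, e2, hsum]; linarith
    · rw [e1, e2, hsum]; linarith
  · intro hgen hne
    refine disjoint_left.2 fun x hx hxo => ?_
    have hxk : x ≠ k := by
      rintro rfl; rw [right_mem_openSegment_iff] at hxo; exact hkQ hxo.symm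
    have hxQ : x ≠ Q := by
      rintro rfl; rw [left_mem_openSegment_iff] at hxo; exact hkQ hxo.symm
    have hline : ∀ z ∈ V, β z + ρ⁻¹ * γ z = 1 → z = k ∨ z = Q := by
      intro z hz hz1
      apply hgen z hz
      have hzc : z - Q = (1 - β z) • ((Z + ρ • (F - Z)) - Q) := by
        nth_rewrite 1 [hcoord' z]
        rw [show ρ⁻¹ * γ z = 1 - β z by linarith]
        module
      have hkc : k - Q = (1 - β k) • ((Z + ρ • (F - Z)) - Q) := by
        nth_rewrite 1 [hcoord' k]
        rw [hρk]
        module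
      rw [hzc, hkc, cross_smul_left, cross_smul_right, cross_self]; ring
    have hxline : β x + ρ⁻¹ * γ x = 1 := by
      obtain ⟨s, t, hs, ht, hst, rfl⟩ := hxo
      rw [hβ _ _ _ _ hst, hγ _ _ _ _ hst, hQc.1, hQc.2]
      have : ρ⁻¹ * (s * 0 + t * γ k) = t * (ρ⁻¹ * γ k) := by ring
      rw [this, hρk]; linarith
    have hxpos : 0 < β x ∧ 0 < ρ⁻¹ * γ x := by
      obtain ⟨s, t, hs, ht, hst, rfl⟩ := hxo
      rw [hβ _ _ _ _ hst, hγ _ _ _ _ hst, hQc.1, hQc.2]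
      constructor
      · have := mul_nonneg ht.le hbk0; linarith
      · have := mul_pos ht hgk
        rw [mul_zero, zero_add]; positivity
    have hx' : x ∈ openSegment ℝ v w := by
      refine mem_openSegment_of_ne_left_right ?_ ?_ hx
      · rintro rfl; exact (hline v hv hxline).elim hxk hxQ
      · rintro rfl; exact (hline w hw hxline).elim hxk hxQ
    refine disjoint_triangle hβ hγ' hcoord' hQ hF' (hout v hv) (hout w hw) hx hxpos.1.le
      hxpos.2.le hxline.le (Or.inr ⟨hxpos.1, hxpos.2, ?_⟩)
    by_contra hcon
    push Not at hcon
    obtain ⟨s, t, hs, ht, hst, rfl⟩ := hx'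
    rw [hβ _ _ _ _ hst, hγ _ _ _ _ hst] at hxline
    have hxl : s * (β v + ρ⁻¹ * γ v) + t * (β w + ρ⁻¹ * γ w) = 1 := by rw [← hxline]; ring
    have hv1 : β v + ρ⁻¹ * γ v = 1 := by
      refine le_antisymm (not_lt.1 fun h1 => ?_) hcon.1
      have p1 := mul_lt_mul_of_pos_left h1 hs
      have p2 := mul_le_mul_of_nonneg_left hcon.2 ht.le
      linarith
    have hw1 : β w + ρ⁻¹ * γ w = 1 := by
      refine le_antisymm (not_lt.1 fun h1 => ?_) hcon.2
      have p1 := mul_lt_mul_of_pos_left h1 ht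
      have p2 := mul_le_mul_of_nonneg_left hcon.1 hs.le
      linarith
    exact hne ⟨hline v hv hv1, hline w hw hw1⟩

end GenKernel

/-! ### Linked vertices and visibility from a point of a base. -/

namespace GenKernel
open Set Filter Topology

/-- Two vertices are linked if they are adjacent or joined by a diagonal. -/
def Linked (n : ℕ) (P : ℕ → Plane) (i j : ℕ) : Prop :=
  openSegment ℝ (P i) (P j) ⊆ inside (curve P) ∨ j ≡ i + 1 [MOD n] ∨ i ≡ j + 1 [MOD n]

lemma Linked.symm {n : ℕ} {P : ℕ → Plane} {i j : ℕ} (h : Linked n P i j) : Linked n P j i := by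
  rcases h with h | h | h
  · exact Or.inl (by rwa [openSegment_symm])
  · exact Or.inr (Or.inr h)
  · exact Or.inr (Or.inl h)

namespace SimpleCycle

variable {n : ℕ} {P : ℕ → Plane}

lemma linked_congr (h : SimpleCycle n P) {i j i' j' : ℕ} (hi : i ≡ i' [MOD n])
    (hj : j ≡ j' [MOD n]) (hl : Linked n P i j) : Linked n P i' j' := by
  rcases hl with hl | hl | hl
  · left; rwa [← h.congr hi, ← h.congr hj]
  · exact Or.inr (Or.inl (hj.symm.trans (hl.trans (hi.add_right 1))))
  · exact Or.inr (Or.inr (hi.symm.trans (hl.trans (hj.add_right 1))))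

lemma linked_shift (h : SimpleCycle n P) (c : ℕ) {i j : ℕ} :
    Linked n (fun i => P (c + i)) i j ↔ Linked n P (c + i) (c + j) := by
  unfold Linked
  rw [h.curve_shift, add_assoc c i 1, add_assoc c j 1, Nat.ModEq.add_iff_left (Nat.ModEq.refl c),
    Nat.ModEq.add_iff_left (Nat.ModEq.refl c)]

lemma finite_range (h : SimpleCycle n P) : (range P).Finite := by
  refine (Set.toFinite (P '' Iio n)).subset ?_
  rintro _ ⟨i, rfl⟩
  obtain ⟨j, -, hj, hij⟩ := h.exists_rep 0 i
  exact ⟨j, by simpa using hj, (h.congr hij).symm⟩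

lemma range_subset_curve (h : SimpleCycle n P) : range P ⊆ curve P := by
  rintro _ ⟨i, rfl⟩; exact h.vertex_mem_curve i

lemma vertex_notMem_openSegment (h : SimpleCycle n P) {i j : ℕ} (hij : ¬ i ≡ j [MOD n]) (c : ℕ) :
    P c ∉ openSegment ℝ (P i) (P j) := by
  intro hc
  have hne : P i ≠ P j := fun he => hij (h.injective _ _ he)
  by_cases h1 : c ≡ i [MOD n]
  · rw [h.congr h1, left_mem_openSegment_iff] at hc; exact hne hc
  by_cases h2 : c ≡ j [MOD n]
  · rw [h.congr h2, right_mem_openSegment_iff] at hc; exact hne hc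
  apply h.generic i j c hij (fun e => h2 e.symm) (fun e => h1 e.symm)
  obtain ⟨s, t, -, -, hst, he⟩ := hc
  rw [← he, show s • P i + t • P j - P i = t • (P j - P i) by
    rw [show s = 1 - t by linarith]; module, cross_smul_right, cross_self, mul_zero]

/-- A point of two different edges is a vertex. -/
lemma mem_range_of_two_edges (h : SimpleCycle n P) {i j : ℕ} (hij : ¬ i ≡ j [MOD n]) {x : Plane}
    (hi : x ∈ edge P i) (hj : x ∈ edge P j) : x ∈ range P := by
  obtain ⟨k, h1, h2, h3⟩ := h.exists_rep i j
  rw [h.edge_congr h3] at hj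
  rcases h1.eq_or_lt with rfl | hlt
  · exact absurd h3.symm hij
  rcases h.edge_inter i k x hlt h2 hi hj with ⟨-, rfl⟩ | ⟨-, rfl⟩
  · exact ⟨_, rfl⟩
  · exact ⟨_, rfl⟩

/-- A ray that starts inside has a first point on the curve. -/
lemma exists_first_hit (h : SimpleCycle n P) {o d : Plane} (hd : d ≠ 0) {ε : ℝ} (hε : 0 < ε)
    (hin : ∀ t : ℝ, 0 < t → t ≤ ε → o + t • d ∈ inside (curve P)) :
    ∃ τ > ε, o + τ • d ∈ curve P ∧ ∀ t : ℝ, 0 < t → t < τ → o + t • d ∈ inside (curve P) := by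
  have hcont : Continuous fun t : ℝ => o + t • d := by fun_prop
  -- Hits before `ε` are left out because the starting point `o` may itself be on the curve.
  set S : Set ℝ := {t | ε ≤ t ∧ o + t • d ∈ curve P} with hS
  have hScl : IsClosed S := isClosed_Ici.inter (h.isClosed_curve.preimage hcont)
  have hbdd : BddBelow S := ⟨ε, fun t ht => ht.1⟩
  have sub : ∀ J : Set ℝ, J.OrdConnected → ε ∈ J → (∀ t ∈ J, o + t • d ∉ curve P) →
      ∀ t ∈ J, o + t • d ∈ inside (curve P) := by
    intro J hJ hεJ hJC t ht
    refine h.subset_inside (hJ.isPreconnected.image _ hcont.continuousOn) ?_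
      ⟨ε, hεJ, rfl⟩ (hin ε hε le_rfl) ⟨t, ht, rfl⟩
    rw [disjoint_left]
    rintro _ ⟨t, ht, rfl⟩
    exact hJC t ht
  have hne : S.Nonempty := by
    by_contra hcon
    rw [not_nonempty_iff_eq_empty] at hcon
    have hall := sub (Ici ε) ordConnected_Ici (mem_Ici.2 le_rfl) fun t ht hC =>
      (hcon ▸ (⟨ht, hC⟩ : t ∈ S) : t ∈ (∅ : Set ℝ))
    obtain ⟨R, hR⟩ := h.isBounded_inside.exists_norm_le
    have hd' : 0 < ‖d‖ := norm_pos_iff.2 hd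
    set t := max ε ((R + ‖o‖ + 1) / ‖d‖) with ht
    have h1 := hR _ (hall t (mem_Ici.2 (le_max_left _ _)))
    have h2 : (R + ‖o‖ + 1) ≤ t * ‖d‖ := by
      rw [← div_le_iff₀ hd']; exact le_max_right _ _
    have h3 : ‖t • d‖ ≤ ‖o + t • d‖ + ‖o‖ := by
      have := norm_sub_le (o + t • d) o
      rwa [add_sub_cancel_left] at this
    rw [norm_smul, Real.norm_eq_abs, abs_of_pos (lt_of_lt_of_le hε (le_max_left _ _))] at h3
    linarith
  have hmem := hScl.csInf_mem hne hbdd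
  refine ⟨sInf S, lt_of_le_of_ne hmem.1 fun he => ?_, hmem.2, fun t ht0 ht => ?_⟩
  · exact (hin ε hε le_rfl).1 (he ▸ hmem.2)
  · rcases le_total t ε with hle | hle
    · exact hin t ht0 hle
    · refine sub (Ico ε (sInf S)) ordConnected_Ico ⟨le_rfl, lt_of_le_of_lt hle ht⟩ ?_ t ⟨hle, ht⟩
      intro t' ht' hC
      exact absurd (csInf_le hbdd ⟨ht'.1, hC⟩) (not_le.2 ht'.2)

/-- A point of a segment between two vertices that is on no other line through two vertices. -/
lemma exists_generic_point (h : SimpleCycle n P) {i j : ℕ} (hij : ¬ i ≡ j [MOD n]) :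
    ∃ o ∈ openSegment ℝ (P i) (P j), ∀ a b, ¬ a ≡ b [MOD n] →
      cross (P a - o) (P b - o) = 0 → (a ≡ i [MOD n] ∧ b ≡ j [MOD n]) ∨
        (a ≡ j [MOD n] ∧ b ≡ i [MOD n]) := by
  set bad : Plane × Plane → Set ℝ := fun ab =>
    {t | cross (ab.1 - ((1 - t) • P i + t • P j)) (ab.2 - ((1 - t) • P i + t • P j)) = 0} with hbad
  set good : Set (Plane × Plane) := {ab | ∃ a b, ab = (P a, P b) ∧ ¬ a ≡ b [MOD n] ∧
    ¬ ((a ≡ i [MOD n] ∧ b ≡ j [MOD n]) ∨ (a ≡ j [MOD n] ∧ b ≡ i [MOD n]))} with hgood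
  have hgfin : good.Finite := (h.finite_range.prod h.finite_range).subset (by
    rintro _ ⟨a, b, rfl, -⟩; exact ⟨⟨a, rfl⟩, ⟨b, rfl⟩⟩)
  -- The cross product is affine in `t`. Two zeros would put both `P i` and `P j` on the line
  -- through `P a` and `P b`, which general position excludes for pairs other than the base. So only
  -- finitely many `t` are bad.
  have hsub : ∀ ab ∈ good, (bad ab).Subsingleton := by
    rintro _ ⟨a, b, rfl, hab, hne⟩ t ht t' ht'
    by_contra hcon
    have e : ∀ t : ℝ, cross (P a - ((1 - t) • P i + t • P j)) (P b - ((1 - t) • P i + t • P j)) =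
        (1 - t) * cross (P b - P a) (P i - P a) + t * cross (P b - P a) (P j - P a) := by
      intro t; rw [cross_sub_sub]; simp [cross]; ring
    have h1 : (1 - t) * cross (P b - P a) (P i - P a) + t * cross (P b - P a) (P j - P a) = 0 := by
      rw [← e]; exact ht
    have h2 : (1 - t') * cross (P b - P a) (P i - P a) + t' * cross (P b - P a) (P j - P a) = 0 := by
      rw [← e]; exact ht'
    have hd : t - t' ≠ 0 := sub_ne_zero.2 hcon
    have hX : cross (P b - P a) (P i - P a) = 0 := by
      have : (t - t') * cross (P b - P a) (P i - P a) = 0 := by linear_combination t * h2 - t' * h1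
      exact (mul_eq_zero.1 this).resolve_left hd
    have hY : cross (P b - P a) (P j - P a) = 0 := by
      have : (t - t') * cross (P b - P a) (P j - P a) = 0 := by
        linear_combination (1 - t') * h1 - (1 - t) * h2
      exact (mul_eq_zero.1 this).resolve_left hd
    have hin : ∀ c, cross (P b - P a) (P c - P a) = 0 → a ≡ c [MOD n] ∨ b ≡ c [MOD n] := by
      intro c hc
      by_contra hcc
      rw [not_or] at hcc
      exact h.generic a b c hab hcc.2 hcc.1 hc
    apply hne
    rcases hin i hX with hi | hi <;> rcases hin j hY with hj | hj
    · exact absurd (hi.symm.trans hj) hij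
    · exact Or.inl ⟨hi, hj⟩
    · exact Or.inr ⟨hj, hi⟩
    · exact absurd (hi.symm.trans hj) hij
  have hfin : (⋃ ab ∈ good, bad ab).Finite := hgfin.biUnion fun ab hab => (hsub ab hab).finite
  obtain ⟨t, ht, htb⟩ := ((Ioo_infinite (zero_lt_one (α := ℝ))).sdiff hfin).nonempty
  refine ⟨(1 - t) • P i + t • P j, ⟨1 - t, t, by linarith [ht.2], ht.1, by ring, rfl⟩,
    fun a b hab h0 => ?_⟩
  by_contra hcon
  exact htb (mem_iUnion₂.2 ⟨(P a, P b), ⟨a, b, rfl, hab, hcon⟩, h0⟩)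

/-- The data of a base for which a third vertex of a triangle is sought: a generic point `o` of the
base such that the half disc above `o` is inside. -/
structure IsBase (n : ℕ) (P : ℕ → Plane) (i j : ℕ) (o : Plane) (e r : ℝ) : Prop where
  ne : ¬ i ≡ j [MOD n]
  mem : o ∈ openSegment ℝ (P i) (P j)
  generic : ∀ a b, ¬ a ≡ b [MOD n] → cross (P a - o) (P b - o) = 0 →
    (a ≡ i [MOD n] ∧ b ≡ j [MOD n]) ∨ (a ≡ j [MOD n] ∧ b ≡ i [MOD n])
  edges : ∀ c, ((c ≡ i [MOD n] ∧ c + 1 ≡ j [MOD n]) ∨ (c ≡ j [MOD n] ∧ c + 1 ≡ i [MOD n])) ∨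
    Disjoint (edge P c) (openSegment ℝ (P i) (P j))
  e_ne : e ≠ 0
  r_pos : 0 < r
  half : Metric.ball o r ∩ {x | 0 < e * cross (P j - P i) (x - P i)} ⊆ inside (curve P)

end SimpleCycle

namespace SimpleCycle.IsBase

variable {n : ℕ} {P : ℕ → Plane} {i j : ℕ} {o : Plane} {e r : ℝ}

/-- The expression `e * cross (P j - P i) (x - P i)` serves as the height of `x` over the base, up
to a positive factor; the sign of `e` decides which side is above. -/
lemma height_o (hb : IsBase n P i j o e r) : e * cross (P j - P i) (o - P i) = 0 := by
  obtain ⟨s, t, -, -, hst, rfl⟩ := hb.mem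
  rw [show s • P i + t • P j - P i = t • (P j - P i) by
    rw [show s = 1 - t by linarith]; module, cross_smul_right, cross_self, mul_zero, mul_zero]

lemma height_left (_ : IsBase n P i j o e r) : e * cross (P j - P i) (P i - P i) = 0 := by
  simp [cross]

lemma height_right (_ : IsBase n P i j o e r) : e * cross (P j - P i) (P j - P i) = 0 := by
  rw [cross_self, mul_zero]

/-- Points above the base seen from `o` are inside. -/
lemma subset_inside_of_disjoint (h : SimpleCycle n P) (hb : IsBase n P i j o e r) {x : Plane}
    (hx : 0 < e * cross (P j - P i) (x - P i)) (hd : Disjoint (openSegment ℝ o x) (curve P)) :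
    openSegment ℝ o x ⊆ inside (curve P) := by
  have hf := (isAff_cross_sub (P j - P i) (P i)).const_mul e
  have hcl := mem_closure_inter_of_ray (U := Metric.ball o r) (S := {z | ∃ t : ℝ, 0 < t ∧
    z = o + t • (x - o)}) (d := x - o) Metric.isOpen_ball (Metric.mem_ball_self hb.r_pos)
    fun t ht => ⟨t, ht, rfl⟩
  have hcont : Continuous fun t : ℝ => o + t • (x - o) := by fun_prop
  have hev : ∀ᶠ t : ℝ in 𝓝[>] 0, o + t • (x - o) ∈ Metric.ball o r := by
    have h2 := hcont.tendsto 0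
    simp only [zero_smul, add_zero] at h2
    exact (h2.mono_left nhdsWithin_le_nhds).eventually (Metric.ball_mem_nhds o hb.r_pos)
  obtain ⟨t, htb, ht0, ht1⟩ := (hev.and (Ioo_mem_nhdsGT (zero_lt_one (α := ℝ)))).exists
  have hmem : o + t • (x - o) ∈ openSegment ℝ o x := by
    rw [openSegment_eq_image']; exact ⟨t, ⟨ht0, ht1⟩, rfl⟩
  refine h.subset_inside (convex_openSegment o x).isPreconnected hd hmem (hb.half ⟨htb, ?_⟩)
  show 0 < e * cross (P j - P i) (o + t • (x - o) - P i)
  have := hf o x (1 - t) t (by ring)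
  simp only at this
  rw [show o + t • (x - o) = (1 - t) • o + t • x by module, this, hb.height_o]
  simp only [mul_zero, zero_add]
  positivity

lemma o_notMem_range (h : SimpleCycle n P) (hb : IsBase n P i j o e r) : o ∉ range P := by
  rintro ⟨c, rfl⟩
  exact h.vertex_notMem_openSegment hb.ne c hb.mem

/-- By the choice of `o`, a line through two vertices and `o` is the base line, whereas `P k` is
above the base. -/
lemma vertex_eq_of_cross (h : SimpleCycle n P) (hb : IsBase n P i j o e r) {k : ℕ}
    (hk : 0 < e * cross (P j - P i) (P k - P i)) {z : Plane} (hz : z ∈ range P)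
    (h0 : cross (P k - o) (z - o) = 0) : z = P k := by
  obtain ⟨a, rfl⟩ := hz
  by_contra hne
  have hka : ¬ k ≡ a [MOD n] := fun e => hne (h.congr e.symm)
  rcases hb.generic k a hka h0 with ⟨h1, -⟩ | ⟨h1, -⟩
  · rw [h.congr h1, hb.height_left] at hk; exact lt_irrefl _ hk
  · rw [h.congr h1, hb.height_right] at hk; exact lt_irrefl _ hk

/-- Some vertex above the base is visible from `o`. -/
lemma exists_visible (h : SimpleCycle n P) (hb : IsBase n P i j o e r) :
    ∃ k, 0 < e * cross (P j - P i) (P k - P i) ∧ openSegment ℝ o (P k) ⊆ inside (curve P) := by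
  have hf := (isAff_cross_sub (P j - P i) (P i)).const_mul e
  have hPij : P j - P i ≠ 0 := sub_ne_zero.2 fun he => hb.ne (h.injective _ _ he.symm)
  have hrot := cross_rot_pos hPij
  have he2 : 0 < e * e := mul_self_pos.2 hb.e_ne
  set d := e • rot (P j - P i) with hd
  have hd0 : d ≠ 0 := by
    intro h0
    have : cross (P j - P i) d = e * cross (P j - P i) (rot (P j - P i)) := by
      rw [hd, cross_smul_right]
    rw [h0] at this
    have h1 : cross (P j - P i) 0 = 0 := by simp [cross]
    rw [h1] at this
    exact mul_ne_zero hb.e_ne hrot.ne' this.symm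
  have hray : ∀ t : ℝ, 0 < t → 0 < e * cross (P j - P i) (o + t • d - P i) := by
    intro t ht
    have h1 : e * cross (P j - P i) (o + t • d - P i) = e * cross (P j - P i) (o - P i) +
        t * ((e * e) * cross (P j - P i) (rot (P j - P i))) := by
      rw [add_sub_right_comm, cross_add_right, hd, cross_smul_right, cross_smul_right]; ring
    rw [h1, hb.height_o, zero_add]
    positivity
  have hd' : 0 < ‖d‖ := norm_pos_iff.2 hd0
  -- The perpendicular from `o` first meets the curve in `y`. If `y` is not a vertex, it lies inside
  -- an edge, and the higher end of that edge spans with `o` and `y` a triangle to be swept.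
  obtain ⟨τ, hτ, hyC, hτin⟩ := h.exists_first_hit (o := o) hd0 (ε := r / (2 * ‖d‖))
    (div_pos hb.r_pos (by positivity)) (fun t ht0 ht => hb.half ⟨by
      rw [Metric.mem_ball, dist_eq_norm, add_sub_cancel_left, norm_smul, Real.norm_eq_abs,
        abs_of_pos ht0]
      have : t * ‖d‖ ≤ r / (2 * ‖d‖) * ‖d‖ := mul_le_mul_of_nonneg_right ht hd'.le
      have e1 : r / (2 * ‖d‖) * ‖d‖ = r / 2 := by field_simp
      have := hb.r_pos
      linarith, hray t ht0⟩)
  have hτ0 : 0 < τ := lt_trans (div_pos hb.r_pos (by positivity)) hτ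
  set y := o + τ • d with hy
  have hyf : 0 < e * cross (P j - P i) (y - P i) := hray τ hτ0
  have hseg : openSegment ℝ o y ⊆ inside (curve P) := by
    rintro _ hx
    rw [openSegment_eq_image'] at hx
    obtain ⟨t, ht, rfl⟩ := hx
    simp only
    rw [hy, add_sub_cancel_left, smul_smul]
    exact hτin _ (mul_pos ht.1 hτ0) (by nlinarith [ht.2])
  by_cases hyV : y ∈ range P
  · obtain ⟨k, hk⟩ := hyV
    exact ⟨k, hk ▸ hyf, hk ▸ hseg⟩
  obtain ⟨m, hm⟩ := mem_iUnion.1 hyC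
  have hm' : y ∈ openSegment ℝ (P m) (P (m + 1)) := by
    refine mem_openSegment_of_ne_left_right ?_ ?_ hm
    · rintro he; exact hyV ⟨m, he⟩
    · rintro he; exact hyV ⟨m + 1, he⟩
  -- the higher end of the edge
  obtain ⟨F, G, hFV, hyFG, hFf, hFG, hFG', hcrossFG⟩ : ∃ F G : Plane, F ∈ range P ∧
      y ∈ openSegment ℝ F G ∧ 0 < e * cross (P j - P i) (F - P i) ∧
      segment ℝ F G = edge P m ∧ openSegment ℝ F G = openSegment ℝ (P m) (P (m + 1)) ∧
      cross (F - o) (G - o) ≠ 0 := by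
    have hmm : ¬ m ≡ m + 1 [MOD n] := not_modEq_of_lt (by omega) (by have := h.three_le; omega)
    have hyf' := hyf
    obtain ⟨s, t, hs, ht, hst, hyst⟩ := hm'
    have e1 := hf (P m) (P (m + 1)) s t hst
    simp only at e1
    rw [← hyst, e1] at hyf'
    have hor : 0 < e * cross (P j - P i) (P m - P i) ∨
        0 < e * cross (P j - P i) (P (m + 1) - P i) := by
      by_contra hcon
      push Not at hcon
      have p1 := mul_nonpos_of_nonneg_of_nonpos hs.le hcon.1
      have p2 := mul_nonpos_of_nonneg_of_nonpos ht.le hcon.2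
      linarith
    rcases hor with hp | hp
    · refine ⟨P m, P (m + 1), ⟨m, rfl⟩, ⟨s, t, hs, ht, hst, hyst⟩, hp, rfl, rfl, fun h0 => ?_⟩
      exact h.ne_succ m (hb.vertex_eq_of_cross h hp ⟨m + 1, rfl⟩ h0).symm
    · refine ⟨P (m + 1), P m, ⟨m + 1, rfl⟩, ⟨t, s, ht, hs, by linarith, by rw [← hyst, add_comm]⟩,
        hp, segment_symm ℝ _ _, openSegment_symm ℝ _ _, fun h0 => ?_⟩
      exact h.ne_succ m (hb.vertex_eq_of_cross h hp ⟨m, rfl⟩ h0)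
  have hΔ : cross (o - y) (F - y) ≠ 0 := by
    obtain ⟨s, t, hs, ht, hst, hyst⟩ := hyFG
    have : cross (o - y) (F - y) = t * cross (F - o) (G - o) := by
      rw [← hyst, show s = 1 - t by linarith]; simp [cross]; ring
    rw [this]
    exact mul_ne_zero ht.ne' hcrossFG
  have hyo : ∀ g : ℝ, 0 < g → g < 1 → y + g • (o - y) ∈ inside (curve P) := by
    intro g hg0 hg1
    apply hseg
    rw [openSegment_symm, openSegment_eq_image']
    exact ⟨g, ⟨hg0, hg1⟩, rfl⟩
  -- In the triangle `y o F` the vertex of smallest angle at `o` is visible from `o`. It is above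
  -- the base, being a convex combination of `y`, `o`, `F` with positive weight at `F`. The edge
  -- carrying `y` needs a separate argument because it contains the side `yF`.
  obtain ⟨k, ⟨k, rfl⟩, b, g, hkc, hb0, hg0, hbg, hk⟩ := exists_sweep hΔ h.finite_range hFV
    (fun g hg0 hg1 hV => by
      rcases hg0.eq_or_lt with rfl | hg0
      · rw [zero_smul, add_zero] at hV; exact hyV hV
      · exact (hyo g hg0 hg1).1 (h.range_subset_curve hV))
  have hkf : 0 < e * cross (P j - P i) (P k - P i) := by
    have e1 : e * cross (P j - P i) (P k - P i) =
        (1 - b - g) * (e * cross (P j - P i) (y - P i)) +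
        b * (e * cross (P j - P i) (o - P i)) + g * (e * cross (P j - P i) (F - P i)) := by
      rw [hkc]; simp [cross]; ring
    rw [e1, hb.height_o, mul_zero, add_zero]
    have p1 : 0 ≤ 1 - b - g := by linarith
    have := mul_nonneg p1 hyf.le
    have := mul_pos hg0 hFf
    linarith
  refine ⟨k, hkf, hb.subset_inside_of_disjoint h hkf ?_⟩
  rw [disjoint_right]
  intro x hxC hxo
  obtain ⟨c, hc⟩ := mem_iUnion.1 hxC
  by_cases hcm : c ≡ m [MOD n]
  · rw [h.edge_congr hcm, ← hFG] at hc
    have hx0 : cross (F - y) (x - y) = 0 := by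
      obtain ⟨s, t, hs, ht, hst, hyst⟩ := hyFG
      obtain ⟨s', t', -, -, hst', rfl⟩ := hc
      rw [← hyst, show s = 1 - t by linarith, show s' = 1 - t' by linarith]
      simp [cross]; ring
    obtain ⟨s, t, hs, ht, hst, rfl⟩ := hxo
    have : cross (F - y) (s • o + t • P k - y) = -((s + t * b) * cross (o - y) (F - y)) := by
      rw [hkc, show s = 1 - t by linarith]; simp [cross]; ring
    rw [this, neg_eq_zero] at hx0
    refine mul_ne_zero ?_ hΔ hx0
    positivity
  · have hcm' : ¬ m ≡ c [MOD n] := fun e => hcm e.symm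
    refine disjoint_left.1 ((hk (P c) ⟨c, rfl⟩ (P (c + 1)) ⟨c + 1, rfl⟩ ?_ ?_).2 ?_ ?_) hc hxo
    · intro g hg0 hg1 hV
      rcases hg0.eq_or_lt with rfl | hg0
      · rw [zero_smul, add_zero] at hV
        exact hyV (h.mem_range_of_two_edges hcm' hm hV)
      · exact (hyo g hg0 hg1).1 (h.edge_subset_curve c hV)
    · intro g hg0 hg1 hV
      have hzm : y + g • (F - y) ∈ openSegment ℝ F G := by
        obtain ⟨s, t, hs, ht, hst, hyst⟩ := hyFG
        refine ⟨s + g * t, t * (1 - g), by positivity, mul_pos ht (by linarith), ?_, ?_⟩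
        · rw [show s = 1 - t by linarith]; ring
        · rw [← hyst, show s = 1 - t by linarith]; module
      have hzm' : y + g • (F - y) ∈ edge P m := hFG ▸ openSegment_subset_segment ℝ _ _ hzm
      obtain ⟨a, ha⟩ := h.mem_range_of_two_edges hcm' hzm' hV
      have hmm : ¬ m ≡ m + 1 [MOD n] := not_modEq_of_lt (by omega) (by have := h.three_le; omega)
      exact h.vertex_notMem_openSegment hmm a (by rw [ha, ← hFG']; exact hzm)
    · intro z hz h0
      exact Or.inl (hb.vertex_eq_of_cross h hkf hz h0)
    · rintro ⟨h1 | h1, h2 | h2⟩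
      · exact h.ne_succ c (h1.trans h2.symm)
      · exact hb.o_notMem_range h ⟨_, h2⟩
      · exact hb.o_notMem_range h ⟨_, h1⟩
      · exact hb.o_notMem_range h ⟨_, h1⟩

end SimpleCycle.IsBase

end GenKernel

/-! ### Empty triangles over a base and the choice of a balanced vertex. -/

namespace GenKernel
open Set Filter Topology

lemma add_smul_mem_openSegment {x y o : Plane} (ho : o ∈ openSegment ℝ x y) {g : ℝ} (hg0 : 0 ≤ g)
    (hg1 : g < 1) : o + g • (x - o) ∈ openSegment ℝ x y := by
  obtain ⟨s, t, hs, ht, hst, rfl⟩ := ho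
  refine ⟨s + g * t, t * (1 - g), by positivity, mul_pos ht (by linarith), ?_, ?_⟩
  · rw [show s = 1 - t by linarith]; ring
  · rw [show s = 1 - t by linarith]; module

lemma openSegment_subset_of_mem {x y s : Plane} (hs : s ∈ openSegment ℝ x y) :
    openSegment ℝ s x ⊆ openSegment ℝ x y := by
  intro z hz
  rw [openSegment_eq_image'] at hz
  obtain ⟨t, ht, rfl⟩ := hz
  exact add_smul_mem_openSegment hs ht.1.le ht.2

namespace SimpleCycle.IsBase

variable {n : ℕ} {P : ℕ → Plane} {i j : ℕ} {o : Plane} {e r : ℝ}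

/-- The lowest vertex visible from a point of the base is linked to both ends of the base. -/
lemma linked_of_min (h : SimpleCycle n P) (hb : IsBase n P i j o e r) {k : ℕ}
    (hk : 0 < e * cross (P j - P i) (P k - P i)) (hko : openSegment ℝ o (P k) ⊆ inside (curve P))
    (hmin : ∀ l, 0 < e * cross (P j - P i) (P l - P i) → openSegment ℝ o (P l) ⊆ inside (curve P) →
      e * cross (P j - P i) (P k - P i) ≤ e * cross (P j - P i) (P l - P i))
    {a : ℕ} (ha : a = i ∨ a = j) : Linked n P a k := by
  by_cases hadj : k ≡ a + 1 [MOD n] ∨ a ≡ k + 1 [MOD n]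
  · exact Or.inr hadj
  have hfa : e * cross (P j - P i) (P a - P i) = 0 := by
    rcases ha with rfl | rfl
    · exact hb.height_left
    · exact hb.height_right
  have hak : ¬ a ≡ k [MOD n] := by
    intro e1; rw [← h.congr e1, hfa] at hk; exact lt_irrefl _ hk
  have hbase : ∀ g : ℝ, 0 ≤ g → g < 1 → o + g • (P a - o) ∈ openSegment ℝ (P i) (P j) := by
    intro g hg0 hg1
    rcases ha with rfl | rfl
    · exact add_smul_mem_openSegment hb.mem hg0 hg1
    · rw [openSegment_symm]
      exact add_smul_mem_openSegment (by rw [openSegment_symm]; exact hb.mem) hg0 hg1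
  have hΔ : cross (P a - o) (P k - o) ≠ 0 := by
    intro h0
    rw [cross_swap, neg_eq_zero] at h0
    exact hak (h.injective _ _ (hb.vertex_eq_of_cross h hk ⟨a, rfl⟩ h0))
  -- Sweep the triangle `o`, `P a`, `P k` around `P a`. The vertex `P l` found is visible from `o`,
  -- and its height is `g ≤ 1` times that of `P k`. Since `P k` is lowest, `g = 1` and `P l = P k`,
  -- so the second conclusion of the sweep is that no edge crosses the segment from `P a` to `P k`.
  obtain ⟨l, ⟨l, rfl⟩, b, g, hlc, hb0, hg0, hbg, hl⟩ := exists_sweep hΔ h.finite_range ⟨k, rfl⟩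
    (fun g hg0 hg1 ⟨c, hc⟩ => h.vertex_notMem_openSegment hb.ne c (hc ▸ hbase g hg0 hg1))
  have hheight : ∀ (b g : ℝ) (q : Plane), e * cross (P j - P i) (o + b • (P a - o) + g • (q - o) - P i)
      = g * (e * cross (P j - P i) (q - P i)) := by
    intro b g q
    have e1 : e * cross (P j - P i) (o + b • (P a - o) + g • (q - o) - P i) =
        (1 - b - g) * (e * cross (P j - P i) (o - P i)) +
        b * (e * cross (P j - P i) (P a - P i)) + g * (e * cross (P j - P i) (q - P i)) := by
      simp [cross]; ring
    rw [e1, hb.height_o, hfa]; ring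
  have hlf : e * cross (P j - P i) (P l - P i) = g * (e * cross (P j - P i) (P k - P i)) := by
    rw [hlc, hheight]
  have hlpos : 0 < e * cross (P j - P i) (P l - P i) := by rw [hlf]; positivity
  -- An edge either is the base, at height zero, or misses both sides of the triangle at `o`, as the
  -- sweep requires.
  have hedge : ∀ c, (∀ z ∈ edge P c, e * cross (P j - P i) (z - P i) = 0) ∨
      ((∀ g : ℝ, 0 ≤ g → g < 1 → o + g • (P a - o) ∉ segment ℝ (P c) (P (c + 1))) ∧
      (∀ g : ℝ, 0 ≤ g → g < 1 → o + g • (P k - o) ∉ segment ℝ (P c) (P (c + 1)))) := by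
    intro c
    rcases hb.edges c with h1 | h1
    · left
      rintro z ⟨s, t, -, -, hst, rfl⟩
      have hf := (isAff_cross_sub (P j - P i) (P i)).const_mul e (P c) (P (c + 1)) s t hst
      simp only at hf
      rw [hf]
      rcases h1 with ⟨h1, h2⟩ | ⟨h1, h2⟩
      · rw [h.congr h1, h.congr h2, hb.height_left, hb.height_right]; ring
      · rw [h.congr h1, h.congr h2, hb.height_left, hb.height_right]; ring
    · right
      refine ⟨fun g hg0 hg1 hz => disjoint_left.1 h1 hz (hbase g hg0 hg1), fun g hg0 hg1 hz => ?_⟩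
      rcases hg0.eq_or_lt with rfl | hg0
      · rw [zero_smul, add_zero] at hz
        exact disjoint_left.1 h1 hz hb.mem
      · refine (hko ?_).1 (h.edge_subset_curve c hz)
        rw [openSegment_eq_image']
        exact ⟨g, ⟨hg0, hg1⟩, rfl⟩
  have htri : ∀ b g : ℝ, 0 ≤ b → 0 < g → b + g < 1 →
      o + b • (P a - o) + g • (P l - o) ∉ curve P := by
    intro b g hb0 hg0 hbg hz
    obtain ⟨c, hc⟩ := mem_iUnion.1 hz
    rcases hedge c with h1 | h1
    · have := h1 _ hc
      rw [hheight] at this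
      exact (mul_pos hg0 hlpos).ne' this
    · exact (hl (P c) ⟨c, rfl⟩ (P (c + 1)) ⟨c + 1, rfl⟩ h1.1 h1.2).1 b g hb0 hg0.le hbg hc
  have hol : openSegment ℝ o (P l) ⊆ inside (curve P) := by
    refine hb.subset_inside_of_disjoint h hlpos (disjoint_left.2 fun z hz => ?_)
    rw [openSegment_eq_image'] at hz
    obtain ⟨t, ht, rfl⟩ := hz
    have := htri 0 t le_rfl ht.1 (by linarith [ht.2])
    rwa [zero_smul, add_zero] at this
  have hg1 : g = 1 := by
    have := hmin l hlpos hol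
    rw [hlf] at this
    by_contra hne
    have hglt : g < 1 := lt_of_le_of_ne (by linarith) hne
    have := mul_lt_mul_of_pos_right hglt hk
    linarith
  have hb00 : b = 0 := by linarith
  have hlk : P l = P k := by rw [hlc, hg1, hb00, one_smul, zero_smul]; abel
  rw [hlk] at hl htri
  left
  intro x hx
  have hx' := hx
  obtain ⟨s, t, hs, ht, hst, hxst⟩ := hx
  have hxc : x = o + s • (P a - o) + t • (P k - o) := by
    rw [← hxst, show s = 1 - t by linarith]; module
  have hxf : 0 < e * cross (P j - P i) (x - P i) := by
    rw [hxc, hheight]; positivity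
  have hxC : x ∉ curve P := by
    intro hz
    obtain ⟨c, hc⟩ := mem_iUnion.1 hz
    rcases hedge c with h1 | h1
    · exact hxf.ne' (h1 _ hc)
    · refine disjoint_left.1 ((hl (P c) ⟨c, rfl⟩ (P (c + 1)) ⟨c + 1, rfl⟩ h1.1 h1.2).2 ?_ ?_) hc hx'
      · rintro _ ⟨m, rfl⟩ h0
        by_contra hcon
        rw [not_or] at hcon
        exact h.generic a k m hak (fun e => hcon.1 (h.congr e.symm))
          (fun e => hcon.2 (h.congr e.symm)) h0
      · rintro ⟨h2 | h2, h3 | h3⟩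
        · exact h.ne_succ c (h2.trans h3.symm)
        · exact hadj (Or.inr ((h.injective _ _ h3).symm.trans ((h.injective _ _ h2).add_right 1)))
        · exact hadj (Or.inl ((h.injective _ _ h3).symm.trans ((h.injective _ _ h2).add_right 1)))
        · exact h.ne_succ c (h2.trans h3.symm)
  have hox : openSegment ℝ o x ⊆ inside (curve P) := by
    refine hb.subset_inside_of_disjoint h hxf (disjoint_left.2 fun z hz => ?_)
    rw [openSegment_eq_image'] at hz
    obtain ⟨l, hl, rfl⟩ := hz
    have := htri (l * s) (l * t) (mul_nonneg hl.1.le hs.le) (mul_pos hl.1 ht) (by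
      rw [← mul_add, hst, mul_one]; exact hl.2)
    rw [hxc]
    convert this using 2
    module
  have hpre : IsPreconnected (openSegment ℝ o x ∪ {x}) := by
    have hsub : openSegment ℝ o x ∪ {x} ⊆ closure (openSegment ℝ o x) := by
      rintro z (hz | rfl)
      · exact subset_closure hz
      · rw [closure_openSegment]; exact right_mem_segment ℝ _ _
    exact (convex_openSegment o x).isPreconnected.subset_closure subset_union_left hsub
  obtain ⟨z, hz⟩ : (openSegment ℝ o x).Nonempty :=
    ⟨_, 1/2, 1/2, by norm_num, by norm_num, by norm_num, rfl⟩
  refine h.subset_inside hpre ?_ (Or.inl hz) (hox hz) (Or.inr rfl)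
  refine disjoint_left.2 ?_
  rintro w (hw | rfl)
  · exact (hox hw).1
  · exact hxC

/-- Every base is a side of an empty triangle. -/
lemma exists_third (h : SimpleCycle n P) (hb : IsBase n P i j o e r) :
    ∃ k, 0 < e * cross (P j - P i) (P k - P i) ∧ openSegment ℝ o (P k) ⊆ inside (curve P) ∧
      Linked n P i k ∧ Linked n P j k := by
  obtain ⟨k₀, hk₀, hk₀'⟩ := hb.exists_visible h
  obtain ⟨k, ⟨⟨k, rfl⟩, hk1, hk2⟩, hmin⟩ := Set.exists_min_image
    {p | p ∈ range P ∧ 0 < e * cross (P j - P i) (p - P i) ∧ openSegment ℝ o p ⊆ inside (curve P)}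
    (fun p => e * cross (P j - P i) (p - P i)) (h.finite_range.subset fun p hp => hp.1)
    ⟨P k₀, ⟨k₀, rfl⟩, hk₀, hk₀'⟩
  have hmin' := fun l hl1 hl2 => hmin (P l) ⟨⟨l, rfl⟩, hl1, hl2⟩
  exact ⟨k, hk1, hk2, hb.linked_of_min h hk1 hk2 hmin' (Or.inl rfl),
    hb.linked_of_min h hk1 hk2 hmin' (Or.inr rfl)⟩

end SimpleCycle.IsBase

namespace SimpleCycle

variable {n : ℕ} {P : ℕ → Plane}

lemma not_modEq_zero {g : ℕ} (h0 : 0 < g) (hg : g < n) : ¬ 0 ≡ g [MOD n] :=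
  not_modEq_of_lt h0 (by omega)

/-- An edge is the base of a triangle. -/
lemma exists_triangle_edge (h : SimpleCycle n P) :
    ∃ t, 0 < t ∧ t < n - 1 ∧ Linked n P 0 t ∧ Linked n P t (n - 1) := by
  have h3 := h.three_le
  have hn : P (n - 1 + 1) = P 0 := by
    rw [show n - 1 + 1 = 0 + n by omega, h.periodic]
  have hij : ¬ 0 ≡ n - 1 [MOD n] := not_modEq_zero (by omega) (by omega)
  obtain ⟨o, ho, hgen⟩ := h.exists_generic_point hij
  have ho' : o ∈ openSegment ℝ (P (n - 1)) (P (n - 1 + 1)) := by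
    rw [hn, openSegment_symm]; exact ho
  obtain ⟨r, hr, hs⟩ := (h.shift (n - 1)).localSplit_edge ho'
  rw [h.curve_shift] at hs
  simp only [add_zero, hn] at hs
  have hoC : o ∈ curve P := h.edge_subset_curve (n - 1) (openSegment_subset_segment ℝ _ _ ho')
  obtain ⟨p, hp⟩ := h.inside_nonempty
  have hcomp : connectedComponentIn (curve P)ᶜ p ⊆ inside (curve P) :=
    h.subset_inside isPreconnected_connectedComponentIn
      (disjoint_left.2 fun z hz => connectedComponentIn_subset _ _ hz)
      (mem_connectedComponentIn hp.1) hp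
  have hlin : ∀ x, cross (P (n - 1) - P 0) (x - P 0) = -cross (P 0 - P (n - 1)) (x - o) := by
    intro x
    obtain ⟨s, t, -, -, hst, rfl⟩ := ho
    rw [show s = 1 - t by linarith]; simp [cross]; ring
  obtain ⟨e, he, hhalf⟩ : ∃ e : ℝ, e ≠ 0 ∧ Metric.ball o r ∩
      {x | 0 < e * cross (P (n - 1) - P 0) (x - P 0)} ⊆ inside (curve P) := by
    rcases hs.subset_component (h.curve_subset_closure_component hp.1 hoC) with h1 | h1
    · refine ⟨-1, by norm_num, fun x hx => hcomp (h1.1 ⟨hx.1, ?_⟩)⟩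
      have hx2 : 0 < -1 * cross (P (n - 1) - P 0) (x - P 0) := hx.2
      rw [hlin] at hx2
      show 0 < cross _ _
      linarith
    · refine ⟨1, by norm_num, fun x hx => hcomp (h1.1 ⟨hx.1, ?_⟩)⟩
      have hx2 : 0 < 1 * cross (P (n - 1) - P 0) (x - P 0) := hx.2
      rw [hlin] at hx2
      show cross _ _ < 0
      linarith
  have hb : IsBase n P 0 (n - 1) o e r := by
    refine ⟨hij, ho, hgen, fun c => ?_, he, hr, hhalf⟩
    by_cases hc : n - 1 ≡ c [MOD n]
    · left; right
      refine ⟨hc.symm, (hc.symm.add_right 1).trans ?_⟩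
      rw [show n - 1 + 1 = n by omega]; simp [Nat.ModEq]
    · right
      refine disjoint_left.2 fun x hx hx' => ?_
      rw [openSegment_symm, ← hn] at hx'
      obtain ⟨a, rfl⟩ := h.mem_range_of_two_edges hc (openSegment_subset_segment ℝ _ _ hx') hx
      rw [hn, openSegment_symm] at hx'
      exact h.vertex_notMem_openSegment hij a hx'
  obtain ⟨k, hk, -, hk1, hk2⟩ := hb.exists_third h
  obtain ⟨t, -, ht, htk⟩ := h.exists_rep 0 k
  rw [h.congr htk] at hk
  refine ⟨t, Nat.pos_of_ne_zero ?_, ?_, h.linked_congr rfl htk hk1,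
    (h.linked_congr rfl htk hk2).symm⟩
  · rintro rfl; rw [hb.height_left] at hk; exact lt_irrefl _ hk
  · have : t ≠ n - 1 := by
      rintro rfl; rw [hb.height_right] at hk; exact lt_irrefl _ hk
    omega

/-- A diagonal is the base of a triangle on either side. -/
lemma exists_triangle_diagonal (h : SimpleCycle n P) {g : ℕ} (hg : 2 ≤ g) (hgn : g + 2 ≤ n)
    (hdiag : openSegment ℝ (P 0) (P g) ⊆ inside (curve P)) :
    ∃ t, 0 < t ∧ t < g ∧ Linked n P 0 t ∧ Linked n P t g := by
  have hij : ¬ 0 ≡ g [MOD n] := not_modEq_zero (by omega) (by omega)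
  obtain ⟨o, ho, hgen⟩ := h.exists_generic_point hij
  -- The point `s` is the midpoint of `o` and `P g`; so `o` is on the half of the cut leading to `P
  -- 0`, where `exists_side` applies.
  obtain ⟨s, hs1, hos⟩ : ∃ s ∈ openSegment ℝ (P 0) (P g), o ∈ openSegment ℝ s (P 0) := by
    obtain ⟨a, b, ha, hb, hab, hoab⟩ := ho
    obtain rfl : b = 1 - a := by linarith
    have h2 : 0 < 2 - a := by linarith
    refine ⟨(a / 2) • P 0 + (1 - a / 2) • P g, ⟨_, _, by positivity, by linarith, by ring, rfl⟩,
      (2 - 2 * a) / (2 - a), a / (2 - a), div_pos (by linarith) h2, by positivity, ?_, ?_⟩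
    · field_simp; ring
    · have e1 : (2 - 2 * a) / (2 - a) * (a / 2) + a / (2 - a) = a := by field_simp; ring
      have e2 : (2 - 2 * a) / (2 - a) * (1 - a / 2) = 1 - a := by field_simp
      rw [smul_add, smul_smul, smul_smul, add_right_comm, ← add_smul, e1, e2, hoab]
  have hcut : IsCut n P g (P g) s := by
    refine ⟨by omega, by omega, left_mem_segment ℝ _ _, h.ne_succ g, hdiag hs1,
      (openSegment_subset_of_mem hs1).trans hdiag, ?_⟩
    rw [openSegment_symm] at hs1 hdiag
    exact (openSegment_subset_of_mem hs1).trans hdiag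
  obtain ⟨r, hr, hball⟩ := Metric.isOpen_iff.1 h.isOpen_inside o (hdiag ho)
  obtain ⟨V, hVN, -, ⟨x, hxV⟩, -, hV⟩ := hcut.exists_side h hos Metric.isOpen_ball
    (Metric.mem_ball_self hr)
  obtain ⟨hxs, hxU⟩ := hV x hxV
  -- With this `e` the point `x` has height `e * e`: above the base means on the side of the chain
  -- from `0` to `g`.
  set e := cross (P g - P 0) (x - P 0) with he
  have he0 : e ≠ 0 := by
    obtain ⟨a, b, ha, hb, hab, hsab⟩ := hs1
    have : cross (P 0 - s) (x - s) = -(b * e) := by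
      rw [← hsab, he, show a = 1 - b by linarith]; simp [cross]; ring
    rw [this] at hxs
    intro h0
    rw [h0, mul_zero, neg_zero] at hxs
    exact hxs rfl
  have hb : IsBase n P 0 g o e r := by
    refine ⟨hij, ho, hgen, fun c => Or.inr (disjoint_left.2 fun z hz hz' => ?_), he0, hr,
      fun z hz => hball hz.1⟩
    exact (hdiag hz').1 (h.edge_subset_curve c hz)
  obtain ⟨k, hk, hko, hk1, hk2⟩ := hb.exists_third h
  obtain ⟨t, -, ht, htk⟩ := h.exists_rep 0 k
  rw [h.congr htk] at hk hko
  have hf := (isAff_cross_sub (P g - P 0) (P 0)).const_mul e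
  have hpos : ∀ z ∈ openSegment ℝ o (P t), 0 < e * cross (P g - P 0) (z - P 0) := by
    rintro z ⟨a, b, ha, hb', hab, rfl⟩
    have := hf o (P t) a b hab
    simp only at this
    rw [this, hb.height_o]
    simp only [mul_zero, zero_add]
    positivity
  -- The upper half disc together with the line of sight to the apex is connected, misses the cut
  -- and contains `x`. So the apex, which is adherent to it, is on the arc from `P 0` to `P g`.
  set U := (Metric.ball o r ∩ {z | 0 < e * cross (P g - P 0) (z - P 0)}) ∪ openSegment ℝ o (P t)
    with hU
  have hUpre : IsPreconnected U := by
    have hev : ∀ᶠ c : ℝ in 𝓝[>] 0, o + c • (P t - o) ∈ Metric.ball o r := by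
      have hcont : Continuous fun c : ℝ => o + c • (P t - o) := by fun_prop
      have h2 := hcont.tendsto 0
      simp only [zero_smul, add_zero] at h2
      exact (h2.mono_left nhdsWithin_le_nhds).eventually (Metric.ball_mem_nhds o hr)
    obtain ⟨c, hcb, hc0, hc1⟩ := (hev.and (Ioo_mem_nhdsGT (zero_lt_one (α := ℝ)))).exists
    have hmem : o + c • (P t - o) ∈ openSegment ℝ o (P t) := by
      rw [openSegment_eq_image']; exact ⟨c, ⟨hc0, hc1⟩, rfl⟩
    exact IsPreconnected.union _ ⟨hcb, hpos _ hmem⟩ hmem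
      ((convex_ball _ _).inter hf.convex_pos).isPreconnected
      (convex_openSegment _ _).isPreconnected
  have hUin : U ⊆ inside (curve P) := union_subset (fun z hz => hball hz.1) hko
  have hUpos : ∀ z ∈ U, 0 < e * cross (P g - P 0) (z - P 0) := by
    rintro z (hz | hz)
    · exact hz.2
    · exact hpos z hz
  have hzero : ∀ z ∈ segment ℝ (P 0) (P g), cross (P g - P 0) (z - P 0) = 0 := by
    rintro z ⟨a, b, -, -, hab, rfl⟩
    rw [show a = 1 - b by linarith]; simp [cross]; ring
  have hs2 := openSegment_subset_segment ℝ _ _ hs1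
  have hUd : Disjoint U (segment ℝ s (P 0) ∪ segment ℝ s (P g)) := by
    refine disjoint_left.2 fun z hz hz' => ?_
    have hz2 : z ∈ segment ℝ (P 0) (P g) := by
      rcases hz' with hz' | hz'
      · exact (convex_segment _ _).segment_subset hs2 (left_mem_segment ℝ _ _) hz'
      · exact (convex_segment _ _).segment_subset hs2 (right_mem_segment ℝ _ _) hz'
    have := hUpos z hz
    rw [hzero z hz2, mul_zero] at this
    exact lt_irrefl _ this
  have hxmem : x ∈ U := Or.inl ⟨hVN hxV, mul_self_pos.2 he0⟩
  have hcl := hxU U hUpre (hUin.trans subset_union_right) hUd hxmem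
  have htcl : P t ∈ closure U := closure_mono subset_union_right (by
    rw [closure_openSegment]; exact right_mem_segment ℝ _ _)
  have ht0 : t ≠ 0 := by
    rintro rfl; rw [hb.height_left] at hk; exact lt_irrefl _ hk
  have htg : ¬ t ≡ g [MOD n] := by
    intro e1; rw [h.congr e1, hb.height_right] at hk; exact lt_irrefl _ hk
  refine ⟨t, Nat.pos_of_ne_zero ht0, ?_, h.linked_congr rfl htk hk1,
    (h.linked_congr rfl htk hk2).symm⟩
  by_contra hgt
  have hgt' : g < t := lt_of_le_of_ne (not_lt.1 hgt) fun e1 => htg (e1 ▸ rfl)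
  rcases hcl ⟨htcl, h.vertex_mem_curve t⟩ with h1 | h1
  · obtain ⟨i, -, hi, hti⟩ := mem_trace_edgeList.1 h1
    rcases h.vertex_mem_edge hti with h2 | h2
    · exact not_modEq_of_lt (by omega) (by omega) h2.symm
    · exact not_modEq_of_lt (by omega) (by omega) h2.symm
  · rw [segment_same] at h1
    exact htg (h.injective _ _ h1)

/-- The side of a triangle in a triangulation: every link that cuts off a vertex is the base of a
triangle. -/
lemma exists_triangle (h : SimpleCycle n P) {a g : ℕ} (hg : 2 ≤ g) (hgn : g < n)
    (hl : Linked n P a (a + g)) :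
    ∃ t, 0 < t ∧ t < g ∧ Linked n P a (a + t) ∧ Linked n P (a + t) (a + g) := by
  have key : ∃ t, 0 < t ∧ t < g ∧ Linked n (fun i => P (a + i)) 0 t ∧
      Linked n (fun i => P (a + i)) t g := by
    rcases Nat.lt_or_ge (g + 1) n with hg1 | hg1
    · refine (h.shift a).exists_triangle_diagonal hg (by omega) ?_
      rcases (h.linked_shift a (i := 0) (j := g)).2 hl with h1 | h1 | h1
      · exact h1
      · exact absurd h1.symm (not_modEq_of_lt (by omega) (by omega))
      · exact absurd h1 (not_modEq_of_lt (by omega) (by omega))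
    · obtain rfl : g = n - 1 := by omega
      exact (h.shift a).exists_triangle_edge
  obtain ⟨t, ht0, htg, h1, h2⟩ := key
  exact ⟨t, ht0, htg, (h.linked_shift a).1 h1, (h.linked_shift a).1 h2⟩

/-- There is a vertex such that the vertices linked to it cut the polygon into short chains. -/
lemma exists_balanced (h : SimpleCycle n P) (hn : 4 ≤ n) :
    ∃ a, ∀ z, 0 < z → z < n → Linked n P a (a + z) ∨ ∃ l u, l < z ∧ z < u ∧ u ≤ n ∧
      u - l ≤ n / 2 - 1 ∧ (l = 0 ∨ Linked n P a (a + l)) ∧ (u = n ∨ Linked n P a (a + u)) := by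
  classical
  -- Links spanning a long chain exist: an edge spans the chain of the `n - 1` other edges. The
  -- minimal `g` is used, so both chains at its apex `a + t` have fewer than `n / 2` edges.
  have hex : ∃ g, n / 2 ≤ g ∧ g < n ∧ ∃ a, Linked n P a (a + g) := by
    refine ⟨n - 1, by omega, by omega, 0, Or.inr (Or.inr ?_)⟩
    rw [show 0 + (n - 1) + 1 = n by omega]; simp [Nat.ModEq]
  set g := Nat.find hex with hgdef
  obtain ⟨hg1, hgn, a, hag⟩ := Nat.find_spec hex
  have hmin : ∀ a t, Linked n P a (a + t) → t < g → t < n / 2 := by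
    intro a t hl ht
    by_contra hcon
    exact Nat.find_min hex ht ⟨by omega, by omega, a, hl⟩
  obtain ⟨t, ht0, htg, hat, htag⟩ := h.exists_triangle (by omega) hgn hag
  have ht1 := hmin a t hat htg
  have ht2 := hmin (a + t) (g - t) (by rwa [show a + t + (g - t) = a + g by omega]) (by omega)
  have hper : ∀ i, i + n ≡ i [MOD n] := fun i => by simp [Nat.ModEq]
  by_cases hh : n - g < n / 2
  · refine ⟨a, fun z hz0 hzn => ?_⟩
    by_cases h1 : z = t
    · left; rw [h1]; exact hat
    by_cases h2 : z = g
    · left; rw [h2]; exact hag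
    right
    rcases Nat.lt_or_ge z t with h3 | h3
    · exact ⟨0, t, by omega, by omega, by omega, by omega, Or.inl rfl, Or.inr hat⟩
    rcases Nat.lt_or_ge z g with h4 | h4
    · exact ⟨t, g, by omega, by omega, by omega, by omega, Or.inr hat, Or.inr hag⟩
    · exact ⟨g, n, by omega, by omega, by omega, by omega, Or.inr hag, Or.inl rfl⟩
  -- Now the complementary chain has `n / 2` or `n / 2 + 1` edges. It is split at a second apex `a +
  -- g + q`. A part can still have `n / 2` edges only if the other part is a single edge; that part
  -- is split once more, and the vertex chosen is the end that it shares with the first link.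
  have hback : Linked n P (a + g) (a + g + (n - g)) := by
    rw [show a + g + (n - g) = a + n by omega]
    exact h.linked_congr rfl (hper a).symm hag.symm
  obtain ⟨q, hq0, hqh, hq1, hq2⟩ := h.exists_triangle (by omega) (by omega) hback
  rw [show a + g + (n - g) = a + n by omega] at hq2
  have hq2' : Linked n P a (a + (g + q)) := by
    rw [← add_assoc]
    exact (h.linked_congr rfl (hper a) hq2).symm
  by_cases hA : n - g - q < n / 2
  · by_cases hB : q < n / 2
    · refine ⟨a, fun z hz0 hzn => ?_⟩
      by_cases h1 : z = t
      · left; rw [h1]; exact hat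
      by_cases h2 : z = g
      · left; rw [h2]; exact hag
      by_cases h3 : z = g + q
      · left; rw [h3]; exact hq2'
      right
      rcases Nat.lt_or_ge z t with h4 | h4
      · exact ⟨0, t, by omega, by omega, by omega, by omega, Or.inl rfl, Or.inr hat⟩
      rcases Nat.lt_or_ge z g with h5 | h5
      · exact ⟨t, g, by omega, by omega, by omega, by omega, Or.inr hat, Or.inr hag⟩
      rcases Nat.lt_or_ge z (g + q) with h6 | h6
      · exact ⟨g, g + q, by omega, by omega, by omega, by omega, Or.inr hag, Or.inr hq2'⟩
      · exact ⟨g + q, n, by omega, by omega, by omega, by omega, Or.inr hq2', Or.inl rfl⟩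
    · -- the chain from `a + g` to `a + g + q` is long
      obtain ⟨w, hw0, hwq, hw1, hw2⟩ := h.exists_triangle (by omega) (by omega) hq1
      have hva : Linked n P (a + g) (a + g + (n - g)) := hback
      have hvt : Linked n P (a + g) (a + g + (n - g + t)) := by
        rw [show a + g + (n - g + t) = a + t + n by omega]
        exact h.linked_congr rfl (hper (a + t)).symm htag.symm
      refine ⟨a + g, fun z hz0 hzn => ?_⟩
      by_cases h1 : z = w
      · left; rw [h1]; exact hw1
      by_cases h2 : z = q
      · left; rw [h2]; exact hq1
      by_cases h3 : z = n - g
      · left; rw [h3]; exact hva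
      by_cases h4 : z = n - g + t
      · left; rw [h4]; exact hvt
      right
      rcases Nat.lt_or_ge z w with h5 | h5
      · exact ⟨0, w, by omega, by omega, by omega, by omega, Or.inl rfl, Or.inr hw1⟩
      rcases Nat.lt_or_ge z q with h6 | h6
      · exact ⟨w, q, by omega, by omega, by omega, by omega, Or.inr hw1, Or.inr hq1⟩
      rcases Nat.lt_or_ge z (n - g) with h7 | h7
      · exact ⟨q, n - g, by omega, by omega, by omega, by omega, Or.inr hq1, Or.inr hva⟩
      rcases Nat.lt_or_ge z (n - g + t) with h8 | h8
      · exact ⟨n - g, n - g + t, by omega, by omega, by omega, by omega, Or.inr hva, Or.inr hvt⟩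
      · exact ⟨n - g + t, n, by omega, by omega, by omega, by omega, Or.inr hvt, Or.inl rfl⟩
  · have hq3 : Linked n P (a + g + q) (a + g + q + (n - g - q)) := by
      rw [show a + g + q + (n - g - q) = a + n by omega]; exact hq2
    obtain ⟨w, hw0, hwq, hw1, hw2⟩ := h.exists_triangle (by omega) (by omega) hq3
    have hw2' : Linked n P a (a + (g + q + w)) := by
      rw [show a + g + q + (n - g - q) = a + n by omega] at hw2
      rw [show a + (g + q + w) = a + g + q + w by omega]
      exact (h.linked_congr rfl (hper a) hw2).symm
    refine ⟨a, fun z hz0 hzn => ?_⟩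
    by_cases h1 : z = t
    · left; rw [h1]; exact hat
    by_cases h2 : z = g
    · left; rw [h2]; exact hag
    by_cases h3 : z = g + q
    · left; rw [h3]; exact hq2'
    by_cases h4 : z = g + q + w
    · left; rw [h4]; exact hw2'
    right
    rcases Nat.lt_or_ge z t with h5 | h5
    · exact ⟨0, t, by omega, by omega, by omega, by omega, Or.inl rfl, Or.inr hat⟩
    rcases Nat.lt_or_ge z g with h6 | h6
    · exact ⟨t, g, by omega, by omega, by omega, by omega, Or.inr hat, Or.inr hag⟩
    rcases Nat.lt_or_ge z (g + q) with h7 | h7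
    · exact ⟨g, g + q, by omega, by omega, by omega, by omega, Or.inr hag, Or.inr hq2'⟩
    rcases Nat.lt_or_ge z (g + q + w) with h8 | h8
    · exact ⟨g + q, g + q + w, by omega, by omega, by omega, by omega, Or.inr hq2', Or.inr hw2'⟩
    · exact ⟨g + q + w, n, by omega, by omega, by omega, by omega, Or.inr hw2', Or.inl rfl⟩

end SimpleCycle

end GenKernel

/-! ### Points near a vertex that see all vertices linked to it. -/

namespace GenKernel
open Set Filter Topology

lemma isOpen_off_line (u y : Plane) : IsOpen {x | cross u (x - y) ≠ 0} :=
  isOpen_ne_fun (by fun_prop) continuous_const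

lemma dense_off_line {u : Plane} (hu : u ≠ 0) (y : Plane) : Dense {x | cross u (x - y) ≠ 0} := by
  intro x
  by_cases hx : cross u (x - y) = 0
  · refine mem_closure_of_ray (d := rot u) one_pos fun t ht _ => ?_
    show cross u (x + t • rot u - y) ≠ 0
    rw [add_sub_right_comm, cross_add_right, hx, cross_smul_right, zero_add]
    exact (mul_pos ht (cross_rot_pos hu)).ne'
  · exact subset_closure hx

/-- An open set contains an open set of points off finitely many lines. -/
lemma exists_open_off_lines {L : Set (Plane × Plane)} (hL : L.Finite) (hL0 : ∀ l ∈ L, l.1 ≠ 0)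
    {W : Set Plane} (hW : IsOpen W) (hne : W.Nonempty) :
    ∃ O ⊆ W, IsOpen O ∧ O.Nonempty ∧ ∀ x ∈ O, ∀ l ∈ L, cross l.1 (x - l.2) ≠ 0 := by
  refine ⟨W ∩ ⋂ l ∈ L, {x | cross l.1 (x - l.2) ≠ 0}, inter_subset_left,
    hW.inter (hL.isOpen_biInter fun l _ => isOpen_off_line _ _), ?_, fun x hx l hl => ?_⟩
  · have hd := dense_biInter_of_isOpen (fun l _ => isOpen_off_line l.1 l.2) hL.countable
      fun l hl => dense_off_line (hL0 l hl) l.2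
    exact hd.inter_open_nonempty W hW hne
  · exact mem_iInter₂.1 hx.2 l hl

namespace SimpleCycle

variable {n : ℕ} {P : ℕ → Plane}

/-- Edges meet the open segment between linked vertices only if they join them. -/
lemma Linked.edge_disjoint (h : SimpleCycle n P) {i j : ℕ} (hij : ¬ i ≡ j [MOD n])
    (hl : Linked n P i j) {c : ℕ} (hc : P i ∉ edge P c) :
    Disjoint (edge P c) (openSegment ℝ (P i) (P j)) := by
  refine disjoint_left.2 fun x hx hx' => ?_
  have key : ∀ m, openSegment ℝ (P i) (P j) ⊆ edge P m → P i ∈ edge P m → False := by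
    intro m hm hmi
    by_cases hmc : m ≡ c [MOD n]
    · exact hc (h.edge_congr hmc ▸ hmi)
    · obtain ⟨a, rfl⟩ := h.mem_range_of_two_edges hmc (hm hx') hx
      exact h.vertex_notMem_openSegment hij a hx'
  rcases hl with h1 | h1 | h1
  · exact (h1 hx').1 (h.edge_subset_curve c hx)
  · refine key i ?_ (left_mem_segment ℝ _ _)
    rw [h.congr h1]; exact openSegment_subset_segment ℝ _ _
  · refine key j ?_ ?_
    · rw [h.congr h1, openSegment_symm]; exact openSegment_subset_segment ℝ _ _
    · rw [h.congr h1]; exact right_mem_segment ℝ _ _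

/-- As `s` tends to `v`, the triangle `v s w` shrinks to the segment `vw`, which has positive
distance from `a`. -/
lemma eventually_triangle_empty {v w a : Plane} (ha : a ∉ segment ℝ v w) :
    ∀ᶠ s in 𝓝 v, ∀ b g : ℝ, 0 ≤ b → 0 ≤ g → b + g ≤ 1 →
      v + b • (s - v) + g • (w - v) ≠ a := by
  obtain ⟨ρ, hρ, hball⟩ := Metric.isOpen_iff.1 (isCompact_segment v w).isClosed.isOpen_compl a ha
  filter_upwards [Metric.ball_mem_nhds v hρ] with s hs b g hb hg hbg he
  refine hball (a := v + g • (w - v)) ?_ ?_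
  · rw [Metric.mem_ball, dist_eq_norm, ← he]
    have : v + g • (w - v) - (v + b • (s - v) + g • (w - v)) = -(b • (s - v)) := by module
    rw [this, norm_neg, norm_smul, Real.norm_eq_abs, abs_of_nonneg hb]
    have hs : dist s v < ρ := hs
    rw [dist_eq_norm] at hs
    have : b * ‖s - v‖ ≤ 1 * ‖s - v‖ := mul_le_mul_of_nonneg_right (by linarith) (norm_nonneg _)
    linarith
  · rw [segment_eq_image']
    exact ⟨g, ⟨hg, by linarith⟩, rfl⟩

/-- The cone at the vertex `P 1` from which the whole neighbourhood of the vertex is visible. -/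
lemma exists_core (h : SimpleCycle n P) :
    ∃ W : Set Plane, IsOpen W ∧ P 1 ∈ closure W ∧ W ⊆ inside (curve P) ∧ ∀ s ∈ W,
      openSegment ℝ s (P 1) ⊆ inside (curve P) ∧
      ∀ w, ¬ 1 ≡ w [MOD n] → Linked n P 1 w → ∀ c, P 1 ∈ edge P c →
        Disjoint (edge P c) (openSegment ℝ s (P w)) := by
  have h3 := h.three_le
  obtain ⟨c, hc⟩ : ∃ c, c = cross (P 2 - P 1) (P 0 - P 1) := ⟨_, rfl⟩
  have hc0 : 0 < c * c := mul_self_pos.2 (hc ▸ h.cross_vertex_ne_zero)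
  obtain ⟨r, hr, hs⟩ := h.localSplit_vertex hc
  set f : Plane → ℝ := fun x => c * cross (P 2 - P 1) (x - P 1) with hfdef
  set g : Plane → ℝ := fun x => c * cross (x - P 1) (P 0 - P 1) with hgdef
  have hf : IsAff f := (isAff_cross_sub (P 2 - P 1) (P 1)).const_mul c
  have hg : IsAff g := (isAff_sub_cross (P 0 - P 1) (P 1)).const_mul c
  have hfc : Continuous f := by simp only [hfdef]; fun_prop
  have hgc : Continuous g := by simp only [hgdef]; fun_prop
  have f1 : f (P 1) = 0 := by simp [hfdef, cross]
  have g1 : g (P 1) = 0 := by simp [hgdef, cross]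
  have f2 : f (P 2) = 0 := by simp [hfdef, cross_self]
  have g2 : g (P 2) = c * c := by simp [hgdef, ← hc]
  have f0 : f (P 0) = c * c := by simp [hfdef, ← hc]
  have g0 : g (P 0) = 0 := by simp [hgdef, cross_self]
  have hseg : ∀ (x y : Plane) (t : ℝ), f (x + t • (y - x)) = (1 - t) * f x + t * f y ∧
      g (x + t • (y - x)) = (1 - t) * g x + t * g y := by
    intro x y t
    rw [show x + t • (y - x) = (1 - t) • x + t • y by module]
    exact ⟨hf _ _ _ _ (by ring), hg _ _ _ _ (by ring)⟩
  have hedge : ∀ m, P 1 ∈ edge P m → ∀ x ∈ edge P m, 0 ≤ f x ∧ 0 ≤ g x ∧ (f x = 0 ∨ g x = 0) := by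
    intro m hm x hx
    rcases h.vertex_mem_edge hm with h1 | h1
    · rw [← h.edge_congr h1] at hx
      obtain ⟨s, t, hs, ht, hst, rfl⟩ := hx
      rw [hf _ _ _ _ hst, hg _ _ _ _ hst, f1, g1, f2, g2]
      exact ⟨by simp, by positivity, Or.inl (by simp)⟩
    · have h1' : 0 ≡ m [MOD n] := Nat.ModEq.add_right_cancel' 1 h1
      rw [← h.edge_congr h1'] at hx
      obtain ⟨s, t, hs, ht, hst, rfl⟩ := hx
      rw [hf _ _ _ _ hst, hg _ _ _ _ hst, f1, g1, f0, g0]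
      exact ⟨by positivity, by simp, Or.inr (by simp)⟩
  have hopen : ∀ {s w x : Plane}, x ∈ openSegment ℝ s w → ∃ a b : ℝ, 0 < a ∧ 0 < b ∧
      f x = a * f s + b * f w ∧ g x = a * g s + b * g w := by
    rintro s w x ⟨a, b, ha, hb, hab, rfl⟩
    exact ⟨a, b, ha, hb, hf _ _ _ _ hab, hg _ _ _ _ hab⟩
  -- points of a diagonal close to the vertex
  have hdiag : ∀ w, openSegment ℝ (P 1) (P w) ⊆ inside (curve P) → ∃ t : ℝ, 0 < t ∧
      P 1 + t • (P w - P 1) ∈ Metric.ball (P 1) r ∩ inside (curve P) := by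
    intro w hw
    have hcont : Continuous fun t : ℝ => P 1 + t • (P w - P 1) := by fun_prop
    have h2 := hcont.tendsto 0
    simp only [zero_smul, add_zero] at h2
    have hev := (h2.mono_left (nhdsWithin_le_nhds (s := Ioi 0))).eventually
      (Metric.ball_mem_nhds (P 1) hr)
    obtain ⟨t, htb, ht0, ht1⟩ := (hev.and (Ioo_mem_nhdsGT (zero_lt_one (α := ℝ)))).exists
    refine ⟨t, ht0, htb, hw ?_⟩
    rw [openSegment_eq_image']; exact ⟨t, ⟨ht0, ht1⟩, rfl⟩
  have hv := h.vertex_mem_curve 1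
  obtain ⟨p, q, hp, hq, hin, hout, -⟩ := h.exists_components
  have hdisj : ∀ x, x ∈ inside (curve P) → x ∈ outside (curve P) → False :=
    fun x h1 h2 => h2.2 h1.2
  have hballseg : ∀ s ∈ Metric.ball (P 1) r, openSegment ℝ s (P 1) ⊆ Metric.ball (P 1) r :=
    fun s hs => (convex_ball _ _).openSegment_subset hs (Metric.mem_ball_self hr)
  have h1 := hs.subset_component (h.curve_subset_closure_component hp hv)
  have h2 := hs.subset_component (h.curve_subset_closure_component hq hv)
  rw [← hin] at h1
  rw [← hout] at h2
  -- If the inside at the vertex is the convex sector, `W` is this sector: linked vertices have `f,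
  -- g ≥ 0`, so both functions are positive on the open segments from `s` to them, while one
  -- vanishes on each edge at the vertex. If it is the reflex sector, `W` is the opposite cone `f, g
  -- < 0`: linked vertices have `f ≤ 0` or `g ≤ 0`, so one function is negative on the open segment,
  -- while both are nonnegative on those edges. The other two combinations would make inside and
  -- outside meet.
  rcases h1 with ⟨h1, z1, hz1⟩ | ⟨h1, z1, hz1⟩ <;> rcases h2 with ⟨h2, -⟩ | ⟨h2, -⟩
  · exact (hdisj _ (h1 hz1) (h2 hz1)).elim
  · refine ⟨Metric.ball (P 1) r ∩ {x | 0 < f x ∧ 0 < g x},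
      Metric.isOpen_ball.inter ((isOpen_lt continuous_const hfc).inter
        (isOpen_lt continuous_const hgc)), hs.closure₁ ⟨hs.mem, hv⟩, h1, ?_⟩
    rintro s ⟨hsb, hsf, hsg⟩
    refine ⟨fun x hx => h1 ⟨hballseg s hsb hx, ?_⟩, fun w hw hl m hm => ?_⟩
    · obtain ⟨a, b, ha, -, e1, e2⟩ := hopen hx
      rw [f1, mul_zero, add_zero] at e1
      rw [g1, mul_zero, add_zero] at e2
      exact ⟨by rw [← hfdef] at *; show 0 < f x; rw [e1]; positivity,
        by show 0 < g x; rw [e2]; positivity⟩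
    · have hw' : 0 ≤ f (P w) ∧ 0 ≤ g (P w) := by
        rcases hl with hl | hl | hl
        · obtain ⟨t, ht, htb, hti⟩ := hdiag w hl
          rcases hs.cover ⟨htb, hti.1⟩ with h4 | h4
          · have e1 : 0 < f (P 1 + t • (P w - P 1)) := h4.2.1
            have e2 : 0 < g (P 1 + t • (P w - P 1)) := h4.2.2
            rw [(hseg _ _ _).1, f1, mul_zero, zero_add] at e1
            rw [(hseg _ _ _).2, g1, mul_zero, zero_add] at e2
            exact ⟨(pos_of_mul_pos_right e1 ht.le).le, (pos_of_mul_pos_right e2 ht.le).le⟩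
          · exact (hdisj _ hti (h2 h4)).elim
        · rw [h.congr hl]; exact ⟨f2.ge, by rw [g2]; exact hc0.le⟩
        · have h1' : 0 ≡ w [MOD n] := Nat.ModEq.add_right_cancel' 1 hl
          rw [← h.congr h1']; exact ⟨by rw [f0]; exact hc0.le, g0.ge⟩
      refine disjoint_left.2 fun x hx hx' => ?_
      obtain ⟨a, b, ha, hb, e1, e2⟩ := hopen hx'
      have p1 := mul_pos ha hsf
      have p2 := mul_pos ha hsg
      have p3 := mul_nonneg hb.le hw'.1
      have p4 := mul_nonneg hb.le hw'.2
      rcases (hedge m hm x hx).2.2 with h5 | h5 <;> linarith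
  · refine ⟨Metric.ball (P 1) r ∩ {x | f x < 0 ∧ g x < 0},
      Metric.isOpen_ball.inter ((isOpen_lt hfc continuous_const).inter
        (isOpen_lt hgc continuous_const)), ?_,
      fun x hx => h1 ⟨hx.1, Or.inl hx.2.1⟩, ?_⟩
    · refine mem_closure_inter_of_ray (d := -((P 2 - P 1) + (P 0 - P 1))) Metric.isOpen_ball
        hs.mem fun t ht => ?_
      have e1 : f (P 1 + t • -((P 2 - P 1) + (P 0 - P 1))) = -(t * (c * c)) := by
        simp only [hfdef]
        rw [add_sub_cancel_left, cross_smul_right, cross_neg_right, cross_add_right, cross_self,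
          ← hc]; ring
      have e2 : g (P 1 + t • -((P 2 - P 1) + (P 0 - P 1))) = -(t * (c * c)) := by
        simp only [hgdef]
        rw [add_sub_cancel_left, cross_smul_left, cross_neg_left, cross_add_left, cross_self,
          ← hc]; ring
      have := mul_pos ht hc0
      exact ⟨by rw [e1]; linarith, by rw [e2]; linarith⟩
    rintro s ⟨hsb, hsf, hsg⟩
    refine ⟨fun x hx => h1 ⟨hballseg s hsb hx, Or.inl ?_⟩, fun w hw hl m hm => ?_⟩
    · obtain ⟨a, b, ha, -, e1, e2⟩ := hopen hx
      rw [f1, mul_zero, add_zero] at e1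
      show f x < 0
      rw [e1]; exact mul_neg_of_pos_of_neg ha hsf
    · have hw' : f (P w) ≤ 0 ∨ g (P w) ≤ 0 := by
        rcases hl with hl | hl | hl
        · obtain ⟨t, ht, htb, hti⟩ := hdiag w hl
          rcases hs.cover ⟨htb, hti.1⟩ with h4 | h4
          · exact (hdisj _ hti (h2 h4)).elim
          · refine h4.2.imp (fun e1 => ?_) (fun e1 => ?_)
            · have e1 : f (P 1 + t • (P w - P 1)) < 0 := e1
              rw [(hseg _ _ _).1, f1, mul_zero, zero_add] at e1
              exact (neg_of_mul_neg_right e1 ht.le).le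
            · have e1 : g (P 1 + t • (P w - P 1)) < 0 := e1
              rw [(hseg _ _ _).2, g1, mul_zero, zero_add] at e1
              exact (neg_of_mul_neg_right e1 ht.le).le
        · rw [h.congr hl]; exact Or.inl f2.le
        · have h1' : 0 ≡ w [MOD n] := Nat.ModEq.add_right_cancel' 1 hl
          rw [← h.congr h1']; exact Or.inr g0.le
      refine disjoint_left.2 fun x hx hx' => ?_
      obtain ⟨a, b, ha, hb, e1, e2⟩ := hopen hx'
      obtain ⟨h5, h6, -⟩ := hedge m hm x hx
      rcases hw' with h7 | h7
      · have p1 := mul_neg_of_pos_of_neg ha hsf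
        have p3 := mul_nonpos_of_nonneg_of_nonpos hb.le h7
        linarith
      · have p1 := mul_neg_of_pos_of_neg ha hsg
        have p3 := mul_nonpos_of_nonneg_of_nonpos hb.le h7
        linarith
  · exact (hdisj _ (h1 hz1) (h2 hz1)).elim

/-- From an open set of points near a vertex, all vertices linked to it are visible. -/
lemma exists_viewpoints (h : SimpleCycle n P) :
    ∃ O : Set Plane, IsOpen O ∧ O.Nonempty ∧ O ⊆ inside (curve P) ∧ ∀ s ∈ O,
      openSegment ℝ s (P 1) ⊆ inside (curve P) ∧
      ∀ w, Linked n P 1 w → openSegment ℝ s (P w) ⊆ inside (curve P) := by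
  obtain ⟨W, hWo, hWcl, hWin, hW⟩ := h.exists_core
  -- For `s` near `P 1`, each thin triangle `P 1`, `s`, `P w` contains no vertices but those on the
  -- segment from `P 1` to `P w`.
  have hev : ∀ᶠ s in 𝓝 (P 1), ∀ pq ∈ {pq : Plane × Plane | pq.1 ∈ range P ∧ pq.2 ∈ range P ∧
      pq.2 ∉ segment ℝ (P 1) pq.1}, ∀ b g : ℝ, 0 ≤ b → 0 ≤ g → b + g ≤ 1 →
      P 1 + b • (s - P 1) + g • (pq.1 - P 1) ≠ pq.2 := by
    rw [Filter.eventually_all_finite ((h.finite_range.prod h.finite_range).subset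
      fun pq hpq => ⟨hpq.1, hpq.2.1⟩)]
    rintro pq ⟨-, -, hpq⟩
    exact eventually_triangle_empty hpq
  obtain ⟨N, hN, hNo, hvN⟩ := eventually_nhds_iff.1 hev
  have hNW : (N ∩ W).Nonempty := mem_closure_iff.1 hWcl N hNo hvN
  -- Off the lines through two vertices, the thin triangles are nondegenerate and no further vertex
  -- is on the line through `s` and `P w`.
  obtain ⟨O, hO, hOo, hOne, hOgen⟩ := exists_open_off_lines
    (L := (fun pq : Plane × Plane => (pq.2 - pq.1, pq.1)) ''
      {pq | pq.1 ∈ range P ∧ pq.2 ∈ range P ∧ pq.1 ≠ pq.2})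
    (((h.finite_range.prod h.finite_range).subset fun pq hpq => ⟨hpq.1, hpq.2.1⟩).image _)
    (by rintro _ ⟨pq, hpq, rfl⟩; exact sub_ne_zero.2 hpq.2.2.symm) (hNo.inter hWo) hNW
  have hgen : ∀ s ∈ O, ∀ a b, P a ≠ P b → cross (P a - s) (P b - s) ≠ 0 := by
    intro s hs a b hab
    rw [cross_sub_sub]
    exact hOgen s hs _ ⟨(P a, P b), ⟨⟨a, rfl⟩, ⟨b, rfl⟩, hab⟩, rfl⟩
  refine ⟨O, hOo, hOne, fun s hs => hWin (hO hs).2, fun s hs => ?_⟩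
  obtain ⟨hs1, hs2⟩ := hW s (hO hs).2
  refine ⟨hs1, fun w hl => ?_⟩
  by_cases hw : 1 ≡ w [MOD n]
  · rw [← h.congr hw]; exact hs1
  have hsI := hWin (hO hs).2
  have hPw : P 1 ≠ P w := fun e => hw (h.injective _ _ e)
  have hsw : s ≠ P w := by rintro he; exact hsI.1 (he ▸ h.vertex_mem_curve w)
  have hdisj : Disjoint (openSegment ℝ s (P w)) (curve P) := by
    refine disjoint_right.2 fun x hxC hx => ?_
    obtain ⟨c, hc⟩ := mem_iUnion.1 hxC
    by_cases hvc : P 1 ∈ edge P c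
    · exact disjoint_left.1 (hs2 w hw hl c hvc) hc hx
    have hΔ : cross (s - P 1) (P w - P 1) ≠ 0 := by
      have := hgen s hs w 1 hPw.symm
      intro h0
      apply this
      have e1 : cross (P w - s) (P 1 - s) = cross (s - P 1) (P w - P 1) := by simp [cross]; ring
      rw [e1, h0]
    obtain ⟨β, γ, hβ, hγ, hcoord, huniq⟩ := exists_coords hΔ
    have hsc : β s = 1 ∧ γ s = 0 := by
      have := huniq 1 0
      rwa [one_smul, zero_smul, add_zero, add_sub_cancel] at this
    have hwc : β (P w) = 0 ∧ γ (P w) = 1 := by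
      have := huniq 0 1
      rwa [one_smul, zero_smul, add_zero, add_sub_cancel] at this
    have hline : ∀ a, β (P a) + γ (P a) = 1 → P a = P w := by
      intro a ha
      by_contra hne
      apply hgen s hs a w hne
      have e1 : P a - s = γ (P a) • (P w - s) := by
        nth_rewrite 1 [hcoord (P a)]
        rw [show β (P a) = 1 - γ (P a) by linarith]; module
      rw [e1, cross_smul_left, cross_self, mul_zero]
    have hvert : ∀ a, P a ≠ P 1 → β (P a) < 0 ∨ γ (P a) < 0 ∨ 1 ≤ β (P a) + γ (P a) := by
      intro a ha
      by_contra hcon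
      push Not at hcon
      obtain ⟨h1, h2, h3⟩ := hcon
      have haw : P a ≠ P w := by
        intro e; rw [e, hwc.1, hwc.2] at h3; norm_num at h3
      refine hN s (hO hs).1 (P w, P a) ⟨⟨w, rfl⟩, ⟨a, rfl⟩, ?_⟩ (β (P a)) (γ (P a)) h1 h2 h3.le
        (hcoord (P a)).symm
      intro hseg
      refine h.vertex_notMem_openSegment hw a ?_
      exact mem_openSegment_of_ne_left_right ha.symm haw.symm hseg
    have hne1 : P c ≠ P 1 := fun e => hvc (e ▸ left_mem_segment ℝ _ _)
    have hne2 : P (c + 1) ≠ P 1 := fun e => hvc (e ▸ right_mem_segment ℝ _ _)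
    obtain ⟨a, b, ha, hb, hab, hxab⟩ := hx
    have e1 : β x = a := by rw [← hxab, hβ _ _ _ _ hab, hsc.1, hwc.1]; ring
    have e2 : γ x = b := by rw [← hxab, hγ _ _ _ _ hab, hsc.2, hwc.2]; ring
    -- An edge not containing `P 1` misses the sides from `P 1` to `s` and to `P w`, and its ends
    -- are not in the thin triangle below the third side. So it cannot cross the side from `s` to `P
    -- w`.
    refine disjoint_triangle hβ hγ hcoord (x := x) (a := P c) (b := P (c + 1)) ?_ ?_
      (hvert c hne1) (hvert _ hne2) hc ?_ ?_ ?_ (Or.inr ⟨?_, ?_, ?_⟩)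
    · intro g hg0 hg1 hz
      rcases hg0.eq_or_lt with rfl | hg0
      · rw [zero_smul, add_zero] at hz; exact hvc hz
      · refine (hs1 ?_).1 (h.edge_subset_curve c hz)
        rw [openSegment_symm, openSegment_eq_image']
        exact ⟨g, ⟨hg0, hg1⟩, rfl⟩
    · intro g hg0 hg1 hz
      rcases hg0.eq_or_lt with rfl | hg0
      · rw [zero_smul, add_zero] at hz; exact hvc hz
      · refine disjoint_left.1 (Linked.edge_disjoint h hw hl hvc) hz ?_
        rw [openSegment_eq_image']
        exact ⟨g, ⟨hg0, hg1⟩, rfl⟩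
    · rw [e1]; exact ha.le
    · rw [e2]; exact hb.le
    · rw [e1, e2]; exact hab.le
    · rw [e1]; exact ha
    · rw [e2]; exact hb
    · by_contra hcon
      push Not at hcon
      have hxw : x ≠ P w := by
        rintro rfl; rw [hwc.1] at e1; exact ha.ne e1
      have hx1 : x ≠ P c := by
        rintro rfl; exact hxw (hline c (by rw [e1, e2, hab]))
      have hx2 : x ≠ P (c + 1) := by
        rintro rfl; exact hxw (hline (c + 1) (by rw [e1, e2, hab]))
      obtain ⟨s', t', hs', ht', hst', hx'⟩ :=
        mem_openSegment_of_ne_left_right hx1.symm hx2.symm hc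
      have hsum : s' * (β (P c) + γ (P c)) + t' * (β (P (c + 1)) + γ (P (c + 1))) = 1 := by
        have := hab
        rw [← e1, ← e2, ← hx', hβ _ _ _ _ hst', hγ _ _ _ _ hst'] at this
        linarith
      have hc1 : β (P c) + γ (P c) = 1 := by
        refine le_antisymm (not_lt.1 fun h1 => ?_) hcon.1
        have p1 := mul_lt_mul_of_pos_left h1 hs'
        have p2 := mul_le_mul_of_nonneg_left hcon.2 ht'.le
        linarith
      have hc2 : β (P (c + 1)) + γ (P (c + 1)) = 1 := by
        refine le_antisymm (not_lt.1 fun h1 => ?_) hcon.2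
        have p1 := mul_lt_mul_of_pos_left h1 ht'
        have p2 := mul_le_mul_of_nonneg_left hcon.1 hs'.le
        linarith
      exact h.ne_succ c ((hline _ hc1).trans (hline _ hc2).symm)
  obtain ⟨δ, hδ, hball⟩ := Metric.isOpen_iff.1 h.isOpen_inside s hsI
  have hcl : s ∈ closure (openSegment ℝ s (P w)) := by
    rw [closure_openSegment]; exact left_mem_segment ℝ _ _
  obtain ⟨z, hzb, hz⟩ := mem_closure_iff.1 hcl _ Metric.isOpen_ball (Metric.mem_ball_self hδ)
  exact h.subset_inside (convex_openSegment _ _).isPreconnected hdisj hz (hball hzb)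

end SimpleCycle

end GenKernel

/-! ### Counting the vertices adherent to a hidden set; the case of a triangle. -/

namespace GenKernel
open Set Filter Topology

/-- The set `U` lies in the region bounded by the curve `C` and is not crossed by any segment from
`s` to a point of `C` that runs inside. -/
structure IsHidden (C : Set Plane) (s : Plane) (U : Set Plane) : Prop where
  isPreconnected : IsPreconnected U
  subset : U ⊆ C ∪ inside C
  disjoint : ∀ w ∈ C, openSegment ℝ s w ⊆ inside C → Disjoint U (segment ℝ s w)

namespace SimpleCycle

variable {n : ℕ} {P : ℕ → Plane} {s : Plane} {U : Set Plane}

/-- Between two visible vertices there is a visible point that is not a vertex. -/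
lemma exists_visible_between (h : SimpleCycle n P) {j : ℕ} (hj : 1 ≤ j) (hjn : j < n)
    (hs : s ∈ inside (curve P)) (h0 : openSegment ℝ s (P 0) ⊆ inside (curve P))
    (h1 : openSegment ℝ s (P j) ⊆ inside (curve P)) :
    ∃ k y, k < j ∧ y ∈ edge P k ∧ y ∉ range P ∧ openSegment ℝ s y ⊆ inside (curve P) := by
  have hc : IsCut n P j (P j) s := ⟨hj, hjn, left_mem_segment ℝ _ _, h.ne_succ j, hs, h0, h1⟩
  obtain ⟨δ, hδ, hball⟩ := Metric.isOpen_iff.1 h.isOpen_inside s hs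
  have hcl : s ∈ closure (openSegment ℝ s (P 0)) := by
    rw [closure_openSegment]; exact left_mem_segment ℝ _ _
  obtain ⟨o, hoB, ho⟩ := mem_closure_iff.1 hcl _ Metric.isOpen_ball (Metric.mem_ball_self hδ)
  -- Choose `x` near `s`, next to the segment to `P 0` on the side of the arc, and off the lines
  -- joining `s` to vertices. The ray from `s` through `x` first meets the curve in a point that is
  -- not a vertex. The ray misses the cut up to there, so this point is on the arc.
  obtain ⟨V, hVB, hVo, hVne, -, hV⟩ := hc.exists_side h ho Metric.isOpen_ball hoB
  have hne : ∀ a, P a ≠ s := by rintro a rfl; exact hs.1 (h.vertex_mem_curve a)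
  obtain ⟨O, hOV, -, ⟨x, hxO⟩, hO⟩ := exists_open_off_lines
    (L := (fun a => (a - s, s)) '' range P) (h.finite_range.image _)
    (by rintro _ ⟨_, ⟨a, rfl⟩, rfl⟩; exact sub_ne_zero.2 (hne a)) hVo hVne
  have hgen : ∀ a, cross (P a - s) (x - s) ≠ 0 := fun a => hO x hxO _ ⟨P a, ⟨a, rfl⟩, rfl⟩
  have hxs : x - s ≠ 0 := by
    intro h2; apply hgen 0; rw [h2, ← zero_smul ℝ (0 : Plane), cross_smul_right, zero_mul]
  obtain ⟨τ, hτ, hyC, hyI⟩ := h.exists_first_hit hxs one_pos fun t ht0 ht1 => hball <| by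
    have := (convex_ball s δ).segment_subset (Metric.mem_ball_self hδ) (hVB (hOV hxO))
    rw [segment_eq_image'] at this
    exact this ⟨t, ⟨ht0.le, ht1⟩, rfl⟩
  have hτ0 : 0 < τ := one_pos.trans hτ
  obtain ⟨y, hy⟩ : ∃ y, y = s + τ • (x - s) := ⟨_, rfl⟩
  have hys : y - s = τ • (x - s) := by rw [hy, add_sub_cancel_left]
  rw [← hy] at hyC
  have hvis : openSegment ℝ s y ⊆ inside (curve P) := by
    rw [openSegment_eq_image', hys]
    rintro _ ⟨t, ht, rfl⟩
    simp only [smul_smul]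
    exact hyI _ (mul_pos ht.1 hτ0) (by nlinarith [ht.2])
  have hyv : y ∉ range P := by
    rintro ⟨a, rfl⟩
    apply hgen a
    rw [hys, cross_smul_left, cross_self, mul_zero]
  have hoff : ∀ a, Disjoint (openSegment ℝ s y) (segment ℝ s (P a)) := by
    intro a
    rw [openSegment_eq_image', hys, segment_eq_image']
    refine disjoint_left.2 ?_
    rintro _ ⟨t, ht, rfl⟩ ⟨m, hm, he⟩
    have he : m • (P a - s) = t • τ • (x - s) := add_left_cancel he
    have e1 : cross (P a - s) (m • (P a - s)) = t * (τ * cross (P a - s) (x - s)) := by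
      rw [he, cross_smul_right, cross_smul_right]
    rw [cross_smul_right, cross_self, mul_zero] at e1
    exact mul_ne_zero ht.1.ne' (mul_ne_zero hτ0.ne' (hgen a)) e1.symm
  have hxU : x ∈ openSegment ℝ s y := by
    rw [openSegment_eq_image', hys]
    refine ⟨τ⁻¹, ⟨inv_pos.2 hτ0, inv_lt_one_of_one_lt₀ hτ⟩, ?_⟩
    simp only [smul_smul, inv_mul_cancel₀ hτ0.ne', one_smul, add_sub_cancel]
  have hyA := (hV x (hOV hxO)).2 _ (convex_openSegment s y).isPreconnected
    (hvis.trans subset_union_right)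
    (disjoint_union_right.2 ⟨hoff 0, hoff j⟩) hxU
    ⟨by rw [closure_openSegment]; exact right_mem_segment ℝ _ _, hyC⟩
  rcases hyA with h2 | h2
  · obtain ⟨k, -, hk, hyk⟩ := mem_trace_edgeList.1 h2
    exact ⟨k, y, by omega, hyk, hyv, hvis⟩
  · rw [segment_same] at h2
    exact absurd ⟨j, h2.symm⟩ hyv

/-- A visible vertex between two others: these are not both adherent to a hidden set. -/
lemma not_mem_closure_of_lt (h : SimpleCycle n P) (hs : s ∈ inside (curve P))
    (hU : IsHidden (curve P) s U) {i j : ℕ} (hi : 0 < i) (hij : i < j) (hjn : j < n)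
    (h0 : openSegment ℝ s (P 0) ⊆ inside (curve P))
    (hvi : openSegment ℝ s (P i) ⊆ inside (curve P))
    (hvj : openSegment ℝ s (P j) ⊆ inside (curve P)) (hUi : P i ∈ closure U) :
    P j ∉ closure U := by
  intro hUj
  have hcs := h.curve_shift i
  obtain ⟨k, y, hk, hyk, hyv, hy⟩ := (h.shift i).exists_visible_between (s := s) (j := j - i)
    (by omega) (by omega) (by rwa [hcs]) (by rwa [hcs]) (by
      rw [hcs]; rwa [show i + (j - i) = j by omega])
  rw [hcs] at hy
  have hyk : y ∈ edge P (i + k) := hyk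
  have hyv : ∀ a, i ≤ a → y ≠ P a := by
    rintro a ha rfl
    exact hyv ⟨a - i, by simp only; rw [show i + (a - i) = a by omega]⟩
  -- The cut through `s` from `P 0` to `y` has `P i` on one arc and `P j` on the other, neither
  -- being an end of the cut.
  have hc : IsCut n P (i + k) y s :=
    ⟨by omega, by omega, hyk, hyv _ (by omega), hs, h0, hy⟩
  have hinter := h.arcs_inter hc.one_le hc.lt hyk hc.ne
  have hne : ∀ a, i ≤ a → a < n → P a ∉ ({P 0, y} : Set Plane) := by
    rintro a ha han (h2 | h2)
    · exact h.ne_of_lt (i := 0) (j := a) (by omega) (by omega) h2.symm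
    · exact hyv a ha h2.symm
  rcases hc.subset_or_subset h hU.isPreconnected hU.subset (disjoint_union_right.2
    ⟨hU.disjoint _ (h.vertex_mem_curve 0) h0, hU.disjoint _ (h.edge_subset_curve _ hyk) hy⟩) with
    ⟨-, h2⟩ | ⟨-, h2⟩
  · refine hne j hij.le hjn (hinter ⟨h2 ⟨hUj, h.vertex_mem_curve j⟩, Or.inr ?_⟩)
    exact mem_trace_edgeList.2 ⟨j, by omega, by omega, left_mem_segment ℝ _ _⟩
  · refine hne i le_rfl (by omega) (hinter ⟨?_, h2 ⟨hUi, h.vertex_mem_curve i⟩⟩)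
    rcases Nat.eq_zero_or_pos k with rfl | hk0
    · exact Or.inr (left_mem_segment ℝ _ _)
    · exact Or.inl (mem_trace_edgeList.2 ⟨i, by omega, by omega, left_mem_segment ℝ _ _⟩)

/-- If there are three visible vertices, at most one of them is adherent to a hidden set. -/
lemma not_mem_closure_of_visible (h : SimpleCycle n P) (hs : s ∈ inside (curve P))
    (hU : IsHidden (curve P) s U) {a b c : ℕ} (hab : ¬ a ≡ b [MOD n]) (hca : ¬ c ≡ a [MOD n])
    (hcb : ¬ c ≡ b [MOD n]) (ha : openSegment ℝ s (P a) ⊆ inside (curve P))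
    (hb : openSegment ℝ s (P b) ⊆ inside (curve P))
    (hc : openSegment ℝ s (P c) ⊆ inside (curve P)) (hUa : P a ∈ closure U) :
    P b ∉ closure U := by
  intro hUb
  obtain ⟨i, hi1, hi2, hi⟩ := h.exists_rep c a
  obtain ⟨j, hj1, hj2, hj⟩ := h.exists_rep c b
  have hic : i ≠ c := by rintro rfl; exact hca hi.symm
  have hjc : j ≠ c := by rintro rfl; exact hcb hj.symm
  have hij : i ≠ j := by rintro rfl; exact hab (hi.trans hj.symm)
  rw [h.congr hi] at ha hUa
  rw [h.congr hj] at hb hUb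
  have key : ∀ i j, c < i → i < j → j < c + n → openSegment ℝ s (P i) ⊆ inside (curve P) →
      openSegment ℝ s (P j) ⊆ inside (curve P) → P i ∈ closure U → P j ∉ closure U := by
    intro i j h1 h2 h3 hvi hvj hUi
    have hcs := h.curve_shift c
    have := (h.shift c).not_mem_closure_of_lt (s := s) (U := U) (i := i - c) (j := j - c)
      (by rwa [hcs]) (by rwa [hcs]) (by omega) (by omega) (by omega)
    simp only [hcs, show c + (i - c) = i by omega, show c + (j - c) = j by omega] at this
    exact this hc hvi hvj hUi
  rcases hij.lt_or_gt with h1 | h1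
  · exact key i j (by omega) h1 hj2 ha hb hUa hUb
  · exact key j i (by omega) h1 hi2 hb ha hUb hUa

/-- The vertices adherent to a hidden set seen from a point to which the vertices linked to `P 0`
are visible. -/
lemma ncard_adherent_le (h : SimpleCycle n P) (hn : 4 ≤ n) (hs : s ∈ inside (curve P))
    (hU : IsHidden (curve P) s U) (h0 : openSegment ℝ s (P 0) ⊆ inside (curve P))
    (hvis : ∀ w, Linked n P 0 w → openSegment ℝ s (P w) ⊆ inside (curve P))
    (hbal : ∀ z, 0 < z → z < n → Linked n P 0 z ∨ ∃ l u, l < z ∧ z < u ∧ u ≤ n ∧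
      u - l ≤ n / 2 - 1 ∧ (l = 0 ∨ Linked n P 0 l) ∧ (u = n ∨ Linked n P 0 u)) :
    (range P ∩ closure U).ncard ≤ n / 2 - 1 := by
  -- Vertex 0 and its two neighbours are visible, so besides any two vertices there is a third
  -- visible one.
  have hthird : ∀ a < n, ∀ b < n, ∃ c < n, c ≠ a ∧ c ≠ b ∧
      openSegment ℝ s (P c) ⊆ inside (curve P) := by
    intro a ha b hb
    obtain ⟨c, hc, hca, hcb⟩ : ∃ c, (c = 0 ∨ c = 1 ∨ c = n - 1) ∧ c ≠ a ∧ c ≠ b := by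
      by_contra! hcon
      have h1 := hcon 0 (by omega)
      have h2 := hcon 1 (by omega)
      have h3 := hcon (n - 1) (by omega)
      omega
    refine ⟨c, by omega, hca, hcb, ?_⟩
    rcases hc with rfl | rfl | rfl
    · exact h0
    · exact hvis 1 (Or.inr (Or.inl rfl))
    · refine hvis _ (Or.inr (Or.inr ?_))
      rw [show n - 1 + 1 = n by omega]; simp [Nat.ModEq]
  have huniq : ∀ a < n, ∀ b < n, a ≠ b → openSegment ℝ s (P a) ⊆ inside (curve P) →
      openSegment ℝ s (P b) ⊆ inside (curve P) → P a ∈ closure U → P b ∉ closure U := by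
    intro a ha b hb hab hva hvb
    obtain ⟨c, hc, hca, hcb, hvc⟩ := hthird a ha b hb
    exact h.not_mem_closure_of_visible hs hU (fun e => hab (e.eq_of_lt_of_lt ha hb))
      (fun e => hca (e.eq_of_lt_of_lt hc ha)) (fun e => hcb (e.eq_of_lt_of_lt hc hb)) hva hvb hvc
  have hfin : (range P ∩ closure U).Finite := h.finite_range.subset inter_subset_left
  by_cases hall : ∀ z < n, P z ∈ closure U → openSegment ℝ s (P z) ⊆ inside (curve P)
  · refine ((ncard_le_one hfin).2 ?_).trans (by omega)
    rintro _ ⟨⟨i, rfl⟩, hi⟩ _ ⟨⟨j, rfl⟩, hj⟩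
    obtain ⟨a, -, ha, hia⟩ := h.exists_rep 0 i
    obtain ⟨b, -, hb, hjb⟩ := h.exists_rep 0 j
    rw [zero_add] at ha hb
    rw [h.congr hia] at hi ⊢
    rw [h.congr hjb] at hj ⊢
    by_contra hne
    exact huniq a ha b hb (by rintro rfl; exact hne rfl) (hall a ha hi) (hall b hb hj) hi hj
  · push Not at hall
    obtain ⟨z, hzn, hzU, hz⟩ := hall
    have hz0 : 0 < z := by
      rcases Nat.eq_zero_or_pos z with rfl | h1
      · exact absurd h0 hz
      · exact h1
    obtain ⟨l, u, hlz, hzu, hun, hul, hl, hu⟩ := (hbal z hz0 hzn).resolve_left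
      fun h1 => hz (hvis z h1)
    have hvl : openSegment ℝ s (P l) ⊆ inside (curve P) := by
      rcases hl with rfl | hl
      · exact h0
      · exact hvis l hl
    have hvu : openSegment ℝ s (P u) ⊆ inside (curve P) := by
      rcases hu with rfl | hu
      · rwa [← zero_add u, h.periodic]
      · exact hvis u hu
    have hnot : P l ∈ closure U → P u ∉ closure U := by
      rcases hun.eq_or_lt with rfl | hun
      · have e : P u = P 0 := by rw [← h.periodic 0, zero_add]
        rw [e] at hvu ⊢
        exact huniq l (by omega) 0 (by omega) (by omega) hvl hvu
      · exact huniq l (by omega) u hun (by omega) hvl hvu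
    obtain ⟨g, rfl⟩ : ∃ g, u = l + g := ⟨u - l, by omega⟩
    have hcs := h.curve_shift l
    have hQ := h.shift l
    have hc : IsCut n (fun i => P (l + i)) g (P (l + g)) s := by
      refine ⟨by omega, by omega, left_mem_segment ℝ _ _, hQ.ne_succ g, ?_, ?_, ?_⟩ <;>
        rw [hcs] <;> assumption
    have hsplit := hc.subset_or_subset hQ hU.isPreconnected (by rw [hcs]; exact hU.subset)
      (disjoint_union_right.2 ⟨hU.disjoint _ (h.vertex_mem_curve l) hvl,
        hU.disjoint _ (h.vertex_mem_curve _) hvu⟩)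
    -- The invisible adherent vertex `z` lies strictly between `l` and `u`, which decides the side
    -- of the cut on which `U` lies.
    have hsub : closure U ∩ curve P ⊆ arcTo (fun i => P (l + i)) g (P (l + g)) := by
      rcases hsplit with ⟨-, h2⟩ | ⟨-, h2⟩
      · rwa [hcs] at h2
      · exfalso
        rw [hcs] at h2
        have hze : P z ∈ edge (fun i => P (l + i)) (z - l) := by
          have key : ∀ m, P (l + m) ∈ edge (fun i => P (l + i)) m :=
            fun m => left_mem_segment ℝ _ _
          have := key (z - l)
          rwa [show l + (z - l) = z by omega] at this
        rcases hQ.arcs_inter hc.one_le hc.lt hc.mem_edge hc.ne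
          ⟨Or.inl (mem_trace_edgeList.2 ⟨z - l, by omega, by omega, hze⟩),
            h2 ⟨hzU, h.vertex_mem_curve z⟩⟩ with h3 | h3
        · exact hz (h3 ▸ hvl)
        · have h3 : P z = P (l + g) := h3
          exact hz (h3 ▸ hvu)
    have hmem : ∀ x ∈ range P ∩ closure U, ∃ m ≤ g, x = P (l + m) := by
      rintro _ ⟨⟨i, rfl⟩, hi⟩
      rcases hsub ⟨hi, h.vertex_mem_curve i⟩ with h2 | h2
      · obtain ⟨k, -, hk, hik⟩ := mem_trace_edgeList.1 h2
        have hik : P i ∈ edge P (l + k) := hik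
        rcases h.vertex_mem_edge hik with h3 | h3
        · exact ⟨k, by omega, h.congr h3⟩
        · exact ⟨k + 1, by omega, h.congr h3⟩
      · rw [segment_same] at h2
        exact ⟨g, le_rfl, h2⟩
    -- The chain has `g + 1` vertices. One of its ends is not adherent and is dropped, which leaves
    -- index sets of size `g`.
    have hcard : ∀ A : Finset ℕ, A.card = g →
        range P ∩ closure U ⊆ (fun m => P (l + m)) '' (A : Set ℕ) →
        (range P ∩ closure U).ncard ≤ n / 2 - 1 := by
      intro A hA hsubA
      have h1 := ncard_le_ncard hsubA (A.finite_toSet.image _)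
      have h2 := ncard_image_le (f := fun m => P (l + m)) A.finite_toSet
      rw [ncard_coe_finset, hA] at h2
      omega
    by_cases hlU : P l ∈ closure U
    · refine hcard (Finset.range g) (Finset.card_range g) fun x hx => ?_
      obtain ⟨m, hm, rfl⟩ := hmem x hx
      refine ⟨m, ?_, rfl⟩
      rcases hm.eq_or_lt with rfl | hm
      · exact absurd hx.2 (hnot hlU)
      · simpa using hm
    · refine hcard (Finset.Icc 1 g) (by simp) fun x hx => ?_
      obtain ⟨m, hm, rfl⟩ := hmem x hx
      refine ⟨m, ?_, rfl⟩
      rcases Nat.eq_zero_or_pos m with rfl | hm0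
      · exact absurd hx.2 hlU
      · simp; omega

/-- There is an open set of points from which hidden sets have few adherent vertices. -/
lemma exists_few_adherent (h : SimpleCycle n P) (hn : 4 ≤ n) :
    ∃ O : Set Plane, IsOpen O ∧ O.Nonempty ∧ O ⊆ inside (curve P) ∧
      ∀ s ∈ O, ∀ U, IsHidden (curve P) s U → (range P ∩ closure U).ncard ≤ n / 2 - 1 := by
  obtain ⟨a, ha⟩ := h.exists_balanced hn
  have hn1 : a + (n - 1) + 1 = a + n := by omega
  obtain ⟨O, hO, hOne, hOin, hvis⟩ := (h.shift (a + (n - 1))).exists_viewpoints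
  have e1 : P (a + (n - 1) + 1) = P a := by rw [hn1, h.periodic]
  simp only [h.curve_shift, e1] at hOin hvis
  refine ⟨O, hO, hOne, hOin, fun s hs U hU => ?_⟩
  obtain ⟨hv0, hv⟩ := hvis s hs
  have hvis' : ∀ w, Linked n P a w → openSegment ℝ s (P w) ⊆ inside (curve P) := by
    intro w hw
    obtain ⟨j, hj1, -, hj⟩ := h.exists_rep (a + (n - 1)) w
    obtain ⟨k, rfl⟩ := Nat.exists_eq_add_of_le hj1
    rw [h.congr hj]
    refine hv k ((h.linked_shift _).2 (h.linked_congr ?_ hj hw))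
    rw [hn1]; simp [Nat.ModEq]
  have hcs := h.curve_shift a
  have hr : range (fun i => P (a + i)) = range P := by
    refine Subset.antisymm (by rintro _ ⟨i, rfl⟩; exact ⟨_, rfl⟩) ?_
    rintro _ ⟨i, rfl⟩
    obtain ⟨j, hj1, -, hj⟩ := h.exists_rep a i
    obtain ⟨k, rfl⟩ := Nat.exists_eq_add_of_le hj1
    exact ⟨k, (h.congr hj).symm⟩
  rw [← hr]
  refine (h.shift a).ncard_adherent_le (s := s) hn ?_ ?_ ?_ ?_ ?_
  · rw [hcs]; exact hOin hs
  · rwa [hcs]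
  · rw [hcs]; exact hv0
  · intro w hw
    rw [hcs]; exact hvis' _ ((h.linked_shift a).1 hw)
  · intro z hz hzn
    simp only [h.linked_shift a]
    exact ha z hz hzn

/-- The inside of a triangle lies on the inner side of every edge. -/
lemma pos_of_mem_inside (h : SimpleCycle 3 P) (i : ℕ) {x : Plane} (hx : x ∈ inside (curve P)) :
    0 < cross (P (i + 1) - P i) (P (i + 2) - P i) * cross (P (i + 1) - P i) (x - P i) := by
  obtain ⟨c, hc⟩ : ∃ c, c = cross (P (i + 1) - P i) (P (i + 2) - P i) := ⟨_, rfl⟩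
  rw [← hc]
  have hc0 : c ≠ 0 := hc ▸ h.generic _ _ _ (not_modEq_of_lt (by omega) (by omega))
    (not_modEq_of_lt (by omega) (by omega)) (not_modEq_of_lt (by omega) (by omega))
  have hcc : 0 < c * c := mul_self_pos.2 hc0
  have hf : IsAff fun x => c * cross (P (i + 1) - P i) (x - P i) :=
    (isAff_cross_sub _ _).const_mul c
  have hv : ∀ m, 0 ≤ c * cross (P (i + 1) - P i) (P m - P i) := by
    intro m
    obtain ⟨k, h1, h2, hk⟩ := h.exists_rep i m
    rw [h.congr hk]
    obtain rfl | rfl | rfl : k = i ∨ k = i + 1 ∨ k = i + 2 := by omega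
    · simp [cross]
    · rw [cross_self, mul_zero]
    · rw [← hc]; exact hcc.le
  have hC : ∀ y ∈ curve P, 0 ≤ c * cross (P (i + 1) - P i) (y - P i) := by
    intro y hy
    obtain ⟨m, hm⟩ := mem_iUnion.1 hy
    obtain ⟨a, b, ha, hb, hab, rfl⟩ := hm
    have e := hf (P m) (P (m + 1)) a b hab
    simp only at e
    rw [e]
    have := mul_nonneg ha (hv m)
    have := mul_nonneg hb (hv (m + 1))
    linarith
  by_contra hcon
  push Not at hcon
  obtain ⟨δ, hδ, hball⟩ := Metric.isOpen_iff.1 h.isOpen_inside x hx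
  have hd : -(P (i + 2) - P i) ≠ 0 :=
    neg_ne_zero.2 (sub_ne_zero.2 (h.ne_of_lt (by omega) (by omega)).symm)
  have hd' := norm_pos_iff.2 hd
  -- Moving away from the third vertex lowers the height over the edge. From an inner point of
  -- nonpositive height the ray would meet the curve at negative height, which does not occur on the
  -- curve.
  obtain ⟨τ, hτ, hy, -⟩ := h.exists_first_hit hd (ε := δ / 2 / ‖-(P (i + 2) - P i)‖) (o := x)
    (by positivity) fun t ht ht' => hball <| by
      rw [Metric.mem_ball, dist_eq_norm, add_sub_cancel_left, norm_smul, Real.norm_eq_abs,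
        abs_of_pos ht]
      rw [le_div_iff₀ hd'] at ht'
      linarith
  have hτ0 : 0 < τ := lt_trans (by positivity) hτ
  have := hC _ hy
  rw [show x + τ • -(P (i + 2) - P i) - P i = (x - P i) + (-τ) • (P (i + 2) - P i) by module,
    cross_add_right, cross_smul_right, ← hc] at this
  have := mul_pos hτ0 hcc
  linarith

/-- The inside of a triangle is convex. -/
lemma convex_inside (h : SimpleCycle 3 P) : Convex ℝ (inside (curve P)) := by
  obtain ⟨T, hT⟩ : ∃ T : Set Plane, T = ⋂ i : ℕ, {x | 0 < cross (P (i + 1) - P i)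
    (P (i + 2) - P i) * cross (P (i + 1) - P i) (x - P i)} := ⟨_, rfl⟩
  have hTc : Convex ℝ T := hT ▸ convex_iInter fun i =>
    ((isAff_cross_sub _ _).const_mul _).convex_pos
  have hsub : inside (curve P) ⊆ T := fun x hx =>
    hT ▸ mem_iInter.2 fun i => h.pos_of_mem_inside i hx
  obtain ⟨x, hx⟩ := h.inside_nonempty
  have hTs : T ⊆ inside (curve P) := by
    refine h.subset_inside hTc.isPreconnected ?_ (hsub hx) hx
    refine disjoint_left.2 fun y hyT hyC => ?_
    obtain ⟨i, hi⟩ := mem_iUnion.1 hyC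
    rw [hT] at hyT
    have h1 : 0 < cross (P (i + 1) - P i) (P (i + 2) - P i) *
      cross (P (i + 1) - P i) (y - P i) := mem_iInter.1 hyT i
    obtain ⟨a, b, -, -, hab, rfl⟩ := hi
    rw [show a • P i + b • P (i + 1) - P i = b • (P (i + 1) - P i) by
      rw [show a = 1 - b by linarith]; module, cross_smul_right, cross_self, mul_zero,
      mul_zero] at h1
    exact lt_irrefl _ h1
  rw [hsub.antisymm hTs]; exact hTc

end SimpleCycle

end GenKernel

/-! ### From `Polygon` to periodic vertex sequences, and the conclusion. -/

namespace GenKernel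
open Set Filter Topology

/-- The vertices of a polygon as a periodic sequence. -/
def vertexSeq {n : ℕ} (hn : 0 < n) (p : Polygon Plane n) (k : ℕ) : Plane :=
  p ⟨k % n, Nat.mod_lt k hn⟩

section Bridge

variable {n : ℕ} (hn : 0 < n) (p : Polygon Plane n)

lemma val_finRotate (i : Fin n) : (finRotate n i : ℕ) = (i + 1) % n := by
  obtain ⟨m, rfl⟩ : ∃ m, n = m + 1 := ⟨n - 1, by have := i.isLt; omega⟩
  rw [finRotate_apply, Fin.val_add, Fin.val_one', Nat.add_mod_mod]

lemma edge_vertexSeq (k : ℕ) :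
    edge (vertexSeq hn p) k = p.edgeSet ℝ ⟨k % n, Nat.mod_lt k hn⟩ := by
  have : finRotate n ⟨k % n, Nat.mod_lt k hn⟩ = ⟨(k + 1) % n, Nat.mod_lt _ hn⟩ :=
    Fin.ext (by rw [val_finRotate]; simp)
  unfold edge Polygon.edgeSet
  rw [this, affineSegment_eq_segment]
  rfl

lemma range_vertexSeq : range (vertexSeq hn p) = range p.vertices := by
  refine Subset.antisymm (by rintro _ ⟨i, rfl⟩; exact ⟨_, rfl⟩) ?_
  rintro _ ⟨i, rfl⟩
  exact ⟨i, congrArg p.vertices (Fin.ext (Nat.mod_eq_of_lt i.isLt))⟩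

lemma curve_vertexSeq : curve (vertexSeq hn p) = p.boundary ℝ := by
  unfold curve Polygon.boundary
  refine Subset.antisymm (iUnion_subset fun k => ?_) (iUnion_subset fun i => ?_)
  · rw [edge_vertexSeq]; exact subset_iUnion _ _
  · have := edge_vertexSeq hn p i
    simp only [Nat.mod_eq_of_lt i.isLt] at this
    rw [← this]; exact subset_iUnion _ _

lemma region_eq : region p = curve (vertexSeq hn p) ∪ inside (curve (vertexSeq hn p)) := by
  rw [curve_vertexSeq]; rfl

variable {p}

lemma collinear_of_cross_eq_zero {a b c : Plane} (hab : a ≠ b)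
    (h : cross (b - a) (c - a) = 0) : Collinear ℝ {a, b, c} := by
  obtain ⟨t, ht⟩ := exists_eq_smul_of_cross_eq_zero (sub_ne_zero.2 hab.symm) h
  refine (collinear_iff_of_mem (p₀ := a) (by simp)).2 ⟨b - a, ?_⟩
  rintro q (rfl | rfl | rfl)
  · exact ⟨0, by simp⟩
  · exact ⟨1, by simp⟩
  · exact ⟨t, by rw [vadd_eq_add, ← ht]; abel⟩

/-- For indices `i < j < i + n`, edge `j` follows edge `i` if `j = i + 1`, and edge `i` follows edge
`j` around the end of the period if `j + 1 = i + n`. All other pairs are disjoint by assumption. -/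
lemma IsSimple.simpleCycle (h3 : 3 ≤ n) (hs : IsSimple p) (hg : InGeneralPosition p) :
    SimpleCycle n (vertexSeq hn p) where
  three_le := h3
  periodic i := by simp [vertexSeq]
  injective i j hij := congrArg Fin.val (hs.injective hij)
  generic i j k hij hjk hik h0 := by
    refine hg ⟨i % n, Nat.mod_lt i hn⟩ ⟨j % n, Nat.mod_lt j hn⟩ ⟨k % n, Nat.mod_lt k hn⟩
      (fun e => hij (congrArg Fin.val e)) (fun e => hjk (congrArg Fin.val e))
      (fun e => hik (congrArg Fin.val e)) (collinear_of_cross_eq_zero ?_ h0)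
    exact fun e => hij (congrArg Fin.val (hs.injective e))
  edge_inter i j x hij hj hi hxj := by
    have hmod : ∀ a b : ℕ, (⟨a % n, Nat.mod_lt a hn⟩ : Fin n) = ⟨b % n, Nat.mod_lt b hn⟩ ↔
        a ≡ b [MOD n] := fun a b => Fin.mk.injEq _ _ _ _ ▸ Iff.rfl
    have hrot : ∀ a : ℕ, finRotate n ⟨a % n, Nat.mod_lt a hn⟩ =
        ⟨(a + 1) % n, Nat.mod_lt _ hn⟩ := fun a => Fin.ext (by rw [val_finRotate]; simp)
    have hcons : ∀ a : ℕ, ∀ x, x ∈ edge (vertexSeq hn p) a → x ∈ edge (vertexSeq hn p) (a + 1) →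
        x = vertexSeq hn p (a + 1) := by
      intro a x h1 h2
      rw [edge_vertexSeq] at h1 h2
      have := hs.consecutive ⟨a % n, Nat.mod_lt a hn⟩
      rw [hrot] at this
      exact this.subset ⟨h1, h2⟩
    have hper : ∀ a, edge (vertexSeq hn p) (a + n) = edge (vertexSeq hn p) a := by
      intro a; rw [edge_vertexSeq, edge_vertexSeq]; simp
    by_cases h1 : j = i + 1
    · subst h1; exact Or.inl ⟨rfl, hcons i x hi hxj⟩
    by_cases h2 : j + 1 = i + n
    · refine Or.inr ⟨h2, ?_⟩
      rw [← hper, ← h2] at hi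
      rw [hcons j x hxj hi, h2]; simp [vertexSeq]
    exfalso
    rw [edge_vertexSeq] at hi hxj
    refine disjoint_left.1 (hs.disjoint _ _ ?_ ?_ ?_) hi hxj
    · rw [Ne, hmod]; exact fun e => not_modEq_of_lt hij hj e.symm
    · rw [hrot, Ne, hmod]
      exact fun e => not_modEq_of_lt (n := n) (i := i + 1) (j := j) (by omega) (by omega) e.symm
    · rw [hrot, Ne, hmod]
      intro e
      refine not_modEq_of_lt (n := n) (i := j + 1) (j := i + n) (by omega) (by omega) ?_
      exact e.symm.trans (by simp [Nat.ModEq])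

/-- A pocket is not crossed by a segment to a visible point of the boundary. -/
lemma IsPocket.isHidden {s : Plane} {U : Set Plane} (hI : interior (region p) =
    inside (curve (vertexSeq hn p))) (hU : IsPocket p s U) :
    IsHidden (curve (vertexSeq hn p)) s U := by
  obtain ⟨x, -, rfl⟩ := hU
  have hsub := connectedComponentIn_subset (region p \ closure (visible p s)) x
  refine ⟨isPreconnected_connectedComponentIn, ?_, fun w _ hw => ?_⟩
  · rw [← region_eq]; exact hsub.trans sdiff_subset
  · have h1 : openSegment ℝ s w ⊆ visible p s := by
      intro t ht
      refine ⟨?_, ?_⟩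
      · rw [region_eq hn]; exact Or.inr (hw ht)
      · rw [hI]
        rw [openSegment_symm]
        exact (openSegment_subset_of_mem ht).trans hw
    have h2 := closure_mono h1
    rw [closure_openSegment] at h2
    exact disjoint_left.2 fun z hz hz' => (hsub hz).2 (h2 hz')

end Bridge

end GenKernel

theorem mainTheorem4 (n : ℕ) (hn : 3 ≤ n) (p : Polygon GenKernel.Plane n)
    (hsimple : GenKernel.IsSimple p) (hgen : GenKernel.InGeneralPosition p) :
    (interior (GenKernel.genKernel p (n / 2 - 1))).Nonempty := by
  have hn0 : 0 < n := by omega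
  have h := hsimple.simpleCycle hn0 hn hgen
  have hI : interior (GenKernel.region p) =
      GenKernel.inside (GenKernel.curve (GenKernel.vertexSeq hn0 p)) := by
    rw [GenKernel.region_eq hn0, h.interior_union_inside]
  -- For `n = 3` the bound is `3 / 2 - 1 = 0`, and no pocket exists at all: the inside is convex, so
  -- it is visible from each of its points, and its closure contains the curve.
  rcases hn.eq_or_lt with rfl | h4
  · have hsub : interior (GenKernel.region p) ⊆ GenKernel.genKernel p (3 / 2 - 1) := by
      rintro s hs
      refine ⟨hs, ?_⟩
      rintro U ⟨x, hx, -⟩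
      refine (hx.2 ?_).elim
      rw [hI] at hs
      have h1 : GenKernel.inside (GenKernel.curve (GenKernel.vertexSeq hn0 p)) ⊆
          GenKernel.visible p s := fun t ht =>
        ⟨by rw [GenKernel.region_eq hn0]; exact Or.inr ht,
          hI ▸ h.convex_inside.openSegment_subset hs ht⟩
      have hxr := hx.1
      rw [GenKernel.region_eq hn0] at hxr
      rcases hxr with hxr | hxr
      · exact closure_mono h1 (h.curve_subset_closure_inside hxr)
      · exact subset_closure (h1 hxr)
    obtain ⟨x, hx⟩ := h.inside_nonempty
    exact ⟨x, interior_maximal hsub isOpen_interior (hI ▸ hx)⟩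
  · obtain ⟨O, hO, ⟨x, hx⟩, hOin, hfew⟩ := h.exists_few_adherent h4
    refine ⟨x, interior_maximal ?_ hO hx⟩
    intro s hs
    refine ⟨?_, fun U hU => (Set.ncard_le_ncard ?_ ?_).trans
      (hfew s hs U (hU.isHidden hn0 hI))⟩
    · rw [hI]; exact hOin hs
    · rw [GenKernel.range_vertexSeq]
      exact Set.inter_subset_inter_right _ frontier_subset_closure
    · exact h.finite_range.subset Set.inter_subset_left
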